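/- Let $n\ge 0$. Let $\mathcal L_{\lambda,y}$ be the algebra of fractions $f/g$ with $f\in\mathbb C[\lambda,y]$ and $g$ a finite product of factors $\lambda+ly$, $l\in\mathbb Z$; let $\mathcal L_{\lambda,(\mathbf z,y)}=\mathcal L_{\lambda,y}\otimes_{\mathbb C[y]}\mathbb C(z_1,\dots,z_n,y)\subset\mathbb C(\lambda,\mathbf z,y)$, and let $\delta:\zeta(\lambda)\mapsto\zeta(\lambda+y)$. **The module $V$.** Let $V=V(z_1)\otimes\dots\otimes V(z_n)=(\mathbb C^2)^{\otimes n}\otimes\mathcal L_{\lambda,(\mathbf z,y)}$, with basis $v_I=v_{i_1}\otimes\dots\otimes v_{i_n}$, $I\subset[n]$, where $i_j=1$ if $j\in I$ and $i_j=2$ if $j\notin I$. Let $h^{(j)}v_I=v_I$ if $j\in I$, $h^{(j)}v_I=-v_I$ if $j\notin I$, and $h=\sum_jh^{(j)}$. Let $R(\lambda,w,y)$ be the rational dynamical R-matrix, given in the basis $v_1\otimes v_1,\ v_1\otimes v_2,\ v_2\otimes v_1,\ v_2\otimes v_2$ by $$R(\lambda,w,y)=\begin{pmatrix}1&0&0&0\\0&\frac{(\lambda+y)w}{\lambda(w-y)}&-\frac{(\lambda+w)y}{\lambda(w-y)}&0\\0&-\frac{(\lambda-w)y}{\lambda(w-y)}&\frac{(\lambda-y)w}{\lambda(w-y)}&0\\0&0&0&1\end{pmatrix}.$$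 The L-operator on $\mathbb C^2\otimes(\mathbb C^2)^{\otimes n}$ (auxiliary factor numbered $0$) is $$L(\lambda,w,y)=R^{(0,1)}\Big(\lambda-y\sum_{j=2}^nh^{(j)},w-z_1,y\Big)\cdots R^{(0,n-1)}(\lambda-yh^{(n)},w-z_{n-1},y)\,R^{(0,n)}(\lambda,w-z_n,y),$$ where $R^{(0,j)}$ acts as $R$ in the factors $0$ and $j$, and the operators $h^{(i)}$ in its argument are replaced by their eigenvalues on the basis vector it is applied to. Write $L(\lambda,w,y)(v_j\otimes x)=\sum_iv_i\otimes L_{ij}(\lambda,w,y)x$ with $L_{ij}(\lambda,w,y)=\sum_{s\ge0}L_{ij,s}(\lambda,y)w^{-s}$, $i,j=1,2$ (expansion at $w=\infty$). The rational dynamical quantum group $E_y(\mathfrak{gl}_2)$ acts on $V$ through its operator algebra, which is generated over $\mathbb C$ by the difference operators $$\tilde L_{i1,s}(y)=L_{i1,s}(\lambda,y)\,\delta^{-1},\qquad \tilde L_{i2,s}(y)=L_{i2,s}(\lambda,y)\,\delta\qquad(i=1,2,\ s\ge0),$$ where $\delta$ acts on coordinates in the basis $v_I$, and by the operators $f(\lambda,yh,y)$,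 where $f=p/q$, $p$ is a polynomial in $\lambda,yh,y$ and $q$ is a finite product of factors $\lambda+kyh+ly$, $k,l\in\mathbb Z$. An $E_y(\mathfrak{gl}_2)$-submodule is a complex subspace preserved by the operator algebra. **Cohomology.** For $0\le k\le n$ let $\Gamma=(\gamma_{1,1},\dots,\gamma_{1,k};\gamma_{2,1},\dots,\gamma_{2,n-k})$ and use the standard presentations $$H^*_T(T^*Gr_k\mathbb C^n)=\mathbb C[\Gamma,\mathbf z,y]^{S_k\times S_{n-k}}/\sim,\qquad H^*_{GL_n\times\mathbb C^\times}(T^*Gr_k\mathbb C^n)=\mathbb C[\Gamma,\mathbf z,y]^{S_k\times S_{n-k}\times S_n}/\sim,$$ where $\sim$ is the ideal generated by the coefficients of the powers of $u$ in $\prod_{i=1}^k(u-\gamma_{1,i})\prod_{i=1}^{n-k}(u-\gamma_{2,i})-\prod_{i=1}^n(u-z_i)$; here $T=(\mathbb C^\times)^n\times\mathbb C^\times$. For $|I|=k$, the restriction to the fixed point $x_I$ is the substitution $\{\gamma_{1,*}\}\mapsto z_I=\{z_a\mid a\in I\}$, $\{\gamma_{2,*}\}\mapsto\{z_a\mid a\notin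 I\}$; write $f(\mathbf z_I,\mathbf z,y)$ for the value of $f(\Gamma,\mathbf z,y)$. Put $H^*_T(\mathcal X_n)=\bigoplus_{k=0}^nH^*_T(T^*Gr_k\mathbb C^n)$; tensor products of $H^*_T$ with $\mathcal L_{\lambda,(\mathbf z,y)}$ are over $\mathbb C[\mathbf z,y]$. **Weight functions.** For $I=\{i_1<\dots<i_k\}\subset[n]$ let $w(i,I)=\#\{j>i\mid j\in I\}-\#\{j>i\mid j\notin I\}$, $$W_I(\lambda,\mathbf t,\mathbf z,y)=y^k\sum_{\sigma\in S_k}\Big(\prod_{r=1}^k\prod_{a=1}^nl_I(r,a)\prod_{1\le a<b\le k}\frac{t_a-t_b+y}{t_a-t_b}\Big)\Big|_{t_r\mapsto t_{\sigma(r)}},$$ where $l_I(r,a)$ is $t_r-z_a+y$ for $a<i_r$, $\lambda+t_r-z_a-w(i_r,I)y$ for $a=i_r$, and $t_r-z_a$ for $a>i_r$. For $\sigma\in S_n$ let $W_{\sigma,I}(\lambda,\mathbf t,\mathbf z,y)=W_{\sigma^{-1}(I)}(\lambda,\mathbf t,z_{\sigma(1)},\dots,z_{\sigma(n)},y)$,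 and let $s_0$ be the longest permutation. With $e_k=\prod_{a,b=1}^k(t_a-t_b+y)$ and $C^{(r)}_I=\prod_{i\in I}(\lambda-(w(i,I)+r)y)$ put $$\tilde W^+_I=\frac{W_I(\lambda,\mathbf t,\mathbf z,y)}{C^{(0)}_IC^{(1)}_Ie_k},\qquad \tilde W^-_I=\frac{(-1)^k}{e_k}W_{s_0,I}(-\lambda-(n-2k)y,\mathbf t,\mathbf z,y).$$ With $R_I=\prod_{a\in I,b\notin I}(z_a-z_b)$ and $Q_I=\prod_{a\in I,b\notin I}(z_a-z_b+y)$ put $\xi_I=Q_I^{-1}\sum_{|J|=|I|}\tilde W^-_J(\lambda,\mathbf z_I,\mathbf z,y)\,v_J$. Let $\mathcal V=\bigoplus_{k=0}^n\mathcal V_k\subset V$, where $\mathcal V_k$ is the space of all elements $$\sum_{|I|=k}\frac{f(\lambda,\mathbf z_I,\mathbf z,y)}{R_I}\,\xi_I,\qquad f\in\mathbb C[\Gamma]^{S_k\times S_{n-k}}\otimes\mathbb C[\mathbf z]^{S_n}\otimes\mathcal L_{\lambda,y}\otimes\mathbb C[y^{\pm1}].$$ **Lemma.** There is a unique isomorphism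 of $\mathcal L_{\lambda,(\mathbf z,y)}$-modules $\mathrm{Stab}:V\to H^*_T(\mathcal X_n)\otimes\mathcal L_{\lambda,(\mathbf z,y)}$ such that, for every $I\subset[n]$, $\mathrm{Stab}(v_I)$ lies in the summand $k=|I|$ and has restriction $\tilde W^+_I(\lambda,\mathbf z_J,\mathbf z,y)$ at $x_J$ for each $J$ with $|J|=|I|$. Let $E_y(\mathfrak{gl}_2)$ act on $H^*_T(\mathcal X_n)\otimes\mathcal L_{\lambda,(\mathbf z,y)}$ by transport of structure along $\mathrm{Stab}$. Then the space $$\bigoplus_{k=0}^nH^*_{GL_n\times\mathbb C^\times}(T^*Gr_k\mathbb C^n)\otimes\mathcal L_{\lambda,y}\otimes\mathbb C[y^{\pm1}]$$ (the complex span of the products $[f]\cdot g$ with $[f]\in H^*_{GL_n\times\mathbb C^\times}(T^*Gr_k\mathbb C^n)$ and $g\in\mathcal L_{\lambda,y}\otimes\mathbb C[y^{\pm1}]$) is an $E_y(\mathfrak{gl}_2)$-submodule of $H^*_T(\mathcal X_n)\otimes\mathcal L_{\lambda,(\mathbf z,y)}$. Equivalently, $\mathcal V$ is an $E_y(\mathfrak{gl}_2)$-submodule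 of $V(z_1)\otimes\dots\otimes V(z_n)$: an element $\zeta\in V$ lies in $\mathcal V$ if and only if $\mathrm{Stab}(\zeta)$ lies in the space displayed above. -/

import Mathlib

open scoped TensorProduct

noncomputable section

namespace DynGr

/-! ### Coefficient rings -/

/-- `ℂ[z₁, …, zₙ, y]`; the variable `some i` is `zᵢ` and `none` is `y`. -/
abbrev PolyZY (n : ℕ) : Type := MvPolynomial (Option (Fin n)) ℂ

/-- The field `ℂ(z₁, …, zₙ, y)`. -/
def FieldZY (n : ℕ) : Type := FractionRing (PolyZY n)

instance instFieldFieldZY (n : ℕ) : Field (FieldZY n) :=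
  inferInstanceAs (Field (FractionRing (PolyZY n)))

instance instAlgebraFieldZY (n : ℕ) : Algebra (PolyZY n) (FieldZY n) :=
  inferInstanceAs (Algebra (PolyZY n) (FractionRing (PolyZY n)))

instance instComplexAlgebraFieldZY (n : ℕ) : Algebra ℂ (FieldZY n) :=
  inferInstanceAs (Algebra ℂ (FractionRing (PolyZY n)))

instance instTowerFieldZY (n : ℕ) : IsScalarTower ℂ (PolyZY n) (FieldZY n) :=
  inferInstanceAs (IsScalarTower ℂ (PolyZY n) (FractionRing (PolyZY n)))

instance instFractionFieldZY (n : ℕ) : IsFractionRing (PolyZY n) (FieldZY n) :=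
  inferInstanceAs (IsFractionRing (PolyZY n) (FractionRing (PolyZY n)))

/-- The field `ℂ(λ, z₁, …, zₙ, y)`; here `λ` is `RatFunc.X`. -/
abbrev RatK (n : ℕ) : Type := RatFunc (FieldZY n)

/-- The element `λ`. -/
def lamK (n : ℕ) : RatK n := RatFunc.X

/-- The element `y`. -/
def yK (n : ℕ) : RatK n := algebraMap (PolyZY n) (RatK n) (MvPolynomial.X none)

/-- The elements `zᵢ`. -/
def zK (n : ℕ) (i : Fin n) : RatK n :=
  algebraMap (PolyZY n) (RatK n) (MvPolynomial.X (some i))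

/-- The algebra `𝓛_{λ,(z,y)}`: fractions whose numerator is a polynomial in `λ` with coefficients
in `ℂ(z, y)` and whose denominator is a finite product of factors `λ + l y`, `l ∈ ℤ`. -/
def Lfull (n : ℕ) : Subalgebra (FieldZY n) (RatK n) :=
  Algebra.adjoin (FieldZY n)
    ({lamK n} ∪ Set.range fun l : ℤ => (lamK n + (l : RatK n) * yK n)⁻¹)

/-- The algebra `𝓛_{λ,y} ⊗ ℂ[y, y⁻¹]`: fractions whose numerator is a polynomial in `λ, y, y⁻¹`
and whose denominator is a finite product of factors `λ + l y`, `l ∈ ℤ`. -/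
def Lsmall (n : ℕ) : Subalgebra ℂ (RatK n) :=
  Algebra.adjoin ℂ
    ({lamK n, yK n, (yK n)⁻¹} ∪ Set.range fun l : ℤ => (lamK n + (l : RatK n) * yK n)⁻¹)

/-- The substitution `λ ↦ λ + m y` on `ℂ(λ, z, y)`. -/
def shiftK (n : ℕ) (m : ℤ) : RatK n ≃ₐ[FieldZY n] RatK n :=
  IsFractionRing.fieldEquivOfAlgEquiv (FieldZY n) (RatK n) (RatK n)
    (Polynomial.algEquivAevalXAddC
      ((m : FieldZY n) * algebraMap (PolyZY n) (FieldZY n) (MvPolynomial.X none)))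

theorem shiftK_lamK (n : ℕ) (m : ℤ) : shiftK n m (lamK n) = lamK n + (m : RatK n) * yK n := by
  have h : lamK n = algebraMap (Polynomial (FieldZY n)) (RatK n) Polynomial.X := by
    simp [lamK]
  rw [h, shiftK, IsFractionRing.fieldEquivOfAlgEquiv_algebraMap]
  simp [yK, IsScalarTower.algebraMap_apply (PolyZY n) (FieldZY n) (RatK n)]

theorem shiftK_yK (n : ℕ) (m : ℤ) : shiftK n m (yK n) = yK n := by
  rw [yK, IsScalarTower.algebraMap_apply (PolyZY n) (FieldZY n) (RatK n)]
  exact (shiftK n m).commutes _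

theorem shiftK_mem (n : ℕ) (m : ℤ) : Lfull n ≤ (Lfull n).comap (shiftK n m).toAlgHom := by
  refine Algebra.adjoin_le ?_
  have hy : yK n ∈ Lfull n := by
    rw [yK, IsScalarTower.algebraMap_apply (PolyZY n) (FieldZY n) (RatK n)]
    exact (Lfull n).algebraMap_mem _
  rintro x (rfl | ⟨l, rfl⟩)
  · change shiftK n m (lamK n) ∈ Lfull n
    rw [shiftK_lamK]
    exact add_mem (Algebra.subset_adjoin (Or.inl rfl))
      (mul_mem (intCast_mem _ _) hy)
  · change shiftK n m ((lamK n + (l : RatK n) * yK n)⁻¹) ∈ Lfull n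
    have h : shiftK n m ((lamK n + (l : RatK n) * yK n)⁻¹)
        = (lamK n + (m : RatK n) * yK n + (l : RatK n) * yK n)⁻¹ := by
      rw [map_inv₀, map_add, map_mul, shiftK_lamK, shiftK_yK, map_intCast]
    rw [h]
    refine Algebra.subset_adjoin (Or.inr ⟨m + l, ?_⟩)
    push_cast
    ring_nf

/-- The substitution `λ ↦ λ + m y` on `𝓛_{λ,(z,y)}`. -/
def shiftL (n : ℕ) (m : ℤ) : Lfull n →ₐ[FieldZY n] Lfull n :=
  ((shiftK n m).toAlgHom.comp (Lfull n).val).codRestrict (Lfull n)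
    (fun x => shiftK_mem n m x.2)

/-- `y` as an element of `𝓛_{λ,(z,y)}`. -/
def yL (n : ℕ) : Lfull n := algebraMap (PolyZY n) (Lfull n) (MvPolynomial.X none)

/-- `zᵢ` as an element of `𝓛_{λ,(z,y)}`. -/
def zL (n : ℕ) (i : Fin n) : Lfull n := algebraMap (PolyZY n) (Lfull n) (MvPolynomial.X (some i))

/-- `λ` as an element of `𝓛_{λ,(z,y)}`. -/
def lamL (n : ℕ) : Lfull n := ⟨lamK n, Algebra.subset_adjoin (Or.inl rfl)⟩

/-- `(λ + l y)⁻¹` as an element of `𝓛_{λ,(z,y)}`. -/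
def invL (n : ℕ) (l : ℤ) : Lfull n :=
  ⟨(lamK n + (l : RatK n) * yK n)⁻¹, Algebra.subset_adjoin (Or.inr ⟨l, rfl⟩)⟩

/-! ### The tensor product of evaluation modules -/

/-- `V(z₁) ⊗ ⋯ ⊗ V(zₙ) = (ℂ²)^{⊗n} ⊗ 𝓛_{λ,(z,y)}`, in coordinates with respect to the basis `v_I`,
`I ⊆ [n]`, where `v_I = v_{i₁} ⊗ ⋯ ⊗ v_{iₙ}` with `i_j = 1` for `j ∈ I` and `i_j = 2` for
`j ∉ I`. -/
abbrev V (n : ℕ) : Type := Finset (Fin n) → Lfull n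

/-- The power series `1 / (1 - c u) = ∑ cˢ uˢ`. -/
def geom {A : Type*} [CommRing A] (c : A) : PowerSeries A := PowerSeries.mk fun s => c ^ s

theorem geom_mul {A : Type*} [CommRing A] (c : A) :
    geom c * (1 - PowerSeries.C c * PowerSeries.X) = 1 := by
  ext s
  rcases s with _ | s
  · simp [geom, mul_sub, ← mul_assoc]
  · simp [geom, mul_sub, ← mul_assoc, PowerSeries.coeff_succ_mul_X, PowerSeries.coeff_one, pow_succ]

/-- Entries of the rational dynamical R-matrix `R(Λ, w - c, y)` at `Λ = λ - m y`, expanded at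
`w = ∞` in powers of `u = w⁻¹`. `Rentry n m c p q` is the coefficient of `v_{p.1} ⊗ v_{p.2}` in
`R (v_{q.1} ⊗ v_{q.2})`; the indices `1, 2` are written `0, 1`. The expansion uses
`(w - c) / (w - c - y) = (1 - c u) / (1 - (c + y) u)`,
`(Λ + w - c) / (w - c - y) = (1 + (Λ - c) u) / (1 - (c + y) u)` and
`(Λ - w + c) / (w - c - y) = ((Λ + c) u - 1) / (1 - (c + y) u)`. -/
def Rentry (n : ℕ) (m : ℤ) (c : Lfull n) : Fin 2 × Fin 2 → Fin 2 × Fin 2 → PowerSeries (Lfull n) :=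
  let Λ : Lfull n := lamL n - (m : Lfull n) * yL n
  let Λi : Lfull n := invL n (-m)
  let y : Lfull n := yL n
  let u : PowerSeries (Lfull n) := PowerSeries.X
  let g : PowerSeries (Lfull n) := geom (c + y)
  fun p q =>
    if p = (0, 0) ∧ q = (0, 0) then 1
    else if p = (0, 1) ∧ q = (0, 1) then
      PowerSeries.C ((Λ + y) * Λi) * (1 - PowerSeries.C c * u) * g
    else if p = (0, 1) ∧ q = (1, 0) then
      -PowerSeries.C (y * Λi) * (1 + PowerSeries.C (Λ - c) * u) * g
    else if p = (1, 0) ∧ q = (0, 1) then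
      -PowerSeries.C (y * Λi) * (PowerSeries.C (Λ + c) * u - 1) * g
    else if p = (1, 0) ∧ q = (1, 0) then
      PowerSeries.C ((Λ - y) * Λi) * (1 - PowerSeries.C c * u) * g
    else if p = (1, 1) ∧ q = (1, 1) then 1
    else 0

/-- The index of the `j`-th factor of `v_I` (`0` for `v₁` and `1` for `v₂`). -/
def slot {n : ℕ} (I : Finset (Fin n)) (j : Fin n) : Fin 2 := if j ∈ I then 0 else 1

/-- The eigenvalue of `∑_{i > j} h^{(i)}` on `v_I`. -/
def tailWeight {n : ℕ} (I : Finset (Fin n)) (j : Fin n) : ℤ :=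
  ∑ i ∈ Finset.univ.filter (fun i => j < i), if i ∈ I then 1 else -1

/-- The operator `R^{(0,j)}(λ - y ∑_{i > j} h^{(i)}, w - z_j, y)` on `ℂ² ⊗ (ℂ²)^{⊗n}`, where the
auxiliary factor `ℂ²` is the one numbered `0`. -/
def R0 (n : ℕ) (j : Fin n) :
    Matrix (Fin 2 × Finset (Fin n)) (Fin 2 × Finset (Fin n)) (PowerSeries (Lfull n)) :=
  Matrix.of fun p q =>
    if p.2.erase j = q.2.erase j then
      Rentry n (tailWeight q.2 j) (zL n j) (p.1, slot p.2 j) (q.1, slot q.2 j)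
    else 0

/-- The L-operator `R^{(0,1)}(λ - y ∑_{i ≥ 2} h^{(i)}, w - z₁, y) ⋯ R^{(0,n)}(λ, w - zₙ, y)`,
expanded in powers of `w⁻¹`. -/
def Lop (n : ℕ) :
    Matrix (Fin 2 × Finset (Fin n)) (Fin 2 × Finset (Fin n)) (PowerSeries (Lfull n)) :=
  (List.ofFn (R0 n)).prod

/-- The matrix coefficients of `L_{ij,s}(λ, y)`, the coefficient of `w^{-s}` in the `(i, j)` entry
of the L-operator. -/
def Lcoeff (n : ℕ) (i j : Fin 2) (s : ℕ) (P Q : Finset (Fin n)) : Lfull n :=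
  PowerSeries.coeff s (Lop n (i, P) (j, Q))

/-- The operator `L̃_{ij,s}(y)`: the composition of `L_{ij,s}(λ, y)` with the shift
`ζ(λ) ↦ ζ(λ - y)` if `j = 1` and `ζ(λ) ↦ ζ(λ + y)` if `j = 2`. -/
def Ltilde (n : ℕ) (i j : Fin 2) (s : ℕ) : Module.End ℂ (V n) where
  toFun ζ := fun P => ∑ Q, Lcoeff n i j s P Q * shiftL n (if j = 0 then -1 else 1) (ζ Q)
  map_add' ζ η := by
    funext P
    simp [mul_add, Finset.sum_add_distrib]
  map_smul' c ζ := by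
    funext P
    have h : ∀ (m : ℤ) (x : Lfull n), shiftL n m (c • x) = c • shiftL n m x := fun m x => by
      rw [← IsScalarTower.algebraMap_smul (FieldZY n) c x, map_smul,
        IsScalarTower.algebraMap_smul]
    simp only [Pi.smul_apply, h, mul_smul_comm, Finset.smul_sum, RingHom.id_apply]

/-- The action of `f(λ, yh, y)`, where `f(λ, x, y)` is the quotient of the polynomial `p` by the
product of the factors `λ + k x + l y`, `(k, l) ∈ D`. On `v_I` the element `h` acts as
`2|I| - n`. -/
def cartan (n : ℕ) (p : MvPolynomial (Fin 3) ℂ) (D : Multiset (ℤ × ℤ)) : Module.End ℂ (V n) where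
  toFun ζ := fun I =>
    let m : ℤ := 2 * (I.card : ℤ) - n
    MvPolynomial.aeval ![lamL n, (m : Lfull n) * yL n, yL n] p
      * (D.map fun kl => invL n (kl.1 * m + kl.2)).prod * ζ I
  map_add' ζ η := by
    funext I
    simp [mul_add]
  map_smul' c ζ := by
    funext I
    simp

/-- The operator algebra, by which `E_y(gl₂)` acts on `V(z₁) ⊗ ⋯ ⊗ V(zₙ)`: it is generated by the
operators `f(λ, yh, y)`, `f ∈ 𝓛_{λ,yh,y}`, and `L̃_{ij,s}(y)`, `i, j = 1, 2`, `s ≥ 0`. -/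
def operatorAlgebra (n : ℕ) : Subalgebra ℂ (Module.End ℂ (V n)) :=
  Algebra.adjoin ℂ
    ({a | ∃ p D, a = cartan n p D} ∪ {a | ∃ i j s, a = Ltilde n i j s})

/-! ### Weight functions -/

section Weight

variable {F : Type*} [Field F] {n k : ℕ}

/-- `w(i, I) = -#{j > i, j ∉ I} + #{j > i, j ∈ I}`. -/
def wt (I : Finset (Fin n)) (i : Fin n) : ℤ :=
  -((Finset.univ.filter fun j => i < j ∧ j ∉ I).card : ℤ)
    + ((Finset.univ.filter fun j => i < j ∧ j ∈ I).card : ℤ)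

/-- `C^{(r)}_I = ∏_{i ∈ I} (λ - (w(i, I) + r) y)`. -/
def Cfac (r : ℤ) (I : Finset (Fin n)) (lam y : F) : F :=
  ∏ i ∈ I, (lam - ((wt I i + r : ℤ) : F) * y)

/-- The factor `l_I(r, a)`, where `ir` is the `r`-th element of `I` and `tr = t_r`. -/
def lfac (I : Finset (Fin n)) (lam tr : F) (z : Fin n → F) (y : F) (ir a : Fin n) : F :=
  if a < ir then tr - z a + y
  else if a = ir then lam + tr - z a - (wt I ir : F) * y
  else tr - z a

/-- The weight function `W_I(λ, t, z, y)` of a `k`-element subset `I ⊆ [n]`. -/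
def W (I : Finset (Fin n)) (hI : I.card = k) (lam : F) (t : Fin k → F) (z : Fin n → F) (y : F) :
    F :=
  y ^ k * ∑ σ : Equiv.Perm (Fin k),
    (∏ r, ∏ a, lfac I lam (t (σ r)) z y (I.orderEmbOfFin hI r) a) *
      ∏ a, ∏ b ∈ Finset.univ.filter (fun b => a < b),
        (t (σ a) - t (σ b) + y) / (t (σ a) - t (σ b))

/-- `W_{σ,I}(λ, t, z, y) = W_{σ⁻¹(I)}(λ, t, z_{σ(1)}, …, z_{σ(n)}, y)`. -/
def Wperm (σ : Equiv.Perm (Fin n)) (I : Finset (Fin n)) (hI : I.card = k) (lam : F)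
    (t : Fin k → F) (z : Fin n → F) (y : F) : F :=
  W (I.map (σ⁻¹).toEmbedding) ((Finset.card_map _).trans hI) lam t (fun i => z (σ i)) y

/-- `e_k(t, y) = ∏_{a, b} (t_a - t_b + y)`. -/
def ek (t : Fin k → F) (y : F) : F := ∏ a, ∏ b, (t a - t b + y)

/-- `W̃⁺_I = W_I / (C^{(0)}_I C^{(1)}_I e_k)`. -/
def Wplus (I : Finset (Fin n)) (hI : I.card = k) (lam : F) (t : Fin k → F) (z : Fin n → F)
    (y : F) : F :=
  1 / (Cfac 0 I lam y * Cfac 1 I lam y * ek t y) * Wperm 1 I hI lam t z y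

/-- `W̃⁻_I = (-1)^k / e_k · W_{s₀,I}(-λ - (n - 2k) y, t, z, y)` with `s₀` the longest
permutation. -/
def Wminus (I : Finset (Fin n)) (hI : I.card = k) (lam : F) (t : Fin k → F) (z : Fin n → F)
    (y : F) : F :=
  (-1) ^ k / ek t y * Wperm Fin.revPerm I hI (-lam - ((n : F) - 2 * (k : F)) * y) t z y

end Weight

/-- The `k`-element subsets of `[n]`. -/
abbrev Sub (n k : ℕ) : Type := {I : Finset (Fin n) // I.card = k}

theorem card_compl_sub {n k : ℕ} (I : Sub n k) : (I.1ᶜ).card = n - k := by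
  rw [Finset.card_compl, Fintype.card_fin, I.2]

/-- `{γ_{1,1}, …, γ_{1,k}, γ_{2,1}, …, γ_{2,n-k}}`. -/
abbrev Gam (n k : ℕ) : Type := Fin k ⊕ Fin (n - k)

/-- The assignment `γ_{1,*} ↦ {z_a | a ∈ I}`, `γ_{2,*} ↦ {z_a | a ∉ I}`: the index of the variable
`z` that is substituted. -/
def fixedPt {n k : ℕ} (I : Sub n k) : Gam n k → Fin n :=
  Sum.elim (I.1.orderEmbOfFin I.2) (I.1ᶜ.orderEmbOfFin (card_compl_sub I))

/-- The tuple `z_I` (only the elements with index in `I`). -/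
def zSub {n k : ℕ} (I : Sub n k) : Fin k → RatK n := fun r => zK n (I.1.orderEmbOfFin I.2 r)

/-- `R_I = ∏_{a ∈ I, b ∉ I} (z_a - z_b)`. -/
def RI {n k : ℕ} (I : Sub n k) : RatK n := ∏ a ∈ I.1, ∏ b ∈ I.1ᶜ, (zK n a - zK n b)

/-- `Q_I = ∏_{a ∈ I, b ∉ I} (z_a - z_b + y)`. -/
def QI {n k : ℕ} (I : Sub n k) : RatK n := ∏ a ∈ I.1, ∏ b ∈ I.1ᶜ, (zK n a - zK n b + yK n)

/-- The coefficient of `v_J` in `ξ_I = Q_I⁻¹ ∑_J W̃⁻_J(λ, z_I, z, y) v_J`. -/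
def xi {n k : ℕ} (I : Sub n k) (J : Finset (Fin n)) : RatK n :=
  if hJ : J.card = k then 1 / QI I * Wminus J hJ (lamK n) (zSub I) (zK n) (yK n) else 0

/-! ### The subspace `𝓥` -/

/-- `f(Γ, z)` is invariant under the group `S_k × S_{n-k} × S_n`. -/
def IsInvGz {n k : ℕ} {B : Type*} [CommRing B] (f : MvPolynomial (Gam n k ⊕ Fin n) B) : Prop :=
  ∀ (σ : Equiv.Perm (Fin k)) (τ : Equiv.Perm (Fin (n - k))) (ρ : Equiv.Perm (Fin n)),
    MvPolynomial.rename (Sum.map (Sum.map σ τ) ρ) f = f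

/-- `f(λ, z_I, z, y)` for a polynomial `f` in `Γ, z` with coefficients in
`𝓛_{λ,y} ⊗ ℂ[y, y⁻¹]`. -/
def evalGz {n k : ℕ} (I : Sub n k) (f : MvPolynomial (Gam n k ⊕ Fin n) (Lsmall n)) : RatK n :=
  MvPolynomial.aeval (Sum.elim (fun g => zK n (fixedPt I g)) (zK n)) f

/-- `𝓥_k`: the elements `∑_{I} f(λ, z_I, z, y) / R_I · ξ_I`, the sum being over the `k`-element
subsets `I`, where `f` runs over
`ℂ[Γ]^{S_k × S_{n-k}} ⊗ ℂ[z]^{S_n} ⊗ 𝓛_{λ,y} ⊗ ℂ[y, y⁻¹]`. -/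
def Vk (n k : ℕ) : Submodule ℂ (V n) where
  carrier := {ζ | ∃ f : MvPolynomial (Gam n k ⊕ Fin n) (Lsmall n), IsInvGz f ∧
    ∀ J, (ζ J : RatK n) = ∑ I : Sub n k, evalGz I f / RI I * xi I J}
  zero_mem' := ⟨0, fun _ _ _ => map_zero _, fun J => by simp [evalGz]⟩
  add_mem' := by
    rintro a b ⟨f, hf, ha⟩ ⟨g, hg, hb⟩
    refine ⟨f + g, fun σ τ ρ => by rw [map_add, hf, hg], fun J => ?_⟩
    simp only [Pi.add_apply, Subalgebra.coe_add, ha, hb, evalGz, map_add, add_div, add_mul,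
      Finset.sum_add_distrib]
  smul_mem' := by
    rintro c a ⟨f, hf, ha⟩
    refine ⟨algebraMap ℂ (Lsmall n) c • f, fun σ τ ρ => by rw [map_smul, hf], fun J => ?_⟩
    have h1 : ((c • a) J : Lfull n) = c • a J := rfl
    have h2 : ((c • a J : Lfull n) : RatK n) = c • (a J : RatK n) := rfl
    rw [h1, h2, ha, Finset.smul_sum]
    refine Finset.sum_congr rfl fun I _ => ?_
    have h3 : evalGz I (algebraMap ℂ (Lsmall n) c • f) = c • evalGz I f := by
      unfold evalGz
      rw [map_smul, algebraMap_smul]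
    rw [h3, smul_div_assoc, smul_mul_assoc]

/-- `𝓥 = ⊕_k 𝓥_k`. -/
def Vsub (n : ℕ) : Submodule ℂ (V n) := ⨆ k : Fin (n + 1), Vk n k

/-! ### Equivariant cohomology -/

/-- `ℂ[Γ, z, y]`. -/
abbrev PolyGzy (n k : ℕ) : Type := MvPolynomial (Gam n k) (PolyZY n)

/-- `ℂ[Γ, z, y]^{S_k × S_{n-k}}`. -/
def InvT (n k : ℕ) : Subalgebra (PolyZY n) (PolyGzy n k) where
  carrier := {f | ∀ (σ : Equiv.Perm (Fin k)) (τ : Equiv.Perm (Fin (n - k))),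
    MvPolynomial.rename (Sum.map σ τ) f = f}
  mul_mem' ha hb σ τ := by rw [map_mul, ha, hb]
  add_mem' ha hb σ τ := by rw [map_add, ha, hb]
  algebraMap_mem' r σ τ := AlgHom.commutes _ r

instance instCommRingInvT (n k : ℕ) : CommRing (InvT n k) := inferInstance

/-- The action of `S_n` on `ℂ[Γ, z, y]` by permutations of the variables `z`. -/
def permZ (n k : ℕ) (ρ : Equiv.Perm (Fin n)) : PolyGzy n k →+* PolyGzy n k :=
  MvPolynomial.map
    (MvPolynomial.rename (Option.map ρ) : PolyZY n →ₐ[ℂ] PolyZY n).toRingHom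

/-- `ℂ[Γ, z, y]^{S_k × S_{n-k} × S_n}`. -/
def InvGL (n k : ℕ) : Subring (PolyGzy n k) :=
  (InvT n k).toSubring ⊓ ⨅ ρ : Equiv.Perm (Fin n), RingHom.eqLocus (permZ n k ρ) (RingHom.id _)

/-- The polynomial `∏_{i ≤ k} (u - γ_{1,i}) ∏_{i ≤ n-k} (u - γ_{2,i}) - ∏_{i ≤ n} (u - z_i)`
in `u`. -/
def relPoly (n k : ℕ) : Polynomial (PolyGzy n k) :=
  (∏ i : Fin k, (Polynomial.X - Polynomial.C (MvPolynomial.X (Sum.inl i)))) *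
      (∏ i : Fin (n - k), (Polynomial.X - Polynomial.C (MvPolynomial.X (Sum.inr i))))
    - ∏ i : Fin n, (Polynomial.X - Polynomial.C (MvPolynomial.C (MvPolynomial.X (some i))))

/-- The ideal of `ℂ[Γ, z, y]^{S_k × S_{n-k}}` generated by the coefficients of `relPoly`. -/
def relT (n k : ℕ) : Ideal (InvT n k) :=
  Ideal.span {f | ∃ j : ℕ, (f : PolyGzy n k) = (relPoly n k).coeff j}

/-- The ideal of `ℂ[Γ, z, y]^{S_k × S_{n-k} × S_n}` generated by the coefficients of `relPoly`. -/
def relGL (n k : ℕ) : Ideal (InvGL n k) :=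
  Ideal.span {f | ∃ j : ℕ, (f : PolyGzy n k) = (relPoly n k).coeff j}

/-- `H^*_T(T^*Gr_k ℂⁿ)`. -/
def HT (n k : ℕ) : Type := InvT n k ⧸ relT n k

instance instCommRingHT (n k : ℕ) : CommRing (HT n k) :=
  inferInstanceAs (CommRing (InvT n k ⧸ relT n k))

instance instAlgebraHT (n k : ℕ) : Algebra (PolyZY n) (HT n k) :=
  inferInstanceAs (Algebra (PolyZY n) (InvT n k ⧸ relT n k))

/-- `H^*_{GL_n × ℂ^×}(T^*Gr_k ℂⁿ)`. -/
def HGL (n k : ℕ) : Type := InvGL n k ⧸ relGL n k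

instance instCommRingHGL (n k : ℕ) : CommRing (HGL n k) :=
  inferInstanceAs (CommRing (InvGL n k ⧸ relGL n k))

/-- The inclusion `ℂ[Γ, z, y]^{S_k × S_{n-k} × S_n} ⊆ ℂ[Γ, z, y]^{S_k × S_{n-k}}`. -/
def inclInv (n k : ℕ) : InvGL n k →+* InvT n k :=
  Subring.inclusion (inf_le_left : InvGL n k ≤ (InvT n k).toSubring)

theorem relGL_le (n k : ℕ) : relGL n k ≤ (relT n k).comap (inclInv n k) := by
  refine Ideal.span_le.2 ?_
  rintro f ⟨j, hj⟩
  exact Ideal.subset_span ⟨j, hj⟩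

/-- The natural map `H^*_{GL_n × ℂ^×}(T^*Gr_k ℂⁿ) → H^*_T(T^*Gr_k ℂⁿ)`. -/
def HGLtoHT (n k : ℕ) : HGL n k →+* HT n k :=
  Ideal.quotientMap (relT n k) (inclInv n k) (relGL_le n k)

/-- The substitution `Γ ↦ z_I` on polynomials. -/
def subst {n k : ℕ} (I : Sub n k) : PolyGzy n k →ₐ[PolyZY n] PolyZY n :=
  MvPolynomial.aeval fun g => MvPolynomial.X (some (fixedPt I g))

theorem prod_fixedPt {n k : ℕ} (I : Sub n k) {M : Type*} [CommMonoid M] (F : Fin n → M) :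
    (∏ i : Fin k, F (fixedPt I (Sum.inl i))) * (∏ i : Fin (n - k), F (fixedPt I (Sum.inr i)))
      = ∏ i, F i := by
  have h : ∀ (m : ℕ) (S : Finset (Fin n)) (hS : S.card = m),
      ∏ i : Fin m, F (S.orderEmbOfFin hS i) = ∏ a ∈ S, F a := by
    intro m S hS
    conv_rhs => rw [← Finset.image_orderEmbOfFin_univ S hS]
    rw [Finset.prod_image (fun a _ b _ hab => (S.orderEmbOfFin hS).injective hab)]
  simp only [fixedPt, Sum.elim_inl, Sum.elim_inr]
  rw [h, h, Finset.prod_mul_prod_compl]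

theorem subst_relPoly {n k : ℕ} (I : Sub n k) :
    (relPoly n k).map (subst I : PolyGzy n k →+* PolyZY n) = 0 := by
  rw [relPoly, Polynomial.map_sub, Polynomial.map_mul, Polynomial.map_prod, Polynomial.map_prod,
    Polynomial.map_prod, sub_eq_zero]
  simp only [Polynomial.map_sub, Polynomial.map_X, Polynomial.map_C, subst, RingHom.coe_coe,
    MvPolynomial.aeval_X, MvPolynomial.aeval_C, Algebra.algebraMap_self, RingHom.id_apply]
  exact prod_fixedPt I fun a => Polynomial.X - Polynomial.C (MvPolynomial.X (some a))

/-- The restriction `H^*_T(T^*Gr_k ℂⁿ) → H^*_T(x_I) = ℂ[z, y]` to the fixed point `x_I`. -/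
def Loc {n k : ℕ} (I : Sub n k) : HT n k →ₐ[PolyZY n] PolyZY n :=
  Ideal.Quotient.liftₐ (relT n k) ((subst I).comp (InvT n k).val) (by
    have h : relT n k ≤ RingHom.ker ((subst I).comp (InvT n k).val) := by
      refine Ideal.span_le.2 ?_
      rintro f ⟨j, hj⟩
      change subst I (f : PolyGzy n k) = 0
      rw [hj]
      have := congrArg (fun p => Polynomial.coeff p j) (subst_relPoly I)
      simpa using this
    exact fun a ha => h ha)

/-- `H^*_T(𝒳_n) ⊗ 𝓛_{λ,(z,y)} = ⊕_k H^*_T(T^*Gr_k ℂⁿ) ⊗ 𝓛_{λ,(z,y)}`, the tensor products being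
over `ℂ[z, y]`. The scalars `𝓛_{λ,(z,y)}` are written on the left. -/
abbrev HX (n : ℕ) : Type := ∀ k : Fin (n + 1), Lfull n ⊗[PolyZY n] HT n k

/-- The restriction to the fixed point `x_I` with coefficients extended to `𝓛_{λ,(z,y)}`. -/
def LocL {n k : ℕ} (I : Sub n k) : Lfull n ⊗[PolyZY n] HT n k →ₗ[Lfull n] Lfull n :=
  (TensorProduct.AlgebraTensorModule.rid (PolyZY n) (Lfull n) (Lfull n)).toLinearMap ∘ₗ
    (Loc I).toLinearMap.baseChange (Lfull n)

/-- `S` is the stable envelope map `Stab_id`: for all `I`, the class `S v_I = κ_{id,I}` lies in the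
summand `k = |I|`, and its restriction to each fixed point `x_J` with `|J| = |I|` is
`W̃⁺_I(λ, z_J, z, y)`. -/
def IsStab {n : ℕ} (S : V n ≃ₗ[Lfull n] HX n) : Prop :=
  ∀ (I : Finset (Fin n)) (k : Fin (n + 1)),
    (∀ (hI : I.card = k) (J : Sub n k),
      (LocL J (S (Pi.single I 1) k) : RatK n)
        = Wplus I hI (lamK n) (zSub J) (zK n) (yK n)) ∧
    (I.card ≠ k → S (Pi.single I 1) k = 0)

/-- `H^*_{GL_n × ℂ^×}(T^*Gr_k ℂⁿ) ⊗ 𝓛_{λ,y} ⊗ ℂ[y, y⁻¹]` as a subspace of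
`H^*_T(T^*Gr_k ℂⁿ) ⊗ 𝓛_{λ,(z,y)}`. -/
def HGLk (n k : ℕ) : Submodule ℂ (Lfull n ⊗[PolyZY n] HT n k) :=
  Submodule.span ℂ
    {x | ∃ (g : Lfull n) (f : HGL n k), (g : RatK n) ∈ Lsmall n ∧ x = g ⊗ₜ HGLtoHT n k f}

/-- `⊕_k H^*_{GL_n × ℂ^×}(T^*Gr_k ℂⁿ) ⊗ 𝓛_{λ,y} ⊗ ℂ[y, y⁻¹]` as a subspace of
`H^*_T(𝒳_n) ⊗ 𝓛_{λ,(z,y)}`. -/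
def HGLsub (n : ℕ) : Submodule ℂ (HX n) := Submodule.pi Set.univ fun k => HGLk n k

end DynGr

end

noncomputable section
namespace DynGr

/-! ### Permutations of the variables `z` -/

/-! Both spaces of the theorem are identified with one space of vectors that visibly is stable under
the operator algebra. For adjacent `i, j` let `exchT i j` be the dynamical R-matrix composed with
the flip of the tensor factors and with the exchange of `z_i` and `z_j`. The space `IsInvVec`
consists of the vectors fixed by all these operators whose coordinates become polynomial in `z`
(elements of `Az n`) after multiplication by D = ∏_{a<b} (z_b - z_a + y).

Stability: the dynamical Yang-Baxter equation (`dynamical_yangBaxter`, `xopF_mulVec_Lop`) says that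
the L-operator intertwines the exchange operator with a copy of it whose dynamical parameter is
shifted by the auxiliary weight. The shift of λ in `Ltilde` absorbs this discrepancy, so the
`Ltilde` commute with `exchT`. The coefficients of the L-operator lie in `Az n`, so polynomiality
survives as well (`isInvVec_operatorAlgebra`).

Identification: by the exchange relations `W_exchange`, restriction to the fixed points (`locSum`)
turns `exchT` into the permutation of the variables `z` and of the fixed points, and `exchT`
permutes the vectors ξ_I. Orthogonality (`locSum_xi`) then gives ζ = ∑_I loc_I(ζ) / R_I · ξ_I on
each weight space. It is checked at the fixed point of the last k indices, where triangularity
leaves one weight function, and is transported by the symmetric group. Hence invariant vectors are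
equivariant families of restrictions.

Polynomiality matches too. At the last-k fixed point the restriction is one coordinate times an
explicit factor. Two symmetric images of the remaining part of D are coprime, so the restriction is
a polynomial (`IsInvVec.isInvFam`). Conversely polynomiality of one coordinate spreads to the others
through divided differences (`Dprod_mul_permSet_swap_mem_Az`).

Finally, averaging over S_k × S_{n-k} shows that polynomial equivariant families are exactly the
values f(z_I) of invariant f and exactly the restrictions of GL_n-equivariant classes
(`isInvFam_iff_exists_evalGz`, `mem_HGLk_iff`). Lagrange interpolation makes restriction to the
fixed points an isomorphism over `Lfull n`, which provides `stab` and its uniqueness. -/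

instance instCharZeroFieldZY (n : ℕ) : CharZero (FieldZY n) :=
  charZero_of_injective_algebraMap (algebraMap ℂ (FieldZY n)).injective

/-- Permutation of the variables `z` of `ℂ[z, y]`. -/
def permPoly {n : ℕ} (σ : Equiv.Perm (Fin n)) : PolyZY n ≃+* PolyZY n :=
  (MvPolynomial.renameEquiv ℂ (Equiv.optionCongr σ)).toRingEquiv

/-- Permutation of the variables `z` of `ℂ(z, y)`. -/
def permF {n : ℕ} (σ : Equiv.Perm (Fin n)) : FieldZY n ≃+* FieldZY n :=
  IsFractionRing.ringEquivOfRingEquiv (permPoly σ)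

/-- Permutation of the variables `z` of `ℂ(λ, z, y)`. -/
def permK {n : ℕ} (σ : Equiv.Perm (Fin n)) : RatK n ≃+* RatK n :=
  IsFractionRing.ringEquivOfRingEquiv (A := Polynomial (FieldZY n)) (B := Polynomial (FieldZY n))
    (Polynomial.mapEquiv (permF σ))

theorem permK_algebraMap_field {n : ℕ} (σ : Equiv.Perm (Fin n)) (x : FieldZY n) :
    permK σ (algebraMap (FieldZY n) (RatK n) x) = algebraMap (FieldZY n) (RatK n) (permF σ x) := by
  rw [IsScalarTower.algebraMap_apply (FieldZY n) (Polynomial (FieldZY n)) (RatK n), permK,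
    IsFractionRing.ringEquivOfRingEquiv_algebraMap]
  simp

theorem permF_algebraMap {n : ℕ} (σ : Equiv.Perm (Fin n)) (x : PolyZY n) :
    permF σ (algebraMap (PolyZY n) (FieldZY n) x) = algebraMap _ _ (permPoly σ x) := by
  rw [permF, IsFractionRing.ringEquivOfRingEquiv_algebraMap]

theorem permK_algebraMap {n : ℕ} (σ : Equiv.Perm (Fin n)) (x : PolyZY n) :
    permK σ (algebraMap (PolyZY n) (RatK n) x) = algebraMap _ _ (permPoly σ x) := by
  rw [IsScalarTower.algebraMap_apply (PolyZY n) (FieldZY n) (RatK n), permK_algebraMap_field,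
    permF_algebraMap, ← IsScalarTower.algebraMap_apply]

theorem permPoly_X {n : ℕ} (σ : Equiv.Perm (Fin n)) (o : Option (Fin n)) :
    permPoly σ (MvPolynomial.X o) = MvPolynomial.X (o.map σ) := by
  simp [permPoly]

@[simp] theorem permK_zK {n : ℕ} (σ : Equiv.Perm (Fin n)) (a : Fin n) :
    permK σ (zK n a) = zK n (σ a) := by
  rw [zK, permK_algebraMap, permPoly_X]; rfl

@[simp] theorem permK_yK {n : ℕ} (σ : Equiv.Perm (Fin n)) : permK σ (yK n) = yK n := by
  rw [yK, permK_algebraMap, permPoly_X]; rfl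

@[simp] theorem permK_lamK {n : ℕ} (σ : Equiv.Perm (Fin n)) : permK σ (lamK n) = lamK n := by
  have h : lamK n = algebraMap (Polynomial (FieldZY n)) (RatK n) Polynomial.X := by
    simp [lamK]
  rw [h, permK, IsFractionRing.ringEquivOfRingEquiv_algebraMap]
  simp

theorem algebraMap_complex_RatK (n : ℕ) (c : ℂ) :
    algebraMap ℂ (RatK n) c = algebraMap (PolyZY n) (RatK n) (MvPolynomial.C c) := by
  rw [IsScalarTower.algebraMap_apply (PolyZY n) (FieldZY n) (RatK n),
    ← MvPolynomial.algebraMap_eq, ← IsScalarTower.algebraMap_apply ℂ (PolyZY n) (FieldZY n),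
    IsScalarTower.algebraMap_apply ℂ (FieldZY n) (RatK n)]

@[simp] theorem permK_complex {n : ℕ} (σ : Equiv.Perm (Fin n)) (c : ℂ) :
    permK σ (algebraMap ℂ (RatK n) c) = algebraMap ℂ (RatK n) c := by
  rw [algebraMap_complex_RatK, permK_algebraMap]
  simp [permPoly]

/-- A homomorphism from `ℂ(λ, z, y)` is determined by its values on constants and variables. -/
theorem ringHom_ext_RatK {n : ℕ} {R : Type*} [Semiring R] {f g : RatK n →+* R}
    (hc : ∀ c : ℂ, f (algebraMap ℂ _ c) = g (algebraMap ℂ _ c)) (hl : f (lamK n) = g (lamK n))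
    (hy : f (yK n) = g (yK n)) (hz : ∀ a, f (zK n a) = g (zK n a)) : f = g := by
  refine IsLocalization.ringHom_ext (nonZeroDivisors (Polynomial (FieldZY n))) ?_
  refine Polynomial.ringHom_ext' ?_ ?_
  · refine IsLocalization.ringHom_ext (nonZeroDivisors (PolyZY n)) ?_
    refine MvPolynomial.ringHom_ext (fun c => ?_) (fun o => ?_)
    · have := hc c
      rw [algebraMap_complex_RatK, IsScalarTower.algebraMap_apply (PolyZY n) (FieldZY n) (RatK n),
        IsScalarTower.algebraMap_apply (FieldZY n) (Polynomial (FieldZY n)) (RatK n)] at this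
      exact this
    · rcases o with _ | a
      · have := hy
        rw [yK, IsScalarTower.algebraMap_apply (PolyZY n) (FieldZY n) (RatK n),
          IsScalarTower.algebraMap_apply (FieldZY n) (Polynomial (FieldZY n)) (RatK n)] at this
        exact this
      · have := hz a
        rw [zK, IsScalarTower.algebraMap_apply (PolyZY n) (FieldZY n) (RatK n),
          IsScalarTower.algebraMap_apply (FieldZY n) (Polynomial (FieldZY n)) (RatK n)] at this
        exact this
  · have h : lamK n = algebraMap (Polynomial (FieldZY n)) (RatK n) Polynomial.X := by
      simp [lamK]
    rw [h] at hl
    exact hl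

theorem permK_one {n : ℕ} (x : RatK n) : permK (1 : Equiv.Perm (Fin n)) x = x := by
  have h : ((permK (1 : Equiv.Perm (Fin n)) : RatK n ≃+* RatK n) : RatK n →+* RatK n)
      = RingHom.id _ := by
    apply ringHom_ext_RatK <;> simp
  exact RingHom.congr_fun h x

theorem permK_mul {n : ℕ} (σ τ : Equiv.Perm (Fin n)) (x : RatK n) :
    permK (σ * τ) x = permK σ (permK τ x) := by
  have h : ((permK (σ * τ) : RatK n ≃+* RatK n) : RatK n →+* RatK n)
      = (permK σ : RatK n →+* RatK n).comp (permK τ : RatK n →+* RatK n) := by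
    apply ringHom_ext_RatK <;> simp
  exact RingHom.congr_fun h x

theorem shiftK_complex (n : ℕ) (m : ℤ) (c : ℂ) :
    shiftK n m (algebraMap ℂ (RatK n) c) = algebraMap ℂ (RatK n) c := by
  rw [IsScalarTower.algebraMap_apply ℂ (FieldZY n) (RatK n)]
  exact (shiftK n m).commutes _

theorem shiftK_zK (n : ℕ) (m : ℤ) (a : Fin n) : shiftK n m (zK n a) = zK n a := by
  rw [zK, IsScalarTower.algebraMap_apply (PolyZY n) (FieldZY n) (RatK n)]
  exact (shiftK n m).commutes _

/-- The dynamical shift moves λ by a multiple of y, and permutations of `z` fix both. Without this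
the operators `Ltilde` could not commute with `exchT`. -/
theorem permK_shiftK {n : ℕ} (σ : Equiv.Perm (Fin n)) (m : ℤ) (x : RatK n) :
    permK σ (shiftK n m x) = shiftK n m (permK σ x) := by
  have h : (permK σ : RatK n →+* RatK n).comp ((shiftK n m).toRingEquiv : RatK n →+* RatK n)
      = ((shiftK n m).toRingEquiv : RatK n →+* RatK n).comp (permK σ : RatK n →+* RatK n) := by
    apply ringHom_ext_RatK <;>
      simp [shiftK_complex, shiftK_zK, shiftK_yK, shiftK_lamK]
  exact RingHom.congr_fun h x

/-! ### Nonvanishing of linear forms -/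

/-- The inclusion `ℂ[z, y][λ] → ℂ(λ, z, y)`. -/
def polyK (n : ℕ) : Polynomial (PolyZY n) →+* RatK n :=
  (algebraMap (Polynomial (FieldZY n)) (RatK n)).comp
    (Polynomial.mapRingHom (algebraMap (PolyZY n) (FieldZY n)))

theorem polyK_injective (n : ℕ) : Function.Injective (polyK n) :=
  (IsFractionRing.injective (Polynomial (FieldZY n)) (RatK n)).comp
    (Polynomial.map_injective _ (IsFractionRing.injective (PolyZY n) (FieldZY n)))

theorem polyK_X (n : ℕ) : polyK n Polynomial.X = lamK n := by simp [polyK, lamK]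

theorem polyK_C (n : ℕ) (p : PolyZY n) : polyK n (Polynomial.C p) = algebraMap _ _ p := by
  simp [polyK, IsScalarTower.algebraMap_apply (PolyZY n) (FieldZY n) (RatK n)]

theorem algebraMap_PolyZY_injective (n : ℕ) :
    Function.Injective (algebraMap (PolyZY n) (RatK n)) := by
  intro a b h
  rw [← polyK_C, ← polyK_C] at h
  exact Polynomial.C_injective (polyK_injective n h)

theorem yK_ne_zero (n : ℕ) : yK n ≠ 0 := by
  rw [yK, Ne, map_eq_zero_iff _ (algebraMap_PolyZY_injective n)]
  exact MvPolynomial.X_ne_zero _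

theorem zK_injective (n : ℕ) : Function.Injective (zK n) := by
  intro a b h
  have := MvPolynomial.X_injective (algebraMap_PolyZY_injective n h)
  simpa using this

theorem zK_sub_ne_zero {n : ℕ} {a b : Fin n} (h : a ≠ b) : zK n a - zK n b ≠ 0 :=
  sub_ne_zero.2 fun e => h (zK_injective n e)

theorem zK_sub_add_ne_zero {n : ℕ} (a b : Fin n) : zK n a - zK n b + yK n ≠ 0 := by
  intro h
  have h1 : algebraMap (PolyZY n) (RatK n)
      (MvPolynomial.X (some a) - MvPolynomial.X (some b) + MvPolynomial.X none) = 0 := by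
    simpa [zK, yK] using h
  rw [map_eq_zero_iff _ (algebraMap_PolyZY_injective n)] at h1
  -- The test point z = 0, y = 1 also covers the case a = b.
  have h2 := congrArg (MvPolynomial.eval fun o : Option (Fin n) => if o = none then (1 : ℂ) else 0) h1
  simp at h2

theorem lamK_add_ne_zero (n : ℕ) (m : ℤ) : lamK n + (m : RatK n) * yK n ≠ 0 := by
  intro h
  have h1 : polyK n (Polynomial.X + Polynomial.C ((m : PolyZY n) * MvPolynomial.X none)) = 0 := by
    rw [map_add, polyK_X, polyK_C]
    simpa [yK] using h
  rw [map_eq_zero_iff _ (polyK_injective n)] at h1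
  exact Polynomial.X_add_C_ne_zero _ h1

theorem lamK_sub_ne_zero (n : ℕ) (m : ℤ) : lamK n - (m : RatK n) * yK n ≠ 0 := by
  have := lamK_add_ne_zero n (-m)
  push_cast at this
  rwa [neg_mul, ← sub_eq_add_neg] at this

/-! ### The exchange relations of weight functions -/

/-- The image of a subset of `[n]` under a permutation. -/
abbrev permSet {n : ℕ} (σ : Equiv.Perm (Fin n)) (I : Finset (Fin n)) : Finset (Fin n) :=
  I.map σ.toEmbedding

theorem mem_permSet {n : ℕ} {σ : Equiv.Perm (Fin n)} {I : Finset (Fin n)} {a : Fin n} :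
    a ∈ permSet σ I ↔ σ.symm a ∈ I := by
  simp [permSet, Finset.mem_map_equiv]

theorem mem_permSet_swap {n : ℕ} {i j : Fin n} {I : Finset (Fin n)} {a : Fin n} :
    a ∈ permSet (Equiv.swap i j) I ↔ Equiv.swap i j a ∈ I := by
  rw [mem_permSet, Equiv.symm_swap]

theorem permSet_swap_swap {n : ℕ} (i j : Fin n) (I : Finset (Fin n)) :
    permSet (Equiv.swap i j) (permSet (Equiv.swap i j) I) = I := by
  ext a
  simp only [mem_permSet_swap, Equiv.swap_apply_self]

theorem wt_eq_tailWeight {n : ℕ} (I : Finset (Fin n)) (a : Fin n) : wt I a = tailWeight I a := by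
  rw [wt, tailWeight, Finset.sum_ite, Finset.filter_filter, Finset.filter_filter]
  simp
  ring

/-- `1`, `-1` or `0` according to whether `I` contains only `i`, only `j`, or both or none. -/
def slotDiff {n : ℕ} (i j : Fin n) (I : Finset (Fin n)) : ℤ :=
  (if i ∈ I then 1 else 0) - (if j ∈ I then 1 else 0)

section Coef
variable {F : Type*} [Field F]

/-- The diagonal coefficient of the exchange relations. -/
def exchDiag (e : ℤ) (L w y : F) : F := if e = 0 then 1 else -((L + e * w) * y) / (L * (w - y))

/-- The off-diagonal coefficient of the exchange relations. -/
def exchOff (e : ℤ) (L w y : F) : F := if e = 0 then 0 else (L + e * y) * w / (L * (w - y))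

end Coef

theorem lt_iff_of_adjacent {n : ℕ} {i j : Fin n} (hij : (j : ℕ) = i + 1) {a : Fin n} (ha : a ≠ i) :
    a < j ↔ a < i := by
  rw [Fin.lt_def, Fin.lt_def]; have := Fin.val_ne_of_ne ha; omega

theorem lt_iff_of_adjacent' {n : ℕ} {i j : Fin n} (hij : (j : ℕ) = i + 1) {a : Fin n}
    (ha : a ≠ j) : j < a ↔ i < a := by
  rw [Fin.lt_def, Fin.lt_def]; have := Fin.val_ne_of_ne ha; omega

theorem lt_swap_iff {n : ℕ} {i j : Fin n} (hij : (j : ℕ) = i + 1) {a : Fin n} (ha : a ≠ i)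
    (b : Fin n) : a < Equiv.swap i j b ↔ a < b := by
  rcases eq_or_ne b i with rfl | hbi
  · rw [Equiv.swap_apply_left, lt_iff_of_adjacent hij ha]
  rcases eq_or_ne b j with rfl | hbj
  · rw [Equiv.swap_apply_right, lt_iff_of_adjacent hij ha]
  rw [Equiv.swap_apply_of_ne_of_ne hbi hbj]

/-- To the right of a position `a ≠ i` lie both of `i, j` or neither of them. -/
theorem tailWeight_permSet_swap {n : ℕ} {i j : Fin n} (hij : (j : ℕ) = i + 1)
    (I : Finset (Fin n)) {a : Fin n} (ha : a ≠ i) :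
    tailWeight (permSet (Equiv.swap i j) I) a = tailWeight I a := by
  rw [tailWeight, tailWeight]
  refine Finset.sum_equiv (Equiv.swap i j) (fun b => ?_) (fun b _ => ?_)
  · simp [lt_swap_iff hij ha]
  · simp only [mem_permSet_swap]

theorem tailWeight_adjacent {n : ℕ} {i j : Fin n} (hij : (j : ℕ) = i + 1) (I : Finset (Fin n)) :
    tailWeight I i = tailWeight I j + if j ∈ I then 1 else -1 := by
  have h : Finset.univ.filter (fun b => i < b)
      = insert j (Finset.univ.filter (fun b => j < b)) := by
    ext b
    simp only [Finset.mem_filter, Finset.mem_univ, true_and, Finset.mem_insert]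
    rcases eq_or_ne b j with rfl | hb
    · simp [Fin.lt_def, hij]
    · simp [hb, lt_iff_of_adjacent' hij hb]
  rw [tailWeight, h, Finset.sum_insert (by simp), add_comm]; rfl

theorem adjacent_ne {n : ℕ} {i j : Fin n} (hij : (j : ℕ) = i + 1) : i ≠ j := by
  rintro rfl; omega

section Weight
variable {F : Type*} [Field F] {n k : ℕ}

/-- The product of the factors of `W_I` that involve one variable `x = t_r`, where `p` is the
`r`-th element of `I`. -/
def row (I : Finset (Fin n)) (lam x : F) (z : Fin n → F) (y : F) (p : Fin n) : F :=
  ∏ a, lfac I lam x z y p a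

/-- Both `i` and `j` lie on the same side of `p`, so their factors have the same shape and are only
interchanged. -/
theorem row_swap_of_ne {i j : Fin n} (hij : (j : ℕ) = i + 1) (I : Finset (Fin n)) (lam x : F)
    (z : Fin n → F) (y : F) {p : Fin n} (hi : p ≠ i) (hj : p ≠ j) :
    row I lam x (z ∘ Equiv.swap i j) y p = row I lam x z y p := by
  refine Fintype.prod_equiv (Equiv.swap i j) _ _ fun a => ?_
  have h1 : Equiv.swap i j a < p ↔ a < p := by
    rcases eq_or_ne a i with rfl | hai
    · rw [Equiv.swap_apply_left, lt_iff_of_adjacent' hij hj]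
    rcases eq_or_ne a j with rfl | haj
    · rw [Equiv.swap_apply_right, lt_iff_of_adjacent' hij hj]
    rw [Equiv.swap_apply_of_ne_of_ne hai haj]
  have h2 : Equiv.swap i j a = p ↔ a = p := by
    rw [Equiv.swap_apply_eq_iff, Equiv.swap_apply_of_ne_of_ne hi hj]
  simp only [lfac, h1, h2, Function.comp_apply]

theorem row_congr_wt (I J : Finset (Fin n)) (lam x : F) (z : Fin n → F) (y : F) {p : Fin n}
    (h : wt I p = wt J p) : row I lam x z y p = row J lam x z y p := by
  simp only [row, lfac, h]

/-- The part of a row away from the adjacent positions `i, j`. -/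
def rowRest (i j : Fin n) (x : F) (z : Fin n → F) (y : F) : F :=
  ∏ a ∈ (Finset.univ.erase i).erase j, if a < i then x - z a + y else x - z a

theorem rowRest_swap (i j : Fin n) (x : F) (z : Fin n → F) (y : F) :
    rowRest i j x (z ∘ Equiv.swap i j) y = rowRest i j x z y := by
  refine Finset.prod_congr rfl fun a ha => ?_
  simp only [Finset.mem_erase] at ha
  rw [Function.comp_apply, Equiv.swap_apply_of_ne_of_ne ha.2.1 ha.1]

theorem prod_split_pair {i j : Fin n} (h : i ≠ j) (f : Fin n → F) :
    ∏ a, f a = f i * f j * ∏ a ∈ (Finset.univ.erase i).erase j, f a := by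
  rw [mul_assoc, Finset.mul_prod_erase _ _ (by simp [h.symm]), Finset.mul_prod_erase _ _ (by simp)]

theorem row_left {i j : Fin n} (hij : (j : ℕ) = i + 1) (I : Finset (Fin n)) (lam x : F)
    (z : Fin n → F) (y : F) :
    row I lam x z y i
      = (lam + x - z i - (wt I i : F) * y) * (x - z j) * rowRest i j x z y := by
  have hne := adjacent_ne hij
  rw [row, prod_split_pair hne, rowRest]
  congr 1
  · have : ¬ j < i := by rw [Fin.lt_def]; omega
    simp [lfac, this, hne.symm]
  · refine Finset.prod_congr rfl fun a ha => ?_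
    simp only [Finset.mem_erase] at ha
    simp [lfac, ha.2.1]

theorem row_right {i j : Fin n} (hij : (j : ℕ) = i + 1) (I : Finset (Fin n)) (lam x : F)
    (z : Fin n → F) (y : F) :
    row I lam x z y j
      = (x - z i + y) * (lam + x - z j - (wt I j : F) * y) * rowRest i j x z y := by
  have hne := adjacent_ne hij
  rw [row, prod_split_pair hne, rowRest]
  congr 1
  · have : i < j := by rw [Fin.lt_def]; omega
    simp [lfac, this]
  · refine Finset.prod_congr rfl fun a ha => ?_
    simp only [Finset.mem_erase] at ha
    simp [lfac, ha.1, lt_iff_of_adjacent hij ha.2.1]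

/-- Only the factors at `i` and `j` differ among the three rows. The common `rowRest` cancels, and
what remains is a rational identity in one variable `x`, once all weights are expressed through the
weight at `j`. -/
theorem row_exchange {i j : Fin n} (hij : (j : ℕ) = i + 1) (I : Finset (Fin n)) (lam x : F)
    (z : Fin n → F) (y : F) (hL : lam - (wt I j : F) * y ≠ 0) (hw : z i - z j - y ≠ 0)
    {p : Fin n} (hp : p = i ∨ p = j) (hpI : p ∈ I) (hqI : Equiv.swap i j p ∉ I) :
    row I lam x (z ∘ Equiv.swap i j) y p
      = exchDiag (slotDiff i j I) (lam - (wt I j : F) * y) (z i - z j) y * row I lam x z y p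
        + exchOff (slotDiff i j I) (lam - (wt I j : F) * y) (z i - z j) y
          * row (permSet (Equiv.swap i j) I) lam x z y (Equiv.swap i j p) := by
  have hne := adjacent_ne hij
  have hwt := tailWeight_adjacent hij I
  have hwt' := tailWeight_adjacent hij (permSet (Equiv.swap i j) I)
  have hwj := tailWeight_permSet_swap hij I hne.symm
  simp only [← wt_eq_tailWeight, mem_permSet_swap, Equiv.swap_apply_right] at hwt hwt' hwj
  rcases hp with rfl | rfl
  · rw [Equiv.swap_apply_left] at hqI ⊢
    rw [row_left hij, row_left hij, row_right hij, rowRest_swap, hwj, hwt]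
    simp only [Function.comp_apply, Equiv.swap_apply_left, Equiv.swap_apply_right, slotDiff, hpI,
      hqI, if_true, if_false, exchDiag, exchOff]
    simp only [sub_zero, one_ne_zero, if_false]
    push_cast
    -- Taking `L` instead of `lam` as the free variable makes every denominator atomic.
    generalize hLe : lam - (wt I j : F) * y = L at *
    obtain rfl : lam = L + (wt I j : F) * y := by rw [← hLe]; ring
    rw [← sub_eq_zero]
    field_simp
    ring
  · rw [Equiv.swap_apply_right] at hqI ⊢
    rw [row_right hij, row_right hij, row_left hij, rowRest_swap, hwt', hwj]
    simp only [Function.comp_apply, Equiv.swap_apply_left, Equiv.swap_apply_right, slotDiff, hpI,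
      hqI, if_true, if_false, exchDiag, exchOff]
    simp only [zero_sub, neg_eq_zero, one_ne_zero, if_false]
    push_cast
    generalize hLe : lam - (wt I p : F) * y = L at *
    obtain rfl : lam = L + (wt I p : F) * y := by rw [← hLe]; ring
    rw [← sub_eq_zero]
    field_simp
    ring

/-- With both positions in `I` the weights at `i` and `j` differ by one. Symmetrizing the product of
the two rows in the variables then makes it symmetric in `z i` and `z j`, although neither summand
is. -/
theorem row_pair_symm {i j : Fin n} (hij : (j : ℕ) = i + 1) (I : Finset (Fin n)) (lam x₁ x₂ : F)
    (z : Fin n → F) (y : F) (hj : j ∈ I) (hx : x₁ ≠ x₂) :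
    row I lam x₁ (z ∘ Equiv.swap i j) y i * row I lam x₂ (z ∘ Equiv.swap i j) y j
          * ((x₁ - x₂ + y) / (x₁ - x₂))
        + row I lam x₂ (z ∘ Equiv.swap i j) y i * row I lam x₁ (z ∘ Equiv.swap i j) y j
          * ((x₂ - x₁ + y) / (x₂ - x₁))
      = row I lam x₁ z y i * row I lam x₂ z y j * ((x₁ - x₂ + y) / (x₁ - x₂))
        + row I lam x₂ z y i * row I lam x₁ z y j * ((x₂ - x₁ + y) / (x₂ - x₁)) := by
  have hwt := tailWeight_adjacent hij I
  simp only [← wt_eq_tailWeight, hj, if_true] at hwt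
  have h1 : x₁ - x₂ ≠ 0 := sub_ne_zero.2 hx
  have h2 : x₂ - x₁ = -(x₁ - x₂) := by ring
  simp only [row_left hij, row_right hij, rowRest_swap, hwt, Function.comp_apply,
    Equiv.swap_apply_left, Equiv.swap_apply_right]
  rw [h2]
  push_cast
  generalize rowRest i j x₁ z y = c₁
  generalize rowRest i j x₂ z y = c₂
  generalize (wt I j : F) = m
  rw [← sub_eq_zero]
  field_simp
  ring

/-- An adjacent transposition is increasing on every set that does not contain both of its points.
-/
theorem orderEmbOfFin_permSet_swap {i j : Fin n} (hij : (j : ℕ) = i + 1) (I : Finset (Fin n))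
    (hI : I.card = k) (h : ¬ (i ∈ I ∧ j ∈ I)) (r : Fin k) :
    (permSet (Equiv.swap i j) I).orderEmbOfFin ((Finset.card_map _).trans hI) r
      = Equiv.swap i j (I.orderEmbOfFin hI r) := by
  symm
  refine congrFun (Finset.orderEmbOfFin_unique (s := permSet (Equiv.swap i j) I)
    (f := fun r => Equiv.swap i j (I.orderEmbOfFin hI r)) _ (fun r => ?_) ?_) r
  · rw [mem_permSet_swap, Equiv.swap_apply_self]
    exact Finset.orderEmbOfFin_mem _ _ _
  · intro a b hab
    have h1 : I.orderEmbOfFin hI a < I.orderEmbOfFin hI b := (I.orderEmbOfFin hI).strictMono hab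
    have ha := Finset.orderEmbOfFin_mem I hI a
    have hb := Finset.orderEmbOfFin_mem I hI b
    change Equiv.swap i j (I.orderEmbOfFin hI a) < Equiv.swap i j (I.orderEmbOfFin hI b)
    generalize I.orderEmbOfFin hI a = p at *
    generalize I.orderEmbOfFin hI b = q at *
    by_cases hp : p = i
    · subst hp
      have hqj : q ≠ j := by rintro rfl; exact h ⟨ha, hb⟩
      rw [Equiv.swap_apply_left, Equiv.swap_apply_of_ne_of_ne h1.ne' hqj]
      exact (lt_iff_of_adjacent' hij hqj).2 h1
    · by_cases hpj : p = j
      · subst hpj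
        rw [Equiv.swap_apply_right]
        have : i < p := by rw [Fin.lt_def]; omega
        rw [Equiv.swap_apply_of_ne_of_ne (this.trans h1).ne' h1.ne']
        exact this.trans h1
      · rw [Equiv.swap_apply_of_ne_of_ne hp hpj, lt_swap_iff hij hp]
        exact h1

/-- The summand of `W_I` that belongs to a permutation of the variables `t`. -/
def Wterm (I : Finset (Fin n)) (hI : I.card = k) (lam : F) (t : Fin k → F) (z : Fin n → F) (y : F)
    (σ : Equiv.Perm (Fin k)) : F :=
  (∏ r, row I lam (t (σ r)) z y (I.orderEmbOfFin hI r)) *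
    ∏ a, ∏ b ∈ Finset.univ.filter (fun b => a < b),
      (t (σ a) - t (σ b) + y) / (t (σ a) - t (σ b))

theorem W_eq_sum (I : Finset (Fin n)) (hI : I.card = k) (lam : F) (t : Fin k → F) (z : Fin n → F)
    (y : F) : W I hI lam t z y = y ^ k * ∑ σ, Wterm I hI lam t z y σ := rfl

/-- The relation holds for each summand separately: the pair factors do not involve `z`, and among
the rows only the one of `p` changes. -/
theorem Wterm_exchange {i j : Fin n} (hij : (j : ℕ) = i + 1) (I : Finset (Fin n))
    (hI : I.card = k) (lam : F) (t : Fin k → F) (z : Fin n → F) (y : F)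
    (hL : lam - (wt I j : F) * y ≠ 0) (hw : z i - z j - y ≠ 0)
    {p : Fin n} (hp : p = i ∨ p = j) (hpI : p ∈ I) (hqI : Equiv.swap i j p ∉ I)
    (σ : Equiv.Perm (Fin k)) :
    Wterm I hI lam t (z ∘ Equiv.swap i j) y σ
      = exchDiag (slotDiff i j I) (lam - (wt I j : F) * y) (z i - z j) y * Wterm I hI lam t z y σ
        + exchOff (slotDiff i j I) (lam - (wt I j : F) * y) (z i - z j) y
          * Wterm (permSet (Equiv.swap i j) I) ((Finset.card_map _).trans hI) lam t z y σ := by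
  have hboth : ¬ (i ∈ I ∧ j ∈ I) := by
    rintro ⟨h1, h2⟩
    rcases hp with rfl | rfl
    · exact hqI (by rwa [Equiv.swap_apply_left])
    · exact hqI (by rwa [Equiv.swap_apply_right])
  obtain ⟨r₀, hr₀⟩ : ∃ r, I.orderEmbOfFin hI r = p := by
    have : p ∈ Set.range (I.orderEmbOfFin hI) := by rw [Finset.range_orderEmbOfFin]; exact hpI
    exact this
  have hrest : ∀ r ∈ Finset.univ.erase r₀,
      I.orderEmbOfFin hI r ≠ i ∧ I.orderEmbOfFin hI r ≠ j := by
    intro r hr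
    have h1 : I.orderEmbOfFin hI r ≠ p := by
      rw [← hr₀]
      exact fun e => (Finset.ne_of_mem_erase hr) ((I.orderEmbOfFin hI).injective e)
    have h2 : I.orderEmbOfFin hI r ≠ Equiv.swap i j p := by
      intro e
      exact hqI (e ▸ Finset.orderEmbOfFin_mem I hI r)
    rcases hp with rfl | rfl
    · rw [Equiv.swap_apply_left] at h2; exact ⟨h1, h2⟩
    · rw [Equiv.swap_apply_right] at h2; exact ⟨h2, h1⟩
  simp only [Wterm, orderEmbOfFin_permSet_swap hij I hI hboth]
  rw [← Finset.mul_prod_erase Finset.univ _ (Finset.mem_univ r₀),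
    ← Finset.mul_prod_erase Finset.univ (fun r => row I lam (t (σ r)) z y _) (Finset.mem_univ r₀),
    ← Finset.mul_prod_erase Finset.univ
      (fun r => row (permSet _ I) lam (t (σ r)) z y _) (Finset.mem_univ r₀),
    hr₀, row_exchange hij I lam _ z y hL hw hp hpI hqI]
  have e1 : ∏ r ∈ Finset.univ.erase r₀,
        row I lam (t (σ r)) (z ∘ Equiv.swap i j) y (I.orderEmbOfFin hI r)
      = ∏ r ∈ Finset.univ.erase r₀, row I lam (t (σ r)) z y (I.orderEmbOfFin hI r) :=
    Finset.prod_congr rfl fun r hr =>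
      row_swap_of_ne hij I lam _ z y (hrest r hr).1 (hrest r hr).2
  have e2 : ∏ r ∈ Finset.univ.erase r₀, row (permSet (Equiv.swap i j) I) lam (t (σ r)) z y
        (Equiv.swap i j (I.orderEmbOfFin hI r))
      = ∏ r ∈ Finset.univ.erase r₀, row I lam (t (σ r)) z y (I.orderEmbOfFin hI r) := by
    refine Finset.prod_congr rfl fun r hr => ?_
    rw [Equiv.swap_apply_of_ne_of_ne (hrest r hr).1 (hrest r hr).2]
    refine row_congr_wt _ _ _ _ _ _ ?_
    rw [wt_eq_tailWeight, wt_eq_tailWeight, tailWeight_permSet_swap hij I (hrest r hr).1]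
  rw [e1, e2]
  ring

/-- An adjacent transposition permutes the pairs a < b other than (r, s), and reverses that one. -/
theorem pairs_swap {r s : Fin k} (hrs : (s : ℕ) = r + 1) (φ : Fin k → Fin k → F) :
    ∃ c : F, (∏ a, ∏ b ∈ Finset.univ.filter (fun b => a < b), φ a b = φ r s * c) ∧
      ∏ a, ∏ b ∈ Finset.univ.filter (fun b => a < b), φ (Equiv.swap r s a) (Equiv.swap r s b)
        = φ s r * c := by
  have key : ∀ ψ : Fin k → Fin k → F, ∏ a, ∏ b ∈ Finset.univ.filter (fun b => a < b), ψ a b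
      = ∏ p ∈ (Finset.univ : Finset (Fin k × Fin k)).filter (fun p => p.1 < p.2), ψ p.1 p.2 := by
    intro ψ
    rw [Finset.prod_filter, Fintype.prod_prod_type]
    exact Finset.prod_congr rfl fun a _ => Finset.prod_filter _ _
  have hmem : (r, s) ∈ (Finset.univ : Finset (Fin k × Fin k)).filter (fun p => p.1 < p.2) := by
    simp only [Finset.mem_filter, Finset.mem_univ, true_and]
    exact Fin.lt_def.2 (by omega)
  refine ⟨∏ p ∈ ((Finset.univ : Finset (Fin k × Fin k)).filter
    (fun p => p.1 < p.2)).erase (r, s), φ p.1 p.2, ?_, ?_⟩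
  · rw [key, ← Finset.mul_prod_erase _ _ hmem]
  · rw [key, ← Finset.mul_prod_erase _ _ hmem, Equiv.swap_apply_left, Equiv.swap_apply_right]
    congr 1
    refine Finset.prod_equiv (Equiv.prodCongr (Equiv.swap r s) (Equiv.swap r s)) ?_ ?_
    · rintro ⟨a, b⟩
      simp only [Finset.mem_erase, Finset.mem_filter, Finset.mem_univ, true_and,
        Equiv.prodCongr_apply, Prod.map_apply, ne_eq, Prod.mk.injEq, Equiv.swap_apply_def,
        Fin.lt_def, Fin.ext_iff]
      split_ifs <;> omega
    · rintro ⟨a, b⟩ _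
      rfl

/-- Here single summands are not invariant. Those of `σ` and `σ * swap r s` together are, by
`row_pair_symm`. -/
theorem sum_Wterm_swap_of_both [CharZero F] {i j : Fin n} (hij : (j : ℕ) = i + 1)
    (I : Finset (Fin n)) (hI : I.card = k) (lam : F) (t : Fin k → F) (ht : Function.Injective t)
    (z : Fin n → F) (y : F) (hi : i ∈ I) (hj : j ∈ I) :
    ∑ σ, Wterm I hI lam t (z ∘ Equiv.swap i j) y σ = ∑ σ, Wterm I hI lam t z y σ := by
  obtain ⟨r, hr⟩ : ∃ r, I.orderEmbOfFin hI r = i := by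
    have : i ∈ Set.range (I.orderEmbOfFin hI) := by rw [Finset.range_orderEmbOfFin]; exact hi
    exact this
  obtain ⟨s, hs⟩ : ∃ r, I.orderEmbOfFin hI r = j := by
    have : j ∈ Set.range (I.orderEmbOfFin hI) := by rw [Finset.range_orderEmbOfFin]; exact hj
    exact this
  have hlt : r < s := by
    rw [← (I.orderEmbOfFin hI).lt_iff_lt, hr, hs, Fin.lt_def]; omega
  -- No element of `I` fits strictly between the neighbours `i` and `j`.
  have hrs : (s : ℕ) = r + 1 := by
    by_contra hne
    have h1 : (r : ℕ) + 1 < s := by have := Fin.lt_def.1 hlt; omega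
    have h2 := (I.orderEmbOfFin hI).strictMono
      (show r < ⟨r + 1, h1.trans s.2⟩ from Fin.lt_def.2 (by simp))
    have h3 := (I.orderEmbOfFin hI).strictMono
      (show (⟨r + 1, h1.trans s.2⟩ : Fin k) < s from Fin.lt_def.2 h1)
    rw [hr, Fin.lt_def] at h2
    rw [hs, Fin.lt_def] at h3
    omega
  have hrs' : r ≠ s := hlt.ne
  -- Doubling the sum pairs the permutations without a choice of coset representatives.
  -- Characteristic zero is needed to divide by two.
  have hdouble : ∀ g : Equiv.Perm (Fin k) → F,
      2 * ∑ σ, g σ = ∑ σ, (g σ + g (σ * Equiv.swap r s)) := by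
    intro g
    rw [Finset.sum_add_distrib, two_mul]
    congr 1
    exact (Equiv.sum_comp (Equiv.mulRight (Equiv.swap r s)) g).symm
  have h2 : (2 : F) ≠ 0 := two_ne_zero
  refine mul_left_cancel₀ h2 ?_
  rw [hdouble, hdouble]
  refine Finset.sum_congr rfl fun σ _ => ?_
  obtain ⟨c, hc1, hc2⟩ := pairs_swap hrs
    (fun a b => (t (σ a) - t (σ b) + y) / (t (σ a) - t (σ b)))
  have hsplit : ∀ f : Fin k → F, ∏ a, f a = f r * f s * ∏ a ∈ (Finset.univ.erase r).erase s, f a :=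
    prod_split_pair hrs'
  have hrest : ∀ u ∈ (Finset.univ.erase r).erase s,
      I.orderEmbOfFin hI u ≠ i ∧ I.orderEmbOfFin hI u ≠ j := by
    intro u hu
    simp only [Finset.mem_erase] at hu
    rw [← hr, ← hs]
    exact ⟨fun e => hu.2.1 ((I.orderEmbOfFin hI).injective e),
      fun e => hu.1 ((I.orderEmbOfFin hI).injective e)⟩
  have e1 : ∏ u ∈ (Finset.univ.erase r).erase s,
        row I lam (t (σ u)) (z ∘ Equiv.swap i j) y (I.orderEmbOfFin hI u)
      = ∏ u ∈ (Finset.univ.erase r).erase s, row I lam (t (σ u)) z y (I.orderEmbOfFin hI u) :=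
    Finset.prod_congr rfl fun u hu =>
      row_swap_of_ne hij I lam _ z y (hrest u hu).1 (hrest u hu).2
  have e2 : ∀ z' : Fin n → F, ∏ u ∈ (Finset.univ.erase r).erase s,
        row I lam (t (σ (Equiv.swap r s u))) z' y (I.orderEmbOfFin hI u)
      = ∏ u ∈ (Finset.univ.erase r).erase s, row I lam (t (σ u)) z' y (I.orderEmbOfFin hI u) :=
    fun z' => Finset.prod_congr rfl fun u hu => by
      simp only [Finset.mem_erase] at hu
      rw [Equiv.swap_apply_of_ne_of_ne hu.2.1 hu.1]
  have hx : t (σ r) ≠ t (σ s) := fun e => hrs' (σ.injective (ht e))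
  have key := row_pair_symm hij I lam (t (σ r)) (t (σ s)) z y hj hx
  simp only [Wterm, Equiv.Perm.mul_apply, hc1, hc2]
  simp only [hsplit (fun u => row I lam _ _ y (I.orderEmbOfFin hI u)), e2, e1,
    Equiv.swap_apply_left, Equiv.swap_apply_right, hr, hs]
  generalize ∏ u ∈ (Finset.univ.erase r).erase s,
    row I lam (t (σ u)) z y (I.orderEmbOfFin hI u) = q
  linear_combination (q * c) * key

/-- The exchange relations of weight functions under an adjacent transposition of the variables
`z`. -/
theorem W_exchange [CharZero F] {i j : Fin n} (hij : (j : ℕ) = i + 1) (I : Finset (Fin n))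
    (hI : I.card = k) (lam : F) (t : Fin k → F) (ht : Function.Injective t) (z : Fin n → F) (y : F)
    (hL : lam - (wt I j : F) * y ≠ 0) (hw : z i - z j - y ≠ 0) :
    W I hI lam t (z ∘ Equiv.swap i j) y
      = exchDiag (slotDiff i j I) (lam - (wt I j : F) * y) (z i - z j) y * W I hI lam t z y
        + exchOff (slotDiff i j I) (lam - (wt I j : F) * y) (z i - z j) y
          * W (permSet (Equiv.swap i j) I) ((Finset.card_map _).trans hI) lam t z y := by
  simp only [W_eq_sum]
  have main : ∀ p : Fin n, (p = i ∨ p = j) → p ∈ I → Equiv.swap i j p ∉ I →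
      y ^ k * ∑ σ, Wterm I hI lam t (z ∘ Equiv.swap i j) y σ
      = exchDiag (slotDiff i j I) (lam - (wt I j : F) * y) (z i - z j) y
          * (y ^ k * ∑ σ, Wterm I hI lam t z y σ)
        + exchOff (slotDiff i j I) (lam - (wt I j : F) * y) (z i - z j) y
          * (y ^ k * ∑ σ, Wterm (permSet (Equiv.swap i j) I) ((Finset.card_map _).trans hI)
              lam t z y σ) := by
    intro p hp hpI hqI
    simp only [Wterm_exchange hij I hI lam t z y hL hw hp hpI hqI, Finset.sum_add_distrib,
      ← Finset.mul_sum]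
    ring
  by_cases hi : i ∈ I <;> by_cases hj : j ∈ I
  · rw [sum_Wterm_swap_of_both hij I hI lam t ht z y hi hj]
    simp [slotDiff, hi, hj, exchDiag, exchOff]
  · exact main i (Or.inl rfl) hi (by rwa [Equiv.swap_apply_left])
  · exact main j (Or.inr rfl) hj (by rwa [Equiv.swap_apply_right])
  · have h0 : slotDiff i j I = 0 := by simp [slotDiff, hi, hj]
    rw [h0]
    simp only [exchDiag, exchOff, if_true, one_mul, zero_mul, add_zero]
    congr 1
    refine Finset.sum_congr rfl fun σ _ => ?_
    simp only [Wterm]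
    congr 1
    refine Finset.prod_congr rfl fun r _ => row_swap_of_ne hij I lam _ z y ?_ ?_
    · exact fun e => hi (e ▸ Finset.orderEmbOfFin_mem I hI r)
    · exact fun e => hj (e ▸ Finset.orderEmbOfFin_mem I hI r)

end Weight

/-! ### Values of weight functions at fixed points -/

/-- The values `σ r` and `r` have the same sum, so none of the inequalities is strict. -/
theorem perm_eq_one_of_le {k : ℕ} (σ : Equiv.Perm (Fin k)) (h : ∀ r, σ r ≤ r) : σ = 1 := by
  have h1 : ∑ r, ((σ r : Fin k) : ℕ) = ∑ r : Fin k, (r : ℕ) :=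
    Equiv.sum_comp σ fun r : Fin k => (r : ℕ)
  have h2 := (Finset.sum_eq_sum_iff_of_le (fun r _ => Fin.le_def.1 (h r))).1 h1
  ext r
  exact h2 r (Finset.mem_univ r)

theorem prod_orderEmbOfFin {n m : ℕ} {M : Type*} [CommMonoid M] (S : Finset (Fin n))
    (hS : S.card = m) (f : Fin n → M) : ∏ i : Fin m, f (S.orderEmbOfFin hS i) = ∏ a ∈ S, f a := by
  conv_rhs => rw [← Finset.image_orderEmbOfFin_univ S hS]
  rw [Finset.prod_image (fun a _ b _ hab => (S.orderEmbOfFin hS).injective hab)]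

theorem exists_perm_orderEmbOfFin {n m : ℕ} (σ : Equiv.Perm (Fin n)) (S T : Finset (Fin n))
    (hS : S.card = m) (hT : T.card = m) (hST : T = permSet σ S) :
    ∃ ρ : Equiv.Perm (Fin m), ∀ r, T.orderEmbOfFin hT r = σ (S.orderEmbOfFin hS (ρ r)) := by
  have h : ∀ r, ∃ q, S.orderEmbOfFin hS q = σ.symm (T.orderEmbOfFin hT r) := by
    intro r
    have : σ.symm (T.orderEmbOfFin hT r) ∈ Set.range (S.orderEmbOfFin hS) := by
      rw [Finset.range_orderEmbOfFin, Finset.mem_coe, ← mem_permSet, ← hST]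
      exact Finset.orderEmbOfFin_mem T hT r
    exact this
  choose f hf using h
  have hinj : Function.Injective f := by
    intro a b hab
    have := hf a
    rw [hab, hf b] at this
    exact ((T.orderEmbOfFin hT).injective (σ.symm.injective this)).symm
  exact ⟨Equiv.ofBijective f (Finite.injective_iff_bijective.1 hinj), fun r => by simp [hf]⟩

section Weight
variable {F : Type*} [Field F] {n k : ℕ}

theorem W_comp_perm (I : Finset (Fin n)) (hI : I.card = k) (lam : F) (t : Fin k → F)
    (z : Fin n → F) (y : F) (π : Equiv.Perm (Fin k)) :
    W I hI lam (t ∘ π) z y = W I hI lam t z y := by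
  rw [W_eq_sum, W_eq_sum, ← Equiv.sum_comp (Equiv.mulLeft π) (Wterm I hI lam t z y)]
  rfl

theorem ek_comp_perm (t : Fin k → F) (y : F) (π : Equiv.Perm (Fin k)) :
    ek (t ∘ π) y = ek t y := by
  rw [ek, ek, ← Equiv.prod_comp π fun a => ∏ b, (t a - t b + y)]
  exact Finset.prod_congr rfl fun a _ => Equiv.prod_comp π fun b => t (π a) - t b + y

theorem map_W {F' : Type*} [Field F'] (f : F →+* F') (I : Finset (Fin n)) (hI : I.card = k)
    (lam : F) (t : Fin k → F) (z : Fin n → F) (y : F) :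
    f (W I hI lam t z y) = W I hI (f lam) (f ∘ t) (f ∘ z) (f y) := by
  simp only [W, lfac, map_mul, map_pow, map_sum, map_prod, map_div₀, map_add, map_sub,
    apply_ite f, map_intCast, Function.comp_apply]

theorem map_ek {F' : Type*} [Field F'] (f : F →+* F') (t : Fin k → F) (y : F) :
    f (ek t y) = ek (f ∘ t) (f y) := by
  simp only [ek, map_prod, map_add, map_sub, Function.comp_apply]

/-- In each summand, row `r` contains the factor t - z_a with a the element of `I` substituted for
t. It lies to the right of the r-th element of `K`, so no y or λ is added and the factor vanishes.
-/
theorem W_eq_zero (I K : Finset (Fin n)) (hI : I.card = k) (hK : K.card = k) (lam : F)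
    (z : Fin n → F) (y : F)
    (h : ∀ σ : Equiv.Perm (Fin k), ∃ r, K.orderEmbOfFin hK r < I.orderEmbOfFin hI (σ r)) :
    W K hK lam (z ∘ I.orderEmbOfFin hI) z y = 0 := by
  rw [W_eq_sum, Finset.sum_eq_zero, mul_zero]
  intro σ _
  obtain ⟨r, hr⟩ := h σ
  rw [Wterm, Finset.prod_eq_zero (Finset.mem_univ r), zero_mul]
  refine Finset.prod_eq_zero (Finset.mem_univ (I.orderEmbOfFin hI (σ r))) ?_
  simp [lfac, hr.not_gt, hr.ne']

/-- The identity is the only surviving permutation. Its factors at positions of `I`, combined with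
the pair factors, build `ek` and the dynamical factors; the positions outside `I` give the last
product. -/
theorem W_diag (I : Finset (Fin n)) (hI : I.card = k) (lam : F) (z : Fin n → F)
    (hz : Function.Injective z) (y : F) :
    W I hI lam (z ∘ I.orderEmbOfFin hI) z y
      = ek (z ∘ I.orderEmbOfFin hI) y * (∏ i ∈ I, (lam - (wt I i : F) * y))
        * ∏ i ∈ I, ∏ a ∈ Iᶜ, if a < i then z i - z a + y else z i - z a := by
  rw [W_eq_sum, Finset.sum_eq_single 1]
  · rw [← prod_orderEmbOfFin I hI, ← prod_orderEmbOfFin I hI, Wterm, ek]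
    -- The factors of `ek` with equal indices are y, one for each row.
    have hy : y ^ k = ∏ _r : Fin k, y := by simp
    rw [hy, ← Finset.prod_mul_distrib, ← Finset.prod_mul_distrib, ← Finset.prod_mul_distrib,
      ← Finset.prod_mul_distrib]
    refine Finset.prod_congr rfl fun r _ => ?_
    simp only [Equiv.Perm.coe_one, id_eq, Function.comp_apply]
    have h1 : row I lam (z (I.orderEmbOfFin hI r)) z y (I.orderEmbOfFin hI r)
        = (∏ s, lfac I lam (z (I.orderEmbOfFin hI r)) z y (I.orderEmbOfFin hI r)
            (I.orderEmbOfFin hI s))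
          * ∏ a ∈ Iᶜ, if a < I.orderEmbOfFin hI r then z (I.orderEmbOfFin hI r) - z a + y
              else z (I.orderEmbOfFin hI r) - z a := by
      rw [row, ← Finset.prod_mul_prod_compl I, prod_orderEmbOfFin I hI]
      congr 1
      refine Finset.prod_congr rfl fun a ha => ?_
      have : a ≠ I.orderEmbOfFin hI r := by
        rintro rfl
        exact (Finset.mem_compl.1 ha) (Finset.orderEmbOfFin_mem I hI r)
      simp [lfac, this]
    rw [h1, Finset.prod_filter]
    -- In row r, earlier indices already carry the summand y. Later ones are z_r - z_b, which the
    -- denominators of the pair factors cancel, leaving z_r - z_b + y.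
    have h2 : y * ((∏ s, lfac I lam (z (I.orderEmbOfFin hI r)) z y (I.orderEmbOfFin hI r)
          (I.orderEmbOfFin hI s))
        * ∏ b, if r < b then (z (I.orderEmbOfFin hI r) - z (I.orderEmbOfFin hI b) + y)
            / (z (I.orderEmbOfFin hI r) - z (I.orderEmbOfFin hI b)) else 1)
        = (∏ b, (z (I.orderEmbOfFin hI r) - z (I.orderEmbOfFin hI b) + y))
          * (lam - (wt I (I.orderEmbOfFin hI r) : F) * y) := by
      rw [← Finset.prod_mul_distrib, ← Finset.mul_prod_erase _ _ (Finset.mem_univ r),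
        ← Finset.mul_prod_erase Finset.univ
          (fun b => z (I.orderEmbOfFin hI r) - z (I.orderEmbOfFin hI b) + y) (Finset.mem_univ r)]
      have h3 : ∀ b ∈ Finset.univ.erase r,
          lfac I lam (z (I.orderEmbOfFin hI r)) z y (I.orderEmbOfFin hI r) (I.orderEmbOfFin hI b)
            * (if r < b then (z (I.orderEmbOfFin hI r) - z (I.orderEmbOfFin hI b) + y)
              / (z (I.orderEmbOfFin hI r) - z (I.orderEmbOfFin hI b)) else 1)
          = z (I.orderEmbOfFin hI r) - z (I.orderEmbOfFin hI b) + y := by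
        intro b hb
        have hbr : b ≠ r := Finset.ne_of_mem_erase hb
        have hne : z (I.orderEmbOfFin hI r) - z (I.orderEmbOfFin hI b) ≠ 0 :=
          sub_ne_zero.2 fun e => hbr ((I.orderEmbOfFin hI).injective (hz e)).symm
        rcases lt_or_gt_of_ne hbr with h | h
        · simp [lfac, h, h.not_gt]
        · simp only [lfac, (I.orderEmbOfFin hI).lt_iff_lt, h, h.not_gt, if_false, if_true,
            EmbeddingLike.apply_eq_iff_eq, hbr]
          field_simp
      rw [Finset.prod_congr rfl h3]
      simp [lfac]
      ring
    rw [← h2]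
    ring
  · intro σ _ hσ
    obtain ⟨r, hr⟩ : ∃ r, r < σ r := by
      by_contra hcon
      push Not at hcon
      exact hσ (perm_eq_one_of_le σ hcon)
    have hr' := (I.orderEmbOfFin hI).strictMono hr
    rw [Wterm, Finset.prod_eq_zero (Finset.mem_univ r), zero_mul]
    refine Finset.prod_eq_zero (Finset.mem_univ (I.orderEmbOfFin hI (σ r))) ?_
    simp [lfac, hr.not_gt, hr.ne']
  · simp

end Weight

/-! ### Permutations acting on fixed points -/

section Sub
variable {n k : ℕ}

/-- The image of a `k`-element subset under a permutation. -/
def permSub (σ : Equiv.Perm (Fin n)) (I : Sub n k) : Sub n k :=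
  ⟨permSet σ I.1, (Finset.card_map _).trans I.2⟩

theorem permSub_mul (σ τ : Equiv.Perm (Fin n)) (I : Sub n k) :
    permSub (σ * τ) I = permSub σ (permSub τ I) := by
  apply Subtype.ext
  ext a
  simp [permSub, Equiv.Perm.mul_def]

theorem permSub_one (I : Sub n k) : permSub 1 I = I := by
  apply Subtype.ext
  ext a
  simp [permSub, Equiv.Perm.one_def]

theorem permSub_swap_swap (i j : Fin n) (I : Sub n k) :
    permSub (Equiv.swap i j) (permSub (Equiv.swap i j) I) = I := by
  rw [← permSub_mul, Equiv.swap_mul_self, permSub_one]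

theorem permSet_compl (σ : Equiv.Perm (Fin n)) (I : Finset (Fin n)) :
    (permSet σ I)ᶜ = permSet σ Iᶜ := by
  ext a
  simp only [Finset.mem_compl, mem_permSet]

theorem permK_RI (σ : Equiv.Perm (Fin n)) (I : Sub n k) :
    permK σ (RI I) = RI (permSub σ I) := by
  simp [RI, permSub, permSet_compl, Finset.prod_map]

theorem permK_QI (σ : Equiv.Perm (Fin n)) (I : Sub n k) :
    permK σ (QI I) = QI (permSub σ I) := by
  simp [QI, permSub, permSet_compl, Finset.prod_map]

theorem RI_ne_zero (I : Sub n k) : RI I ≠ 0 := by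
  refine Finset.prod_ne_zero_iff.2 fun a ha => Finset.prod_ne_zero_iff.2 fun b hb => ?_
  exact zK_sub_ne_zero fun e => (Finset.mem_compl.1 hb) (e ▸ ha)

theorem QI_ne_zero (I : Sub n k) : QI I ≠ 0 :=
  Finset.prod_ne_zero_iff.2 fun a _ => Finset.prod_ne_zero_iff.2 fun b _ => zK_sub_add_ne_zero a b

theorem zSub_eq (I : Sub n k) : zSub I = zK n ∘ I.1.orderEmbOfFin I.2 := rfl

theorem zSub_injective (I : Sub n k) : Function.Injective (zSub I) :=
  (zK_injective n).comp (I.1.orderEmbOfFin I.2).injective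

/-- A permutation need not preserve the increasing enumeration of a subset. The reordering `ρ` is
harmless because `W` and `ek` are symmetric in t. -/
theorem exists_permK_zSub (σ : Equiv.Perm (Fin n)) (I : Sub n k) :
    ∃ ρ : Equiv.Perm (Fin k), permK σ ∘ zSub I = zSub (permSub σ I) ∘ ρ := by
  obtain ⟨ρ, hρ⟩ := exists_perm_orderEmbOfFin σ I.1 (permSub σ I).1 I.2 (permSub σ I).2 rfl
  refine ⟨ρ⁻¹, funext fun r => ?_⟩
  simp [zSub, hρ]

theorem permK_comp_zK (σ : Equiv.Perm (Fin n)) : permK σ ∘ zK n = zK n ∘ σ := by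
  funext a; simp

theorem ek_ne_zero (I : Sub n k) : ek (zSub I) (yK n) ≠ 0 :=
  Finset.prod_ne_zero_iff.2 fun _ _ => Finset.prod_ne_zero_iff.2 fun _ _ =>
    zK_sub_add_ne_zero _ _

theorem permK_ek (σ : Equiv.Perm (Fin n)) (I : Sub n k) :
    permK σ (ek (zSub I) (yK n)) = ek (zSub (permSub σ I)) (yK n) := by
  obtain ⟨ρ, hρ⟩ := exists_permK_zSub σ I
  have := map_ek (permK σ : RatK n →+* RatK n) (zSub I) (yK n)
  simp only [RingHom.coe_coe, permK_yK, hρ, ek_comp_perm] at this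
  exact this

theorem permK_W (σ : Equiv.Perm (Fin n)) (I : Sub n k) (J : Finset (Fin n)) (hJ : J.card = k)
    (lam : RatK n) (z : Fin n → RatK n) :
    permK σ (W J hJ lam (zSub I) z (yK n))
      = W J hJ (permK σ lam) (zSub (permSub σ I)) (permK σ ∘ z) (yK n) := by
  obtain ⟨ρ, hρ⟩ := exists_permK_zSub σ I
  have := map_W (permK σ : RatK n →+* RatK n) J hJ lam (zSub I) z (yK n)
  simp only [RingHom.coe_coe, permK_yK, hρ, W_comp_perm] at this
  exact this

theorem perm_adjacent_induction (P : Equiv.Perm (Fin n) → Prop) (h1 : P 1)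
    (hs : ∀ i j : Fin n, (j : ℕ) = i + 1 → ∀ σ, P σ → P (Equiv.swap i j * σ)) : ∀ σ, P σ := by
  intro σ
  rcases n with _ | m
  · rwa [Subsingleton.elim σ 1]
  · have hσ : σ ∈ Submonoid.closure
        (Set.range fun i : Fin m => Equiv.swap i.castSucc i.succ) := by
      rw [Equiv.Perm.mclosure_swap_castSucc_succ]; trivial
    induction hσ using Submonoid.closure_induction_left with
    | one => exact h1
    | mul_left x hx y _ ih =>
      obtain ⟨i, rfl⟩ := hx
      exact hs _ _ (by simp) _ ih

/-- `fixedPt I` as a bijection. -/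
def fixedEquiv (I : Sub n k) : Gam n k ≃ Fin n := finSumEquivOfFinset I.2 (card_compl_sub I)

theorem fixedEquiv_apply (I : Sub n k) (g : Gam n k) : fixedEquiv I g = fixedPt I g := by
  rcases g with r | r
  · exact finSumEquivOfFinset_inl _ _ _
  · exact finSumEquivOfFinset_inr _ _ _

theorem fixedPt_mem_iff (I : Sub n k) (g : Gam n k) : fixedPt I g ∈ I.1 ↔ g.isLeft := by
  rcases g with r | r
  · simp [fixedPt]
  · have := Finset.orderEmbOfFin_mem I.1ᶜ (card_compl_sub I) r
    rw [Finset.mem_compl] at this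
    simp [fixedPt, this]

theorem exists_permSub_eq (I J : Sub n k) : ∃ σ, permSub σ I = J := by
  refine ⟨(fixedEquiv I).symm.trans (fixedEquiv J), Subtype.ext (Finset.ext fun a => ?_)⟩
  rw [permSub, mem_permSet]
  obtain ⟨g, rfl⟩ := (fixedEquiv J).surjective a
  simp only [Equiv.symm_trans_apply, Equiv.symm_symm, Equiv.symm_apply_apply]
  rw [fixedEquiv_apply, fixedEquiv_apply, fixedPt_mem_iff, fixedPt_mem_iff]

/-- The group generated by adjacent transpositions is transitive on k-subsets. The base point will
be `topSub`, where everything is triangular. -/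
theorem sub_induction (I₀ : Sub n k) (P : Sub n k → Prop) (h0 : P I₀)
    (hs : ∀ i j : Fin n, (j : ℕ) = i + 1 → ∀ I, P I → P (permSub (Equiv.swap i j) I)) :
    ∀ I, P I := by
  intro I
  obtain ⟨σ, rfl⟩ := exists_permSub_eq I₀ I
  refine perm_adjacent_induction (fun σ => P (permSub σ I₀)) ?_ (fun i j hij σ ih => ?_) σ
  · rwa [permSub_one]
  · rw [permSub_mul]
    exact hs i j hij _ ih

/-- The inclusion of `[k]` in `[n]` as the last `k` elements. -/
def lastEmb (hk : k ≤ n) : Fin k ↪ Fin n where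
  toFun r := ⟨n - k + r, by omega⟩
  inj' a b h := by simpa [Fin.ext_iff] using h

/-- The subset of the last `k` elements of `[n]`. -/
def topSub (hk : k ≤ n) : Sub n k := ⟨Finset.univ.map (lastEmb hk), by simp⟩

theorem mem_topSub (hk : k ≤ n) (a : Fin n) : a ∈ (topSub hk).1 ↔ n - k ≤ a := by
  simp only [topSub, Finset.mem_map, Finset.mem_univ, true_and]
  constructor
  · rintro ⟨r, rfl⟩
    exact Nat.le_add_right _ _
  · intro h
    refine ⟨⟨a - (n - k), by omega⟩, Fin.ext ?_⟩
    change n - k + (a - (n - k)) = (a : ℕ)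
    omega

end Sub

/-! ### The action of adjacent transpositions and its covariant families -/

section Exch
variable {n k : ℕ}

/-- The diagonal coefficient of the exchange operator on `v_P`. -/
def diagK (i j : Fin n) (P : Finset (Fin n)) : RatK n :=
  exchDiag (slotDiff i j P) (lamK n - (wt P j : RatK n) * yK n) (zK n i - zK n j) (yK n)

/-- The off-diagonal coefficient of the exchange operator on `v_P`. -/
def offK (i j : Fin n) (P : Finset (Fin n)) : RatK n :=
  exchOff (slotDiff i j P) (lamK n - (wt P j : RatK n) * yK n) (zK n i - zK n j) (yK n)

/-- The action of the adjacent transposition of `i` and `j`: the dynamical R-matrix composed with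
the permutations of the tensor factors and of the variables `z`. -/
def exchT (i j : Fin n) (ζ : Finset (Fin n) → RatK n) (P : Finset (Fin n)) : RatK n :=
  diagK i j P * permK (Equiv.swap i j) (ζ P)
    + offK i j P * permK (Equiv.swap i j) (ζ (permSet (Equiv.swap i j) P))

theorem permK_swap_swap (i j : Fin n) (x : RatK n) :
    permK (Equiv.swap i j) (permK (Equiv.swap i j) x) = x := by
  rw [← permK_mul, Equiv.swap_mul_self, permK_one]

theorem slotDiff_permSet_swap (i j : Fin n) (P : Finset (Fin n)) :
    slotDiff i j (permSet (Equiv.swap i j) P) = -slotDiff i j P := by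
  simp only [slotDiff, mem_permSet_swap, Equiv.swap_apply_left, Equiv.swap_apply_right]
  ring

theorem wt_permSet_swap {i j : Fin n} (hij : (j : ℕ) = i + 1) (P : Finset (Fin n)) {a : Fin n}
    (ha : a ≠ i) : wt (permSet (Equiv.swap i j) P) a = wt P a := by
  rw [wt_eq_tailWeight, wt_eq_tailWeight, tailWeight_permSet_swap hij P ha]

theorem wt_adjacent {i j : Fin n} (hij : (j : ℕ) = i + 1) (P : Finset (Fin n)) :
    wt P i = wt P j + if j ∈ P then 1 else -1 := by
  rw [wt_eq_tailWeight, wt_eq_tailWeight, tailWeight_adjacent hij]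

theorem permSet_swap_eq_self {i j : Fin n} {P : Finset (Fin n)} (h : slotDiff i j P = 0) :
    permSet (Equiv.swap i j) P = P := by
  have hiff : i ∈ P ↔ j ∈ P := by
    rw [slotDiff] at h
    by_cases hi : i ∈ P <;> by_cases hj : j ∈ P <;> simp_all
  ext a
  rw [mem_permSet_swap]
  rcases eq_or_ne a i with rfl | hai
  · rw [Equiv.swap_apply_left, hiff]
  rcases eq_or_ne a j with rfl | haj
  · rw [Equiv.swap_apply_right, hiff]
  rw [Equiv.swap_apply_of_ne_of_ne hai haj]

/-- Moving the element `i` to `j` raises its weight by one and leaves the weights of the other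
elements unchanged, so a single factor is replaced. -/
theorem Cfac_swap {F : Type*} [Field F] {i j : Fin n} (hij : (j : ℕ) = i + 1)
    (P : Finset (Fin n)) (hi : i ∈ P) (hj : j ∉ P) (r : ℤ) (lam y : F) :
    Cfac r P lam y * (lam - ((wt P j + r : ℤ) : F) * y)
      = Cfac r (permSet (Equiv.swap i j) P) lam y
        * (lam - ((wt P j - 1 + r : ℤ) : F) * y) := by
  have hne := adjacent_ne hij
  have h1 : wt P i = wt P j - 1 := by rw [wt_adjacent hij, if_neg hj]; ring
  rw [Cfac, Cfac, Finset.prod_map, ← Finset.mul_prod_erase P _ hi,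
    ← Finset.mul_prod_erase P (fun _ => _ - _) hi, h1]
  simp only [Equiv.coe_toEmbedding, Equiv.swap_apply_left, wt_permSet_swap hij P hne.symm]
  have h2 : ∏ x ∈ P.erase i, (lam - ((wt P x + r : ℤ) : F) * y)
      = ∏ x ∈ P.erase i, (lam - ((wt (permSet (Equiv.swap i j) P) (Equiv.swap i j x) + r : ℤ) : F)
        * y) := by
    refine Finset.prod_congr rfl fun x hx => ?_
    have hxi := Finset.ne_of_mem_erase hx
    have hxj : x ≠ j := fun e => hj (e ▸ Finset.mem_of_mem_erase hx)
    rw [Equiv.swap_apply_of_ne_of_ne hxi hxj, wt_permSet_swap hij P hxi]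
  rw [h2]
  ring

theorem slotDiff_cases (i j : Fin n) (P : Finset (Fin n)) :
    (slotDiff i j P = 0) ∨ (slotDiff i j P = 1 ∧ i ∈ P ∧ j ∉ P)
      ∨ (slotDiff i j P = -1 ∧ i ∉ P ∧ j ∈ P) := by
  rw [slotDiff]
  by_cases hi : i ∈ P <;> by_cases hj : j ∈ P <;> simp [hi, hj]

/-- With L = lam - wt P j · y, `Cfac_swap` contributes the ratios (L + y) / L for r = 0 and L / (L -
y) for r = 1. The common L is cancelled. -/
theorem CC_swap_aux {F : Type*} [Field F] {i j : Fin n} (hij : (j : ℕ) = i + 1)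
    (P : Finset (Fin n)) (hi : i ∈ P) (hj : j ∉ P) (lam y : F) (hL : lam - (wt P j : F) * y ≠ 0) :
    Cfac 0 P lam y * Cfac 1 P lam y * (lam - (wt P j : F) * y - y)
      = Cfac 0 (permSet (Equiv.swap i j) P) lam y * Cfac 1 (permSet (Equiv.swap i j) P) lam y
        * (lam - (wt P j : F) * y + y) := by
  have h0 := Cfac_swap hij P hi hj 0 lam y
  have h1 := Cfac_swap hij P hi hj 1 lam y
  refine mul_left_cancel₀ hL ?_
  push_cast at h0 h1
  ring_nf at h0 h1 ⊢
  linear_combination (Cfac 1 P lam y * (lam - y * wt P j - y)) * h0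
    + (Cfac 0 (permSet (Equiv.swap i j) P) lam y * (lam - y * wt P j + y)) * h1

theorem CC_swap {i j : Fin n} (hij : (j : ℕ) = i + 1) (P : Finset (Fin n)) {lam y : RatK n}
    (hL : lam - (wt P j : RatK n) * y ≠ 0) :
    Cfac 0 P lam y * Cfac 1 P lam y * (lam - (wt P j : RatK n) * y - (slotDiff i j P : RatK n) * y)
      = Cfac 0 (permSet (Equiv.swap i j) P) lam y * Cfac 1 (permSet (Equiv.swap i j) P) lam y
        * (lam - (wt P j : RatK n) * y + (slotDiff i j P : RatK n) * y) := by
  have hne := adjacent_ne hij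
  rcases slotDiff_cases i j P with h | ⟨h, hi, hj⟩ | ⟨h, hi, hj⟩
  · rw [h, permSet_swap_eq_self h]; simp
  · have := CC_swap_aux hij P hi hj lam y hL
    rw [h]; push_cast; rw [one_mul]; exact this
  · have h1 : i ∈ permSet (Equiv.swap i j) P := by
      rwa [mem_permSet_swap, Equiv.swap_apply_left]
    have h2 : j ∉ permSet (Equiv.swap i j) P := by
      rwa [mem_permSet_swap, Equiv.swap_apply_right]
    have := CC_swap_aux hij _ h1 h2 lam y (by rwa [wt_permSet_swap hij P hne.symm])
    rw [permSet_swap_swap, wt_permSet_swap hij P hne.symm] at this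
    rw [h]
    push_cast
    linear_combination -this

/-! ### Covariance of the restrictions to fixed points. -/

/-- The value of `W̃⁺_J` at the fixed point `x_I`, and `0` if `|J| ≠ |I|`. -/
def plusAt (J : Finset (Fin n)) (I : Sub n k) : RatK n :=
  if hJ : J.card = k then Wplus J hJ (lamK n) (zSub I) (zK n) (yK n) else 0

theorem Cfac_ne_zero (r : ℤ) (J : Finset (Fin n)) : Cfac r J (lamK n) (yK n) ≠ 0 :=
  Finset.prod_ne_zero_iff.2 fun _ _ => lamK_sub_ne_zero n _

theorem Wperm_one {F : Type*} [Field F] (J : Finset (Fin n)) (hJ : J.card = k) (lam : F)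
    (t : Fin k → F) (z : Fin n → F) (y : F) : Wperm 1 J hJ lam t z y = W J hJ lam t z y := by
  have h : J.map ((1 : Equiv.Perm (Fin n))⁻¹).toEmbedding = J := by
    ext a; rw [mem_permSet]; rfl
  unfold Wperm
  congr 1

theorem plusAt_of_card (J : Finset (Fin n)) (I : Sub n k) (hJ : J.card = k) :
    plusAt J I = W J hJ (lamK n) (zSub I) (zK n) (yK n)
      / (Cfac 0 J (lamK n) (yK n) * Cfac 1 J (lamK n) (yK n) * ek (zSub I) (yK n)) := by
  rw [plusAt, dif_pos hJ, Wplus, Wperm_one]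
  ring

theorem zK_sub_sub_ne_zero {i j : Fin n} : zK n i - zK n j - yK n ≠ 0 := by
  have := zK_sub_add_ne_zero j i
  intro h
  apply this
  linear_combination -h

/-- This is the exchange relation of `W` after normalization. The factors C⁽⁰⁾C⁽¹⁾ turn the
off-diagonal coefficient of `J` into that of the swapped set, that is, they transpose the matrix.
The pairing with `exchT` requires this transposed form. -/
theorem permK_plusAt {i j : Fin n} (hij : (j : ℕ) = i + 1) (J : Finset (Fin n)) (I : Sub n k) :
    permK (Equiv.swap i j) (plusAt J I)
      = diagK i j J * plusAt J (permSub (Equiv.swap i j) I)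
        + offK i j (permSet (Equiv.swap i j) J)
          * plusAt (permSet (Equiv.swap i j) J) (permSub (Equiv.swap i j) I) := by
  by_cases hJ : J.card = k
  · have hJ' : (permSet (Equiv.swap i j) J).card = k := (Finset.card_map _).trans hJ
    have hL := lamK_sub_ne_zero n (wt J j)
    have hw := zK_sub_sub_ne_zero (i := i) (j := j)
    have hC := CC_swap hij J hL
    have hC0 := Cfac_ne_zero 0 J
    have hC1 := Cfac_ne_zero 1 J
    have hD0 := Cfac_ne_zero 0 (permSet (Equiv.swap i j) J)
    have hD1 := Cfac_ne_zero 1 (permSet (Equiv.swap i j) J)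
    rw [plusAt_of_card _ _ hJ, plusAt_of_card _ _ hJ, plusAt_of_card _ _ hJ', map_div₀, map_mul,
      map_mul, permK_ek, permK_W, permK_lamK, permK_comp_zK,
      W_exchange hij J hJ (lamK n) _ (zSub_injective _) (zK n) (yK n) hL hw]
    have hCp : ∀ r, permK (Equiv.swap i j) (Cfac r J (lamK n) (yK n))
        = Cfac r J (lamK n) (yK n) := by
      intro r; simp [Cfac]
    rw [hCp, hCp, diagK, offK, slotDiff_permSet_swap,
      wt_permSet_swap hij J (adjacent_ne hij).symm]
    have he := ek_ne_zero (permSub (Equiv.swap i j) I)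
    -- This is `CC_swap` rewritten for the off-diagonal coefficients.
    have key : exchOff (slotDiff i j J) (lamK n - (wt J j : RatK n) * yK n) (zK n i - zK n j) (yK n)
        * (Cfac 0 (permSet (Equiv.swap i j) J) (lamK n) (yK n)
          * Cfac 1 (permSet (Equiv.swap i j) J) (lamK n) (yK n))
        = exchOff (-slotDiff i j J) (lamK n - (wt J j : RatK n) * yK n) (zK n i - zK n j) (yK n)
        * (Cfac 0 J (lamK n) (yK n) * Cfac 1 J (lamK n) (yK n)) := by
      simp only [exchOff, neg_eq_zero]
      split_ifs
      · simp
      · push_cast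
        generalize lamK n - (wt J j : RatK n) * yK n = L at *
        field_simp
        linear_combination (-(zK n i - zK n j)) * hC
    generalize W J hJ (lamK n) _ _ _ = A
    generalize W (permSet (Equiv.swap i j) J) _ (lamK n) _ _ _ = B
    generalize (exchOff (slotDiff i j J) _ _ _ : RatK n) = b at *
    generalize (exchOff (-slotDiff i j J) _ _ _ : RatK n) = b' at *
    generalize (exchDiag _ _ _ _ : RatK n) = a at *
    field_simp
    linear_combination B * key
  · simp [plusAt, hJ]

/-- The restriction to the fixed point `x_I` of the class that corresponds to `ζ`. -/
def locSum (ζ : Finset (Fin n) → RatK n) (I : Sub n k) : RatK n := ∑ J, ζ J * plusAt J I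

/-- Since `permK_plusAt` carries the transposed matrix, moving the exchange operator across the
pairing leaves only the permutation of the variables. -/
theorem locSum_exchT {i j : Fin n} (hij : (j : ℕ) = i + 1) (ζ : Finset (Fin n) → RatK n)
    (I : Sub n k) : locSum (exchT i j ζ) (permSub (Equiv.swap i j) I)
      = permK (Equiv.swap i j) (locSum ζ I) := by
  simp only [locSum, map_sum, map_mul, permK_plusAt hij, exchT, add_mul, mul_add,
    Finset.sum_add_distrib]
  congr 1
  · exact Finset.sum_congr rfl fun J _ => by ring
  · let e : Finset (Fin n) ≃ Finset (Fin n) :=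
      ⟨permSet (Equiv.swap i j), permSet (Equiv.swap i j), permSet_swap_swap i j,
        permSet_swap_swap i j⟩
    refine Fintype.sum_equiv e _ _ fun J => ?_
    simp only [e, Equiv.coe_fn_mk, permSet_swap_swap]
    ring

/-! ### Covariance of the vectors ξ_I. -/

theorem exchDiag_neg {F : Type*} [Field F] (e : ℤ) (L w y : F) :
    exchDiag (-e) (-L) w y = exchDiag e L w y := by
  simp only [exchDiag, neg_eq_zero]
  split_ifs
  · rfl
  · push_cast
    rw [neg_mul L, div_neg, ← neg_div]
    congr 1
    ring

theorem exchOff_neg {F : Type*} [Field F] (e : ℤ) (L w y : F) :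
    exchOff (-e) (-L) w y = exchOff e L w y := by
  simp only [exchOff, neg_eq_zero]
  split_ifs
  · rfl
  · push_cast
    rw [neg_mul L, div_neg, ← neg_div]
    congr 1
    ring

theorem wt_rev (J : Finset (Fin n)) (i : Fin n) :
    wt (permSet (Fin.revPerm : Equiv.Perm (Fin n))⁻¹ J) (Fin.rev i)
      = ∑ b ∈ Finset.univ.filter (fun b => b < i), if b ∈ J then (1 : ℤ) else -1 := by
  rw [wt_eq_tailWeight, tailWeight]
  refine Finset.sum_equiv Fin.revPerm (fun b => ?_) (fun b _ => ?_)
  · simp only [Finset.mem_filter, Finset.mem_univ, true_and, Fin.revPerm_apply]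
    rw [Fin.lt_def, Fin.lt_def, Fin.val_rev, Fin.val_rev]
    omega
  · exact if_congr (by rw [mem_permSet]; rfl) rfl rfl

theorem sum_weights (J : Finset (Fin n)) :
    ∑ b : Fin n, (if b ∈ J then (1 : ℤ) else -1) = 2 * (J.card : ℤ) - n := by
  have : ∀ b : Fin n, (if b ∈ J then (1 : ℤ) else -1) = 2 * (if b ∈ J then 1 else 0) - 1 := by
    intro b; split_ifs <;> ring
  simp only [this, Finset.sum_sub_distrib, ← Finset.mul_sum]
  simp

theorem wt_rev_add_self (J : Finset (Fin n)) {i : Fin n} (hi : i ∈ J) :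
    wt (permSet (Fin.revPerm : Equiv.Perm (Fin n))⁻¹ J) (Fin.rev i) + 1 + wt J i
      = 2 * (J.card : ℤ) - n := by
  have h4 : (Finset.univ : Finset (Fin n))
      = insert i (Finset.univ.filter (fun b => b < i) ∪ Finset.univ.filter (fun b => i < b)) := by
    ext b
    simp only [Finset.mem_univ, Finset.mem_insert, Finset.mem_union, Finset.mem_filter, true_and,
      Fin.lt_def, Fin.ext_iff, true_iff]
    omega
  have h5 : Disjoint (Finset.univ.filter (fun b => b < i))
      (Finset.univ.filter (fun b => i < b)) := by
    rw [Finset.disjoint_left]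
    intro b hb hb'
    simp only [Finset.mem_filter, Finset.mem_univ, true_and, Fin.lt_def] at hb hb'
    omega
  have h2 := sum_weights J
  rw [h4, Finset.sum_insert (by simp), Finset.sum_union h5, if_pos hi] at h2
  rw [wt_rev, wt_eq_tailWeight, tailWeight]
  linarith

/-- Reversal turns the weight to the right of a position into the weight to its left. The positions
`i` and `j` contribute opposite signs, so the rest adds up to the total weight. -/
theorem wt_rev_add {i j : Fin n} (hij : (j : ℕ) = i + 1) (J : Finset (Fin n))
    (h : slotDiff i j J ≠ 0) :
    wt (permSet (Fin.revPerm : Equiv.Perm (Fin n))⁻¹ J) (Fin.rev i) + wt J j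
      = 2 * (J.card : ℤ) - n := by
  have hne := adjacent_ne hij
  have h2 := sum_weights J
  have h3 : (if i ∈ J then (1 : ℤ) else -1) + (if j ∈ J then (1 : ℤ) else -1) = 0 := by
    rcases slotDiff_cases i j J with h' | ⟨_, hi, hj⟩ | ⟨_, hi, hj⟩
    · exact absurd h' h
    · simp [hi, hj]
    · simp [hi, hj]
  have h4 : (Finset.univ : Finset (Fin n))
      = insert i (insert j (Finset.univ.filter (fun b => b < i)
          ∪ Finset.univ.filter (fun b => j < b))) := by
    ext b
    simp only [Finset.mem_univ, Finset.mem_insert, Finset.mem_union, Finset.mem_filter, true_and,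
      Fin.lt_def, Fin.ext_iff, true_iff]
    omega
  have h5 : Disjoint (Finset.univ.filter (fun b => b < i))
      (Finset.univ.filter (fun b => j < b)) := by
    rw [Finset.disjoint_left]
    intro b hb hb'
    simp only [Finset.mem_filter, Finset.mem_univ, true_and, Fin.lt_def] at hb hb'
    omega
  rw [h4, Finset.sum_insert, Finset.sum_insert, Finset.sum_union h5] at h2
  · rw [wt_rev, wt_eq_tailWeight, tailWeight]
    linarith
  · simp only [Finset.mem_union, Finset.mem_filter, Finset.mem_univ, true_and, Fin.lt_def]
    omega
  · simp only [Finset.mem_insert, hne, Finset.mem_union, Finset.mem_filter, Finset.mem_univ,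
      true_and, false_or, Fin.lt_def]
    omega

/-- `W_exchange` is applied to the reversed order, at the adjacent positions `rev j`, `rev i`. By
`wt_rev_add` the argument -λ - (n - 2k) y makes the dynamical parameter the negative of the one at
`J`. The sign of the slot difference also flips, and the coefficients are invariant under changing
both signs. -/
theorem Wperm_rev_exchange {i j : Fin n} (hij : (j : ℕ) = i + 1) (J : Finset (Fin n))
    (hJ : J.card = k) (t : Fin k → RatK n) (ht : Function.Injective t) :
    Wperm Fin.revPerm J hJ (-lamK n - ((n : RatK n) - 2 * (k : RatK n)) * yK n) t (zK n) (yK n)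
      = diagK i j J * Wperm Fin.revPerm J hJ
          (-lamK n - ((n : RatK n) - 2 * (k : RatK n)) * yK n) t (zK n ∘ Equiv.swap i j) (yK n)
        + offK i j J * Wperm Fin.revPerm (permSet (Equiv.swap i j) J)
            ((Finset.card_map _).trans hJ)
          (-lamK n - ((n : RatK n) - 2 * (k : RatK n)) * yK n) t (zK n ∘ Equiv.swap i j)
          (yK n) := by
  have hne := adjacent_ne hij
  have hij' : ((Fin.rev i : Fin n) : ℕ) = Fin.rev j + 1 := by
    simp only [Fin.val_rev]; omega
  set J' := permSet (Fin.revPerm : Equiv.Perm (Fin n))⁻¹ J with hJ'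
  set lam := -lamK n - ((n : RatK n) - 2 * (k : RatK n)) * yK n with hlam
  have hmem : ∀ a, Fin.rev a ∈ J' ↔ a ∈ J := by
    intro a
    rw [hJ', mem_permSet]
    exact iff_of_eq (congrArg (· ∈ J) (Fin.rev_rev a))
  have hslot : slotDiff (Fin.rev j) (Fin.rev i) J' = -slotDiff i j J := by
    simp only [slotDiff, hmem]; ring
  have hLm : ∀ m : ℤ, lam - (m : RatK n) * yK n ≠ 0 := by
    intro m h
    refine lamK_add_ne_zero n ((n : ℤ) - 2 * k + m) ?_
    push_cast
    linear_combination -h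
  have hrev : ∀ a, Equiv.swap (Fin.rev j) (Fin.rev i) a
      = Fin.rev (Equiv.swap i j (Fin.rev a)) := by
    intro a
    have := Equiv.swap_apply_apply (Fin.revPerm : Equiv.Perm (Fin n)) j i
    simp only [Fin.revPerm_apply] at this
    rw [this, Equiv.swap_comm]
    simp
  have key := W_exchange hij' J' ((Finset.card_map _).trans hJ) lam t ht
    (fun a => (zK n ∘ Equiv.swap i j) (Fin.revPerm a)) (yK n) (hLm _)
    (by simpa using zK_sub_sub_ne_zero)
  have hz : (fun a => (zK n ∘ Equiv.swap i j) (Fin.revPerm a))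
      ∘ Equiv.swap (Fin.rev j) (Fin.rev i) = fun a => zK n (Fin.revPerm a) := by
    funext a
    simp [hrev]
  have hset : permSet (Equiv.swap (Fin.rev j) (Fin.rev i)) J'
      = permSet (Fin.revPerm : Equiv.Perm (Fin n))⁻¹ (permSet (Equiv.swap i j) J) := by
    ext a
    rw [mem_permSet_swap, hrev, hmem, mem_permSet, mem_permSet_swap]
    rfl
  rw [hz, hslot] at key
  have hWset : ∀ (A B : Finset (Fin n)) (hA : A.card = k) (hB : B.card = k), A = B →
      ∀ z : Fin n → RatK n, W A hA lam t z (yK n) = W B hB lam t z (yK n) := by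
    rintro A B hA hB rfl z; rfl
  rw [hWset _ _ _ ((Finset.card_map _).trans ((Finset.card_map _).trans hJ)) hset] at key
  unfold Wperm
  rw [key]
  have hw : (zK n ∘ Equiv.swap i j) (Fin.revPerm (Fin.rev j))
      - (zK n ∘ Equiv.swap i j) (Fin.revPerm (Fin.rev i)) = zK n i - zK n j := by
    simp
  rw [hw, diagK, offK]
  by_cases h0 : slotDiff i j J = 0
  · rw [h0]
    simp only [neg_zero, exchDiag, exchOff, if_true, one_mul, zero_mul, add_zero]
    rfl
  · have hwt := wt_rev_add hij J h0
    have hLam : lam - (wt J' (Fin.rev i) : RatK n) * yK n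
        = -(lamK n - (wt J j : RatK n) * yK n) := by
      have : (wt J' (Fin.rev i) : RatK n) = 2 * (k : RatK n) - n - wt J j := by
        rw [eq_sub_iff_add_eq, ← hJ]
        exact_mod_cast hwt
      rw [this, hlam]
      ring
    rw [hLam, exchDiag_neg, exchOff_neg]

/-- The factors 1 / Q_I and 1 / e_k are merely carried to the permuted fixed point;
`Wperm_rev_exchange` does the rest. -/
theorem exchT_xi {i j : Fin n} (hij : (j : ℕ) = i + 1) (I : Sub n k) :
    exchT i j (xi I) = xi (permSub (Equiv.swap i j) I) := by
  funext J
  by_cases hJ : J.card = k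
  · have hJ' : (permSet (Equiv.swap i j) J).card = k := (Finset.card_map _).trans hJ
    have hx : ∀ (A : Finset (Fin n)) (hA : A.card = k), permK (Equiv.swap i j) (xi I A)
        = 1 / QI (permSub (Equiv.swap i j) I) * ((-1) ^ k
            / ek (zSub (permSub (Equiv.swap i j) I)) (yK n)
          * Wperm Fin.revPerm A hA (-lamK n - ((n : RatK n) - 2 * (k : RatK n)) * yK n)
            (zSub (permSub (Equiv.swap i j) I)) (zK n ∘ Equiv.swap i j) (yK n)) := by
      intro A hA
      rw [xi, dif_pos hA, Wminus, Wperm, Wperm, map_mul, map_div₀, map_one, permK_QI, map_mul,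
        map_div₀, permK_ek, permK_W]
      have e1 : permK (Equiv.swap i j) (-lamK n - ((n : RatK n) - 2 * (k : RatK n)) * yK n)
          = -lamK n - ((n : RatK n) - 2 * (k : RatK n)) * yK n := by
        simp only [map_sub, map_neg, map_mul, permK_lamK, permK_yK, map_natCast, map_ofNat]
      have e2 : (permK (Equiv.swap i j) ∘ fun a => zK n (Fin.revPerm a))
          = fun a => (zK n ∘ Equiv.swap i j) (Fin.revPerm a) := by
        funext a; simp
      rw [e1, e2]
      simp
    rw [exchT, hx J hJ, hx _ hJ', xi, dif_pos hJ, Wminus,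
      Wperm_rev_exchange hij J hJ _ (zSub_injective _)]
    ring
  · simp [exchT, xi, hJ]

end Exch

/-! ### Orthogonality -/

section Orth
variable {n k : ℕ}

theorem eq_of_forall_orderEmbOfFin_mem (S T : Finset (Fin n)) (hS : S.card = k) (hT : T.card = k)
    (h : ∀ r, S.orderEmbOfFin hS r ∈ T) : S = T := by
  refine Finset.eq_of_subset_of_card_le (fun a ha => ?_) (hT.trans hS.symm).le
  have : a ∈ Set.range (S.orderEmbOfFin hS) := by rw [Finset.range_orderEmbOfFin]; exact ha
  obtain ⟨r, rfl⟩ := this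
  exact h r

/-- Triangularity: a nonzero term needs every element of `J` to be at least some element of the last
k, and then `J` consists of the last k. -/
theorem plusAt_topSub_of_ne (hk : k ≤ n) (J : Finset (Fin n)) (h : J ≠ (topSub hk).1) :
    plusAt J (topSub hk) = 0 := by
  by_cases hJ : J.card = k
  · rw [plusAt_of_card J _ hJ, zSub_eq, W_eq_zero, zero_div]
    intro σ
    by_contra hcon
    push Not at hcon
    refine h (eq_of_forall_orderEmbOfFin_mem J _ hJ (topSub hk).2 fun r => ?_)
    have h1 := Finset.orderEmbOfFin_mem (topSub hk).1 (topSub hk).2 (σ r)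
    rw [mem_topSub] at h1 ⊢
    exact h1.trans (Fin.le_def.1 (hcon r))
  · rw [plusAt, dif_neg hJ]

theorem plusAt_topSub (hk : k ≤ n) :
    plusAt (topSub hk).1 (topSub hk)
      = QI (topSub hk) / Cfac 1 (topSub hk).1 (lamK n) (yK n) := by
  rw [plusAt_of_card _ _ (topSub hk).2, zSub_eq, W_diag _ _ _ _ (zK_injective n)]
  have h1 : ∏ i ∈ (topSub hk).1, ∏ a ∈ (topSub hk).1ᶜ,
      (if a < i then zK n i - zK n a + yK n else zK n i - zK n a) = QI (topSub hk) := by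
    refine Finset.prod_congr rfl fun i hi => Finset.prod_congr rfl fun a ha => ?_
    rw [if_pos]
    rw [Finset.mem_compl, mem_topSub] at ha
    rw [mem_topSub] at hi
    rw [Fin.lt_def]
    omega
  have h2 : ∏ i ∈ (topSub hk).1, (lamK n - (wt (topSub hk).1 i : RatK n) * yK n)
      = Cfac 0 (topSub hk).1 (lamK n) (yK n) := by simp [Cfac]
  rw [h1, h2, ← zSub_eq]
  have h3 := ek_ne_zero (topSub hk)
  have h4 := Cfac_ne_zero 0 (topSub hk).1
  have h5 := Cfac_ne_zero 1 (topSub hk).1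
  field_simp

/-- Read in the reversed order of the variables, `zSub I` is the increasing list of the reversed
subset up to a permutation, so `W_eq_zero` and `W_diag` become applicable. -/
theorem W_zSub_rev (I : Sub n k) (K : Finset (Fin n)) (hK : K.card = k) (lam : RatK n) :
    W K hK lam (zSub I) (fun a => zK n (Fin.revPerm a)) (yK n)
      = W K hK lam ((fun a => zK n (Fin.revPerm a)) ∘
          (permSub (Fin.revPerm : Equiv.Perm (Fin n))⁻¹ I).1.orderEmbOfFin (permSub _ I).2)
        (fun a => zK n (Fin.revPerm a)) (yK n) ∧
    ek (zSub I) (yK n) = ek ((fun a => zK n (Fin.revPerm a)) ∘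
          (permSub (Fin.revPerm : Equiv.Perm (Fin n))⁻¹ I).1.orderEmbOfFin (permSub _ I).2)
        (yK n) := by
  obtain ⟨ρ, hρ⟩ := exists_perm_orderEmbOfFin (Fin.revPerm : Equiv.Perm (Fin n))⁻¹ I.1
    (permSub (Fin.revPerm : Equiv.Perm (Fin n))⁻¹ I).1 I.2 (permSub _ I).2 rfl
  have h : (fun a => zK n (Fin.revPerm a)) ∘
      (permSub (Fin.revPerm : Equiv.Perm (Fin n))⁻¹ I).1.orderEmbOfFin (permSub _ I).2
      = zSub I ∘ ρ := by
    funext r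
    simp only [Function.comp_apply, hρ]
    exact congrArg (zK n) (Fin.rev_rev _)
  rw [h, W_comp_perm, ek_comp_perm]
  exact ⟨rfl, rfl⟩

theorem mem_permSub_rev_topSub (hk : k ≤ n) (a : Fin n) :
    a ∈ (permSub (Fin.revPerm : Equiv.Perm (Fin n))⁻¹ (topSub hk)).1 ↔ (a : ℕ) < k := by
  have h : a ∈ (permSub (Fin.revPerm : Equiv.Perm (Fin n))⁻¹ (topSub hk)).1
      ↔ Fin.rev a ∈ (topSub hk).1 := mem_permSet
  rw [h, mem_topSub, Fin.val_rev]
  omega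

/-- After reversal the base subset becomes the first k indices, the smallest for the same
triangularity, which now forces the fixed point instead of the coordinate. -/
theorem xi_topSub_of_ne (hk : k ≤ n) (I : Sub n k) (h : I ≠ topSub hk) :
    xi I (topSub hk).1 = 0 := by
  rw [xi, dif_pos (topSub hk).2, Wminus, Wperm, (W_zSub_rev I _ _ _).1, W_eq_zero, mul_zero,
    mul_zero]
  intro σ
  by_contra hcon
  push Not at hcon
  have h1 : (permSub (Fin.revPerm : Equiv.Perm (Fin n))⁻¹ I).1
      = (permSub (Fin.revPerm : Equiv.Perm (Fin n))⁻¹ (topSub hk)).1 := by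
    refine eq_of_forall_orderEmbOfFin_mem _ _ (permSub _ I).2 (permSub _ _).2 fun r => ?_
    rw [mem_permSub_rev_topSub]
    have h2 := hcon (σ.symm r)
    rw [Equiv.apply_symm_apply] at h2
    refine lt_of_le_of_lt (Fin.le_def.1 h2) ?_
    rw [← mem_permSub_rev_topSub hk]
    exact Finset.orderEmbOfFin_mem _ _ _
  apply h
  have h2 := congrArg (permSub (Fin.revPerm : Equiv.Perm (Fin n))) (Subtype.ext h1)
  rwa [← permSub_mul, ← permSub_mul, mul_inv_cancel, permSub_one, permSub_one] at h2

/-- The reversed base subset precedes its complement, so `W_diag` yields R_I without any y. By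
`wt_rev_add_self` each dynamical factor is minus a factor of C⁽¹⁾, and these signs cancel the
(-1)^k. -/
theorem xi_topSub (hk : k ≤ n) :
    xi (topSub hk) (topSub hk).1
      = Cfac 1 (topSub hk).1 (lamK n) (yK n) * RI (topSub hk) / QI (topSub hk) := by
  have hinj : Function.Injective fun a => zK n (Fin.revPerm a) :=
    (zK_injective n).comp Fin.revPerm.injective
  have hek := ek_ne_zero (topSub hk)
  rw [xi, dif_pos (topSub hk).2, Wminus, Wperm, (W_zSub_rev _ _ _ _).1]
  have hd := W_diag (permSub (Fin.revPerm : Equiv.Perm (Fin n))⁻¹ (topSub hk)).1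
    (permSub _ (topSub hk)).2 (-lamK n - ((n : RatK n) - 2 * (k : RatK n)) * yK n) _ hinj (yK n)
  rw [← (W_zSub_rev (topSub hk) (topSub hk).1 (topSub hk).2 0).2] at hd
  have h1 : ∏ i ∈ (permSub (Fin.revPerm : Equiv.Perm (Fin n))⁻¹ (topSub hk)).1,
      ∏ a ∈ (permSub (Fin.revPerm : Equiv.Perm (Fin n))⁻¹ (topSub hk)).1ᶜ,
      (if a < i then zK n (Fin.revPerm i) - zK n (Fin.revPerm a) + yK n
        else zK n (Fin.revPerm i) - zK n (Fin.revPerm a)) = RI (topSub hk) := by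
    have h2 : ∏ i ∈ (permSub (Fin.revPerm : Equiv.Perm (Fin n))⁻¹ (topSub hk)).1,
      ∏ a ∈ (permSub (Fin.revPerm : Equiv.Perm (Fin n))⁻¹ (topSub hk)).1ᶜ,
      (if a < i then zK n (Fin.revPerm i) - zK n (Fin.revPerm a) + yK n
        else zK n (Fin.revPerm i) - zK n (Fin.revPerm a))
      = ∏ i ∈ (permSub (Fin.revPerm : Equiv.Perm (Fin n))⁻¹ (topSub hk)).1,
      ∏ a ∈ (permSub (Fin.revPerm : Equiv.Perm (Fin n))⁻¹ (topSub hk)).1ᶜ,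
      (zK n (Fin.revPerm i) - zK n (Fin.revPerm a)) := by
      refine Finset.prod_congr rfl fun i hi => Finset.prod_congr rfl fun a ha => ?_
      rw [if_neg]
      rw [Finset.mem_compl, mem_permSub_rev_topSub] at ha
      rw [mem_permSub_rev_topSub] at hi
      rw [Fin.lt_def]
      omega
    rw [h2, permSub, permSet_compl, Finset.prod_map, RI]
    refine Finset.prod_congr rfl fun i _ => ?_
    rw [Finset.prod_map]
    refine Finset.prod_congr rfl fun a _ => ?_
    exact congrArg₂ (fun x x' => zK n x - zK n x') (Fin.rev_rev i) (Fin.rev_rev a)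
  have h3 : ∏ i ∈ (permSub (Fin.revPerm : Equiv.Perm (Fin n))⁻¹ (topSub hk)).1,
      ((-lamK n - ((n : RatK n) - 2 * (k : RatK n)) * yK n)
        - (wt (permSub (Fin.revPerm : Equiv.Perm (Fin n))⁻¹ (topSub hk)).1 i : RatK n) * yK n)
      = (-1) ^ k * Cfac 1 (topSub hk).1 (lamK n) (yK n) := by
    conv_lhs => rw [permSub, Finset.prod_map]
    have hk' : ((-1) ^ k : RatK n) = ∏ i ∈ (topSub hk).1, (-1 : RatK n) := by
      rw [Finset.prod_const, (topSub hk).2]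
    rw [hk', Cfac, ← Finset.prod_mul_distrib]
    refine Finset.prod_congr rfl fun i hi => ?_
    have h4 := wt_rev_add_self (topSub hk).1 hi
    rw [(topSub hk).2] at h4
    have h5 : ((wt (permSet (Fin.revPerm : Equiv.Perm (Fin n))⁻¹ (topSub hk).1) (Fin.rev i) : ℤ)
        : RatK n) = 2 * k - n - 1 - wt (topSub hk).1 i := by
      have : wt (permSet (Fin.revPerm : Equiv.Perm (Fin n))⁻¹ (topSub hk).1) (Fin.rev i)
        = 2 * k - n - 1 - wt (topSub hk).1 i := by linarith
      rw [this]
      push_cast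
      ring
    change (-lamK n - ((n : RatK n) - 2 * (k : RatK n)) * yK n)
      - ((wt (permSet (Fin.revPerm : Equiv.Perm (Fin n))⁻¹ (topSub hk).1) (Fin.rev i) : ℤ) : RatK n)
        * yK n = _
    rw [h5]
    push_cast
    ring
  rw [h1, h3] at hd
  have hs : ((-1) ^ k * (-1) ^ k : RatK n) = 1 := by rw [← mul_pow]; simp
  change 1 / QI (topSub hk) * ((-1) ^ k / ek (zSub (topSub hk)) (yK n) *
    W (permSub (Fin.revPerm : Equiv.Perm (Fin n))⁻¹ (topSub hk)).1 _ _ _ _ _) = _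
  rw [hd]
  have hQ := QI_ne_zero (topSub hk)
  field_simp
  linear_combination (Cfac 1 (topSub hk).1 (lamK n) (yK n) * RI (topSub hk)) * hs

theorem sum_eq_sum_sub {M : Type*} [AddCommMonoid M] (f : Finset (Fin n) → M)
    (h : ∀ J, J.card ≠ k → f J = 0) : ∑ J, f J = ∑ K : Sub n k, f K.1 := by
  rw [← Finset.sum_subtype (Finset.univ.filter fun J : Finset (Fin n) => J.card = k) (by simp) f]
  refine (Finset.sum_subset (Finset.subset_univ _) fun J _ hJ => h J ?_).symm
  simpa using hJ

theorem plusAt_of_card_ne (J : Finset (Fin n)) (I : Sub n k) (h : J.card ≠ k) :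
    plusAt J I = 0 := dif_neg h

theorem xi_of_card_ne (I : Sub n k) (J : Finset (Fin n)) (h : J.card ≠ k) : xi I J = 0 :=
  dif_neg h

theorem sub_le (I : Sub n k) : k ≤ n := by
  have := Finset.card_le_univ I.1
  rwa [I.2, Fintype.card_fin] at this

/-- At `topSub` the sum has one term, and the two explicit values multiply to R. Both sides
transform alike under adjacent transpositions, which gives all other fixed points. -/
theorem locSum_xi (I J : Sub n k) : locSum (xi I) J = if I = J then RI J else 0 := by
  have hk := sub_le I
  revert I
  refine sub_induction (topSub hk) (fun J => ∀ I, locSum (xi I) J = if I = J then RI J else 0)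
    ?_ ?_ J
  · intro I
    rw [locSum, Finset.sum_eq_single (topSub hk).1]
    · rcases eq_or_ne I (topSub hk) with rfl | h
      · rw [if_pos rfl, xi_topSub, plusAt_topSub]
        have hQ := QI_ne_zero (topSub hk)
        have hC := Cfac_ne_zero 1 (topSub hk).1
        field_simp
      · rw [xi_topSub_of_ne hk I h, if_neg h, zero_mul]
    · intro K _ hK
      rw [plusAt_topSub_of_ne hk K hK, mul_zero]
    · simp
  · intro i j hij J ih I
    have h1 := locSum_exchT hij (xi (permSub (Equiv.swap i j) I)) J
    rw [exchT_xi hij, permSub_swap_swap, ih] at h1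
    rw [h1]
    by_cases h : permSub (Equiv.swap i j) I = J
    · have h' : I = permSub (Equiv.swap i j) J := by rw [← h, permSub_swap_swap]
      rw [if_pos h, if_pos h', permK_RI]
    · have h' : I ≠ permSub (Equiv.swap i j) J := by
        rintro rfl; exact h (permSub_swap_swap _ _ _)
      rw [if_neg h, if_neg h', map_zero]

/-- Orthogonality says X * Y = 1 for square matrices, so Y * X = 1 as well, and that is the
inversion formula. -/
theorem eq_sum_locSum (ζ : Finset (Fin n) → RatK n) (K : Sub n k) :
    ζ K.1 = ∑ I : Sub n k, locSum ζ I / RI I * xi I K.1 := by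
  classical
  let X : Matrix (Sub n k) (Sub n k) (RatK n) := Matrix.of fun I K => xi I K.1 / RI I
  let Y : Matrix (Sub n k) (Sub n k) (RatK n) := Matrix.of fun K J => plusAt K.1 J
  have hXY : X * Y = 1 := by
    ext I J
    have h := locSum_xi I J
    rw [locSum, sum_eq_sum_sub (k := k) _ fun K hK => by rw [plusAt_of_card_ne K J hK, mul_zero]]
      at h
    simp only [X, Y, Matrix.mul_apply, Matrix.of_apply, Matrix.one_apply, div_mul_eq_mul_div,
      ← Finset.sum_div, h]
    split_ifs with hIJ
    · rw [hIJ, div_self (RI_ne_zero J)]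
    · rw [zero_div]
  have hYX : Y * X = 1 := mul_eq_one_comm.1 hXY
  have h2 : ∀ I : Sub n k, locSum ζ I = ∑ J : Sub n k, ζ J.1 * Y J I := fun I =>
    sum_eq_sum_sub (k := k) _ fun K hK => by rw [plusAt_of_card_ne K I hK, mul_zero]
  have h3 : ∀ I : Sub n k, locSum ζ I / RI I * xi I K.1 = ∑ J : Sub n k, ζ J.1 * (Y J I * X I K) := by
    intro I
    rw [h2, Finset.sum_div, Finset.sum_mul]
    refine Finset.sum_congr rfl fun J _ => ?_
    simp only [X, Matrix.of_apply]
    ring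
  simp only [h3]
  rw [Finset.sum_comm]
  simp only [← Finset.mul_sum, ← Matrix.mul_apply, hYX, Matrix.one_apply]
  simp

theorem locSum_sum_xi (g : Sub n k → RatK n) (J : Sub n k) :
    locSum (fun K => ∑ I : Sub n k, g I / RI I * xi I K) J = g J := by
  have h : locSum (fun K => ∑ I : Sub n k, g I / RI I * xi I K) J
      = ∑ I : Sub n k, g I / RI I * locSum (xi I) J := by
    simp only [locSum, Finset.sum_mul, Finset.mul_sum]
    rw [Finset.sum_comm]
    simp only [mul_assoc]
  rw [h]
  simp only [locSum_xi, mul_ite, mul_zero, Finset.sum_ite_eq', Finset.mem_univ, if_true]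
  exact div_mul_cancel₀ _ (RI_ne_zero J)

end Orth

/-! ### The dynamical Yang-Baxter equation -/

/-- The weights of the basis vectors `v₁, v₂`. -/
def slotWeight (a : Fin 2) : ℤ := if a = 0 then 1 else -1

/-- The difference that determines the coefficients of the R-matrix on `v_a ⊗ v_b`. -/
def slotSub (a b : Fin 2) : ℤ := (if a = 0 then 1 else 0) - (if b = 0 then 1 else 0)

section YBE
variable {F : Type*} [Field F]

/-- The R-matrix in the factors `0, 2` of a threefold tensor product. -/
def localR02 (L w y : F) (f : Fin 2 → Fin 2 → Fin 2 → F) (a b c : Fin 2) : F :=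
  exchOff (slotSub a c) L w y * f a b c + exchDiag (slotSub a c) L w y * f c b a

/-- The R-matrix in the factors `0, 1` of a threefold tensor product. -/
def localR01 (L w y : F) (f : Fin 2 → Fin 2 → Fin 2 → F) (a b c : Fin 2) : F :=
  exchOff (slotSub a b) (L - slotWeight c * y) w y * f a b c
    + exchDiag (slotSub a b) (L - slotWeight c * y) w y * f b a c

/-- The exchange operator in the factors `1, 2` of a threefold tensor product. -/
def localX (m : ℤ) (L w y : F) (f : Fin 2 → Fin 2 → Fin 2 → F) (a b c : Fin 2) : F :=
  exchDiag (slotSub b c) (L - (m * slotWeight a : ℤ) * y) w y * f a b c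
    + exchOff (slotSub b c) (L - (m * slotWeight a : ℤ) * y) w y * f a c b

/-- The exchange operator on the right sees the auxiliary weight (m = 1), the one on the left does
not (m = 0). This asymmetry is what the shift of λ in `Ltilde` later compensates. -/
theorem dynamical_yangBaxter (L w z₁ z₂ y : F) (h0 : L ≠ 0) (h1 : L + y ≠ 0) (h2 : L - y ≠ 0)
    (hw1 : w - z₁ - y ≠ 0) (hw2 : w - z₂ - y ≠ 0) (hz : z₁ - z₂ - y ≠ 0)
    (f : Fin 2 → Fin 2 → Fin 2 → F) (a b c : Fin 2) :
    localX 0 L (z₁ - z₂) y (localR01 L (w - z₂) y (localR02 L (w - z₁) y f)) a b c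
      = localR01 L (w - z₁) y (localR02 L (w - z₂) y (localX 1 L (z₁ - z₂) y f)) a b c := by
  -- Each of the eight components is a rational identity in L, w, z₁, z₂, y, linear in the values of
  -- `f`.
  fin_cases a <;> fin_cases b <;> fin_cases c <;>
    simp [localX, localR01, localR02, slotSub, slotWeight, exchDiag, exchOff] <;>
    rw [← sub_eq_zero] <;> field_simp <;> ring

end YBE

/-! ### L-operators and exchange operators over a field -/

section Ops
variable {n : ℕ}

/-- The subset `P` with its factor number `j` replaced by `v_a`. -/
def setSlot (P : Finset (Fin n)) (j : Fin n) (a : Fin 2) : Finset (Fin n) :=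
  if a = 0 then insert j P else P.erase j

theorem mem_setSlot {P : Finset (Fin n)} {j l : Fin n} {a : Fin 2} :
    l ∈ setSlot P j a ↔ if l = j then a = 0 else l ∈ P := by
  unfold setSlot
  split_ifs <;> simp_all

theorem slot_eq_zero {P : Finset (Fin n)} {j : Fin n} : slot P j = 0 ↔ j ∈ P := by
  unfold slot; split_ifs <;> simp_all

theorem fin_two_ext {a b : Fin 2} (h : a = 0 ↔ b = 0) : a = b := by omega

theorem slot_setSlot_self (P : Finset (Fin n)) (j : Fin n) (a : Fin 2) :
    slot (setSlot P j a) j = a := by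
  apply fin_two_ext
  rw [slot_eq_zero, mem_setSlot, if_pos rfl]

theorem slot_setSlot_of_ne (P : Finset (Fin n)) {j l : Fin n} (h : l ≠ j) (a : Fin 2) :
    slot (setSlot P j a) l = slot P l := by
  apply fin_two_ext
  rw [slot_eq_zero, slot_eq_zero, mem_setSlot, if_neg h]

theorem setSlot_slot (P : Finset (Fin n)) (j : Fin n) : setSlot P j (slot P j) = P := by
  ext l
  rw [mem_setSlot, slot_eq_zero]
  split_ifs with h
  · rw [h]
  · rfl

theorem setSlot_setSlot (P : Finset (Fin n)) (j : Fin n) (a b : Fin 2) :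
    setSlot (setSlot P j a) j b = setSlot P j b := by
  ext l
  simp only [mem_setSlot]
  split_ifs <;> rfl

theorem setSlot_comm (P : Finset (Fin n)) {i j : Fin n} (h : i ≠ j) (a b : Fin 2) :
    setSlot (setSlot P i a) j b = setSlot (setSlot P j b) i a := by
  ext l
  simp only [mem_setSlot]
  split_ifs <;> simp_all

theorem slotDiff_eq (i j : Fin n) (P : Finset (Fin n)) :
    slotDiff i j P = slotSub (slot P i) (slot P j) := by
  simp only [slotDiff, slotSub, slot_eq_zero]

theorem tailWeight_eq_sum_slot (P : Finset (Fin n)) (l : Fin n) :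
    tailWeight P l = ∑ b ∈ Finset.univ.filter (fun b => l < b), slotWeight (slot P b) := by
  simp only [tailWeight, slotWeight, slot_eq_zero]

theorem tailWeight_setSlot_of_le (P : Finset (Fin n)) {j l : Fin n} (h : j ≤ l) (a : Fin 2) :
    tailWeight (setSlot P j a) l = tailWeight P l := by
  rw [tailWeight_eq_sum_slot, tailWeight_eq_sum_slot]
  refine Finset.sum_congr rfl fun b hb => ?_
  rw [slot_setSlot_of_ne]
  rintro rfl
  simp only [Finset.mem_filter, Finset.mem_univ, true_and] at hb
  exact absurd h hb.not_ge

/-- Written as a sum, this is conservation of weight when the auxiliary factor and factor `j` are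
interchanged. -/
theorem tailWeight_setSlot_of_lt (P : Finset (Fin n)) {j l : Fin n} (h : l < j) (a : Fin 2) :
    tailWeight (setSlot P j a) l + slotWeight (slot P j) = tailWeight P l + slotWeight a := by
  have hj : j ∈ Finset.univ.filter (fun b => l < b) := by simpa using h
  rw [tailWeight_eq_sum_slot, tailWeight_eq_sum_slot, ← Finset.add_sum_erase _ _ hj,
    ← Finset.add_sum_erase _ (fun b => slotWeight (slot P b)) hj, slot_setSlot_self]
  have : ∑ x ∈ (Finset.univ.filter (fun b => l < b)).erase j, slotWeight (slot (setSlot P j a) x)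
      = ∑ x ∈ (Finset.univ.filter (fun b => l < b)).erase j, slotWeight (slot P x) :=
    Finset.sum_congr rfl fun x hx => by rw [slot_setSlot_of_ne _ (Finset.ne_of_mem_erase hx)]
  rw [this]
  ring

theorem slot_permSet_swap (i j : Fin n) (P : Finset (Fin n)) (l : Fin n) :
    slot (permSet (Equiv.swap i j) P) l = slot P (Equiv.swap i j l) := by
  apply fin_two_ext
  rw [slot_eq_zero, slot_eq_zero, mem_permSet_swap]

theorem ext_slot {P Q : Finset (Fin n)} (h : ∀ l, slot P l = slot Q l) : P = Q := by
  ext l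
  rw [← slot_eq_zero, ← slot_eq_zero, h]

theorem permSet_swap_setSlot {i j l : Fin n} (hi : l ≠ i) (hj : l ≠ j) (P : Finset (Fin n))
    (a : Fin 2) :
    permSet (Equiv.swap i j) (setSlot P l a) = setSlot (permSet (Equiv.swap i j) P) l a := by
  refine ext_slot fun m => ?_
  rw [slot_permSet_swap]
  rcases eq_or_ne m l with rfl | hm
  · rw [Equiv.swap_apply_of_ne_of_ne hi hj, slot_setSlot_self, slot_setSlot_self]
  · have : Equiv.swap i j m ≠ l := by
      rw [Ne, Equiv.swap_apply_eq_iff, Equiv.swap_apply_of_ne_of_ne hi hj]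
      exact hm
    rw [slot_setSlot_of_ne _ this, slot_setSlot_of_ne _ hm, slot_permSet_swap]

variable {F : Type*} [Field F]

/-- The action of the factor `R^{(0,l)}` of the L-operator on columns. -/
def ropF (lam w y : F) (z : Fin n → F) (l : Fin n) (f : Fin 2 × Finset (Fin n) → F)
    (p : Fin 2 × Finset (Fin n)) : F :=
  exchOff (slotSub p.1 (slot p.2 l)) (lam - (tailWeight p.2 l : F) * y) (w - z l) y * f p
    + exchDiag (slotSub p.1 (slot p.2 l)) (lam - (tailWeight p.2 l : F) * y) (w - z l) y
      * f (slot p.2 l, setSlot p.2 l p.1)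

/-- The action of the exchange operator on columns; `m = 1` if the auxiliary factor contributes to
the dynamical shift and `m = 0` if not. -/
def xopF (lam y : F) (z : Fin n → F) (i j : Fin n) (m : ℤ) (f : Fin 2 × Finset (Fin n) → F)
    (p : Fin 2 × Finset (Fin n)) : F :=
  exchDiag (slotDiff i j p.2) (lam - ((tailWeight p.2 j + m * slotWeight p.1 : ℤ) : F) * y)
      (z i - z j) y * f p
    + exchOff (slotDiff i j p.2) (lam - ((tailWeight p.2 j + m * slotWeight p.1 : ℤ) : F) * y)
      (z i - z j) y * f (p.1, permSet (Equiv.swap i j) p.2)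

/-- The tail of `l` contains both `i` and `j`, so it is unaffected by their exchange; with m = 0 the
exchange coefficients see neither slot `l` nor the auxiliary slot. -/
theorem xopF_ropF_of_lt (lam w y : F) (z : Fin n → F) {i j l : Fin n} (hij : (j : ℕ) = i + 1)
    (hl : l < i) (f : Fin 2 × Finset (Fin n) → F) :
    xopF lam y z i j 0 (ropF lam w y (z ∘ Equiv.swap i j) l f)
      = ropF lam w y z l (xopF lam y z i j 0 f) := by
  have hli : l ≠ i := hl.ne
  have hij' : i < j := by rw [Fin.lt_def]; omega
  have hlj : l ≠ j := (hl.trans hij').ne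
  funext ⟨a, P⟩
  simp only [xopF, ropF, zero_mul, add_zero, Function.comp_apply,
    Equiv.swap_apply_of_ne_of_ne hli hlj, slotDiff_eq, slot_setSlot_of_ne _ hli.symm,
    slot_setSlot_of_ne _ hlj.symm, tailWeight_setSlot_of_le _ (hl.trans hij').le,
    slot_permSet_swap, tailWeight_permSet_swap hij P hli, permSet_swap_setSlot hli hlj]
  ring

/-- Interchanging slot `l` with the auxiliary slot changes the tail weight at `j`, but not its sum
with the auxiliary weight, and with m = 1 the coefficients depend only on this sum. -/
theorem xopF_ropF_of_gt (lam w y : F) (z : Fin n → F) {i j l : Fin n} (hij : (j : ℕ) = i + 1)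
    (hl : j < l) (f : Fin 2 × Finset (Fin n) → F) :
    xopF lam y z i j 1 (ropF lam w y (z ∘ Equiv.swap i j) l f)
      = ropF lam w y z l (xopF lam y z i j 1 f) := by
  have hlj : l ≠ j := hl.ne'
  have hij' : i < j := by rw [Fin.lt_def]; omega
  have hli : l ≠ i := (hij'.trans hl).ne'
  funext ⟨a, P⟩
  simp only [xopF, ropF, one_mul, Function.comp_apply,
    Equiv.swap_apply_of_ne_of_ne hli hlj, slotDiff_eq, slot_setSlot_of_ne _ hli.symm,
    slot_setSlot_of_ne _ hlj.symm, tailWeight_setSlot_of_lt P hl,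
    slot_permSet_swap, tailWeight_permSet_swap hij P hli, permSet_swap_setSlot hli hlj]
  ring

theorem permSet_swap_setSlot_setSlot {i j : Fin n} (hne : i ≠ j) (P : Finset (Fin n))
    (b c : Fin 2) :
    permSet (Equiv.swap i j) (setSlot (setSlot P i b) j c) = setSlot (setSlot P i c) j b := by
  refine ext_slot fun m => ?_
  rw [slot_permSet_swap]
  rcases eq_or_ne m i with rfl | hmi
  · rw [Equiv.swap_apply_left, slot_setSlot_self, slot_setSlot_of_ne _ hne, slot_setSlot_self]
  rcases eq_or_ne m j with rfl | hmj
  · rw [Equiv.swap_apply_right, slot_setSlot_self, slot_setSlot_of_ne _ hne, slot_setSlot_self]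
  rw [Equiv.swap_apply_of_ne_of_ne hmi hmj]
  simp only [slot_setSlot_of_ne _ hmi, slot_setSlot_of_ne _ hmj]

/-- Fixing all slots other than `i`, `j` and the auxiliary one leaves a threefold tensor product, in
which the claim is `dynamical_yangBaxter`. -/
theorem xopF_ropF_ropF (lam w y : F) (z : Fin n → F) {i j : Fin n} (hij : (j : ℕ) = i + 1)
    (hL : ∀ m : ℤ, lam - (m : F) * y ≠ 0) (hw : ∀ a, w - z a - y ≠ 0) (hz : z i - z j - y ≠ 0)
    (f : Fin 2 × Finset (Fin n) → F) :
    xopF lam y z i j 0 (ropF lam w y (z ∘ Equiv.swap i j) i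
        (ropF lam w y (z ∘ Equiv.swap i j) j f))
      = ropF lam w y z i (ropF lam w y z j (xopF lam y z i j 1 f)) := by
  have hne : i ≠ j := adjacent_ne hij
  have hij' : i < j := by rw [Fin.lt_def]; omega
  funext ⟨a, P⟩
  set L := lam - (tailWeight P j : F) * y with hLdef
  set g : Fin 2 → Fin 2 → Fin 2 → F := fun a' b' c' => f (a', setSlot (setSlot P i b') j c')
  have hslot_i : ∀ b c, slot (setSlot (setSlot P i b) j c) i = b := fun b c => by
    rw [slot_setSlot_of_ne _ hne, slot_setSlot_self]
  have hslot_j : ∀ b c, slot (setSlot (setSlot P i b) j c) j = c := fun b c => by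
    rw [slot_setSlot_self]
  have hset_i : ∀ b c d, setSlot (setSlot (setSlot P i b) j c) i d
      = setSlot (setSlot P i d) j c := fun b c d => by
    rw [← setSlot_comm _ hne, setSlot_setSlot]
  have htail_j : ∀ b c, tailWeight (setSlot (setSlot P i b) j c) j = tailWeight P j := fun b c => by
    rw [tailWeight_setSlot_of_le _ le_rfl, tailWeight_setSlot_of_le _ hij'.le]
  have htail_i : ∀ b c, tailWeight (setSlot (setSlot P i b) j c) i
      = tailWeight P j + slotWeight c := fun b c => by
    rw [tailWeight_adjacent hij, htail_j, slotWeight]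
    simp only [← slot_eq_zero, hslot_j]
  have hR02 : ∀ (z' : Fin n → F) (f : Fin 2 × Finset (Fin n) → F) (a b c : Fin 2),
      ropF lam w y z' j f (a, setSlot (setSlot P i b) j c)
        = localR02 L (w - z' j) y (fun a' b' c' => f (a', setSlot (setSlot P i b') j c')) a b c := by
    intro z' f a b c
    simp only [ropF, localR02, hslot_j, htail_j, setSlot_setSlot, ← hLdef]
  have hR01 : ∀ (z' : Fin n → F) (f : Fin 2 × Finset (Fin n) → F) (a b c : Fin 2),
      ropF lam w y z' i f (a, setSlot (setSlot P i b) j c)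
        = localR01 L (w - z' i) y (fun a' b' c' => f (a', setSlot (setSlot P i b') j c')) a b c := by
    intro z' f a b c
    have hL' : lam - ((tailWeight P j + slotWeight c : ℤ) : F) * y = L - slotWeight c * y := by
      rw [hLdef]; push_cast; ring
    simp only [ropF, localR01, hslot_i, htail_i, hset_i, hL']
  have hX : ∀ (m : ℤ) (f : Fin 2 × Finset (Fin n) → F) (a b c : Fin 2),
      xopF lam y z i j m f (a, setSlot (setSlot P i b) j c)
        = localX m L (z i - z j) y (fun a' b' c' => f (a', setSlot (setSlot P i b') j c')) a b c := by
    intro m f a b c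
    have hL' : lam - ((tailWeight P j + m * slotWeight a : ℤ) : F) * y
        = L - ((m * slotWeight a : ℤ) : F) * y := by
      rw [hLdef]; push_cast; ring
    simp only [xopF, localX, slotDiff_eq, hslot_i, hslot_j, htail_j, hL',
      permSet_swap_setSlot_setSlot hne]
  have hP : P = setSlot (setSlot P i (slot P i)) j (slot P j) := by
    rw [setSlot_slot, setSlot_slot]
  rw [hP]
  have h1 := hL (tailWeight P j - 1)
  have h2 := hL (tailWeight P j + 1)
  have key := dynamical_yangBaxter L w (z i) (z j) y (hL _)
    (by rw [hLdef]; push_cast at h1; intro h; apply h1; linear_combination h)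
    (by rw [hLdef]; push_cast at h2; intro h; apply h2; linear_combination h)
    (hw i) (hw j) hz g a (slot P i) (slot P j)
  simp only [hX, hR01, hR02]
  simp only [Function.comp_apply, Equiv.swap_apply_left, Equiv.swap_apply_right]
  exact key

end Ops

/-! ### The L-operator commutes with the exchange operators -/

section Lcomm
variable {n : ℕ}

/-- The field of fractions of the ring of power series in `w⁻¹` over `ℂ(λ, z, y)`. -/
abbrev SerF (n : ℕ) : Type := FractionRing (PowerSeries (RatK n))

/-- The constants of `SerF n`. -/
def cF (n : ℕ) : RatK n →+* SerF n := (algebraMap (PowerSeries (RatK n)) (SerF n)).comp PowerSeries.C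

/-- The element `w` of `SerF n`. -/
def wF (n : ℕ) : SerF n := (algebraMap (PowerSeries (RatK n)) (SerF n) PowerSeries.X)⁻¹

/-- Power series over `𝓛_{λ,(z,y)}` as elements of `SerF n`, the variables `z` being permuted. -/
def serF (σ : Equiv.Perm (Fin n)) : PowerSeries (Lfull n) →+* SerF n :=
  (algebraMap (PowerSeries (RatK n)) (SerF n)).comp
    (PowerSeries.map ((permK σ : RatK n →+* RatK n).comp (algebraMap (Lfull n) (RatK n))))

theorem serF_C (σ : Equiv.Perm (Fin n)) (x : Lfull n) :
    serF σ (PowerSeries.C x) = cF n (permK σ (x : RatK n)) := by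
  simp [serF, cF]

theorem serF_X (σ : Equiv.Perm (Fin n)) : serF σ PowerSeries.X = (wF n)⁻¹ := by
  simp [serF, wF]

theorem wF_ne_zero (n : ℕ) : wF n ≠ 0 := by
  rw [wF, Ne, inv_eq_zero, map_eq_zero_iff _ (IsFractionRing.injective _ _)]
  exact PowerSeries.X_ne_zero

/-- Multiplied by w⁻¹ it becomes a power series with constant term 1. This is why w is made an
element of a field: the R-matrix identities can be proved there by clearing denominators. -/
theorem wF_sub_ne_zero (c : RatK n) : wF n - cF n c ≠ 0 := by
  intro h
  have h1 : algebraMap (PowerSeries (RatK n)) (SerF n) (1 - PowerSeries.C c * PowerSeries.X) = 0 := by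
    have h2 := wF_ne_zero n
    rw [map_sub, map_one, map_mul]
    have h3 : algebraMap (PowerSeries (RatK n)) (SerF n) PowerSeries.X = (wF n)⁻¹ := by simp [wF]
    rw [h3]
    change 1 - cF n c * (wF n)⁻¹ = 0
    rw [← div_eq_mul_inv, sub_eq_zero, eq_comm, div_eq_one_iff_eq h2]
    exact (sub_eq_zero.1 h).symm
  rw [map_eq_zero_iff _ (IsFractionRing.injective _ _)] at h1
  have h2 := congrArg PowerSeries.constantCoeff h1
  simp at h2

theorem serF_geom (σ : Equiv.Perm (Fin n)) (c : Lfull n) :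
    serF σ (geom c) = wF n / (wF n - cF n (permK σ (c : RatK n))) := by
  have h := congrArg (serF σ) (geom_mul c)
  rw [map_mul, map_sub, map_one, map_mul, serF_C, serF_X] at h
  have h1 := wF_sub_ne_zero (permK σ (c : RatK n))
  have h2 := wF_ne_zero n
  field_simp at h
  rw [eq_div_iff h1]
  exact h

theorem coe_zL (a : Fin n) : (zL n a : RatK n) = zK n a := rfl
theorem coe_yL (n : ℕ) : (yL n : RatK n) = yK n := rfl
theorem coe_lamL (n : ℕ) : (lamL n : RatK n) = lamK n := rfl
theorem coe_invL (n : ℕ) (l : ℤ) : (invL n l : RatK n) = (lamK n + (l : RatK n) * yK n)⁻¹ := rfl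

theorem cF_lam_sub_ne_zero (n : ℕ) (m : ℤ) :
    cF n (lamK n) - (m : SerF n) * cF n (yK n) ≠ 0 := by
  have h := (map_ne_zero (cF n)).2 (lamK_sub_ne_zero n m)
  simpa using h

/-- The R-matrix combines the identity and the flip. On v_a ⊗ v_a the two coincide, and the
conventions O 0 = 0, D 0 = 1 give the entry 1 there. -/
theorem ite_chain_eq {F : Type*} [Ring F] (O D : ℤ → F) (hO : O 0 = 0) (hD : D 0 = 1)
    (a s b t : Fin 2) :
    (if (a, s) = ((0 : Fin 2), (0 : Fin 2)) ∧ (b, t) = ((0 : Fin 2), (0 : Fin 2)) then 1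
      else if (a, s) = (0, 1) ∧ (b, t) = (0, 1) then O 1
      else if (a, s) = (0, 1) ∧ (b, t) = (1, 0) then D 1
      else if (a, s) = (1, 0) ∧ (b, t) = (0, 1) then D (-1)
      else if (a, s) = (1, 0) ∧ (b, t) = (1, 0) then O (-1)
      else if (a, s) = (1, 1) ∧ (b, t) = (1, 1) then 1 else 0)
      = (if b = a ∧ t = s then O (slotSub a s) else 0)
        + if b = s ∧ t = a then D (slotSub a s) else 0 := by
  fin_cases a <;> fin_cases s <;> fin_cases b <;> fin_cases t <;> simp [slotSub, hO, hD]

theorem serF_Rentry (σ : Equiv.Perm (Fin n)) (m : ℤ) (l : Fin n) (a s b t : Fin 2) :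
    serF σ (Rentry n m (zL n l) (a, s) (b, t))
      = (if b = a ∧ t = s then exchOff (slotSub a s) (cF n (lamK n) - (m : SerF n) * cF n (yK n))
          (wF n - cF n (zK n (σ l))) (cF n (yK n)) else 0)
        + if b = s ∧ t = a then exchDiag (slotSub a s)
          (cF n (lamK n) - (m : SerF n) * cF n (yK n))
          (wF n - cF n (zK n (σ l))) (cF n (yK n)) else 0 := by
  have hL := cF_lam_sub_ne_zero n m
  have hw := wF_ne_zero n
  have hwz := wF_sub_ne_zero (zK n (σ l) + yK n)
  rw [map_add] at hwz
  have hl : cF n (permK σ (lamL n : RatK n)) = cF n (lamK n) := by rw [coe_lamL, permK_lamK]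
  have hm : cF n (permK σ ((m : Lfull n) : RatK n)) = (m : SerF n) := by
    have : ((m : Lfull n) : RatK n) = (m : RatK n) := rfl
    rw [this, map_intCast, map_intCast]
  have hi : cF n (permK σ (invL n (-m) : RatK n))
      = (cF n (lamK n) - (m : SerF n) * cF n (yK n))⁻¹ := by
    rw [coe_invL]
    push_cast
    rw [neg_mul, ← sub_eq_add_neg]
    simp
  have hz : cF n (permK σ (zL n l : RatK n)) = cF n (zK n (σ l)) := by rw [coe_zL, permK_zK]
  have hy : cF n (permK σ (yL n : RatK n)) = cF n (yK n) := by rw [coe_yL, permK_yK]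
  have hg : serF σ (geom (zL n l + yL n))
      = wF n / (wF n - (cF n (zK n (σ l)) + cF n (yK n))) := by
    have : ((zL n l + yL n : Lfull n) : RatK n) = zL n l + yL n := rfl
    rw [serF_geom, this, map_add, map_add, hz, hy]
  rw [← ite_chain_eq (fun e => exchOff e (cF n (lamK n) - (m : SerF n) * cF n (yK n))
    (wF n - cF n (zK n (σ l))) (cF n (yK n))) (fun e => exchDiag e
    (cF n (lamK n) - (m : SerF n) * cF n (yK n)) (wF n - cF n (zK n (σ l))) (cF n (yK n)))
    (by simp [exchOff]) (by simp [exchDiag])]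
  simp only [Rentry, apply_ite (serF σ), map_one, map_zero, map_mul, map_neg, map_add, map_sub,
    serF_C, serF_X, hg, hi, hz, hy, hl, hm]
  have h1 : (1 : ℤ) ≠ 0 := one_ne_zero
  have h2 : (-1 : ℤ) ≠ 0 := by norm_num
  simp only [exchOff, exchDiag, h1, h2, if_false]
  push_cast
  generalize cF n (lamK n) - (m : SerF n) * cF n (yK n) = L at *
  generalize cF n (zK n (σ l)) = c at *
  generalize cF n (yK n) = y at *
  generalize wF n = w at *
  rw [sub_sub w c y]
  congr 1
  congr 1
  · field_simp
  congr 1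
  · field_simp
    ring
  congr 1
  · field_simp
    ring
  congr 1
  · field_simp
    ring


theorem erase_eq_erase_iff {P Q : Finset (Fin n)} {l : Fin n} :
    P.erase l = Q.erase l ↔ Q = setSlot P l (slot Q l) := by
  constructor
  · intro h
    refine ext_slot fun m => ?_
    rcases eq_or_ne m l with rfl | hm
    · rw [slot_setSlot_self]
    · rw [slot_setSlot_of_ne _ hm]
      apply fin_two_ext
      rw [slot_eq_zero, slot_eq_zero]
      have := congrArg (m ∈ ·) h
      simpa [hm] using this.symm
  · intro h
    ext m
    rcases eq_or_ne m l with rfl | hm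
    · simp
    · rw [h]
      simp [hm, mem_setSlot]

theorem serF_R0 (σ : Equiv.Perm (Fin n)) (l : Fin n) (p q : Fin 2 × Finset (Fin n)) :
    serF σ (R0 n l p q)
      = (if q = p then exchOff (slotSub p.1 (slot p.2 l))
          (cF n (lamK n) - (tailWeight p.2 l : SerF n) * cF n (yK n))
          (wF n - cF n (zK n (σ l))) (cF n (yK n)) else 0)
        + if q = (slot p.2 l, setSlot p.2 l p.1) then exchDiag (slotSub p.1 (slot p.2 l))
          (cF n (lamK n) - (tailWeight p.2 l : SerF n) * cF n (yK n))
          (wF n - cF n (zK n (σ l))) (cF n (yK n)) else 0 := by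
  obtain ⟨a, P⟩ := p
  obtain ⟨b, Q⟩ := q
  simp only [R0, Matrix.of_apply]
  by_cases h : P.erase l = Q.erase l
  · have hQ := erase_eq_erase_iff.1 h
    have ht : tailWeight Q l = tailWeight P l := by
      rw [hQ, tailWeight_setSlot_of_le _ le_rfl]
    have h1 : ((b, Q) = (a, P)) ↔ (b = a ∧ slot Q l = slot P l) := by
      rw [Prod.mk.injEq]
      refine and_congr_right fun _ => ⟨fun e => by rw [e], fun e => ?_⟩
      rw [hQ, e, setSlot_slot]
    have h2 : ((b, Q) = (slot P l, setSlot P l a)) ↔ (b = slot P l ∧ slot Q l = a) := by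
      rw [Prod.mk.injEq]
      refine and_congr_right fun _ => ⟨fun e => by rw [e, slot_setSlot_self], fun e => ?_⟩
      rw [hQ, e]
    rw [if_pos h, serF_Rentry, ht, if_congr h1 rfl rfl, if_congr h2 rfl rfl]
  · have h1 : (b, Q) ≠ (a, P) := by
      rintro e
      rw [Prod.mk.injEq] at e
      exact h (by rw [e.2])
    have h2 : (b, Q) ≠ (slot P l, setSlot P l a) := by
      rintro e
      rw [Prod.mk.injEq] at e
      refine h (erase_eq_erase_iff.2 ?_)
      rw [e.2, slot_setSlot_self]
    rw [if_neg h, map_zero, if_neg h1, if_neg h2, add_zero]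

theorem mulVec_R0 (σ : Equiv.Perm (Fin n)) (l : Fin n) (f : Fin 2 × Finset (Fin n) → SerF n) :
    ((R0 n l).map (serF σ)).mulVec f
      = ropF (cF n (lamK n)) (wF n) (cF n (yK n)) ((cF n ∘ zK n) ∘ σ) l f := by
  funext p
  simp only [Matrix.mulVec, dotProduct, Matrix.map_apply, serF_R0, ropF, add_mul, ite_mul, zero_mul,
    Finset.sum_add_distrib, Finset.sum_ite_eq', Finset.mem_univ, if_true, Function.comp_apply]

/-- The product of the factors of the L-operator from number `l` on. -/
def tailProd (σ : Equiv.Perm (Fin n)) (l : ℕ) :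
    Matrix (Fin 2 × Finset (Fin n)) (Fin 2 × Finset (Fin n)) (SerF n) :=
  ((List.ofFn fun l => (R0 n l).map (serF σ)).drop l).prod

theorem tailProd_of_le (σ : Equiv.Perm (Fin n)) {l : ℕ} (h : n ≤ l) : tailProd σ l = 1 := by
  rw [tailProd, List.drop_eq_nil_of_le (by simpa using h), List.prod_nil]

theorem tailProd_of_lt (σ : Equiv.Perm (Fin n)) (l : Fin n) :
    tailProd σ l = (R0 n l).map (serF σ) * tailProd σ (l + 1) := by
  rw [tailProd, List.drop_eq_getElem_cons (by simp), List.prod_cons, tailProd]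
  simp

theorem tailProd_zero (σ : Equiv.Perm (Fin n)) : tailProd σ 0 = (Lop n).map (serF σ) := by
  rw [tailProd, List.drop_zero, Lop]
  have := map_list_prod (serF σ).mapMatrix (List.ofFn (R0 n))
  rw [RingHom.mapMatrix_apply] at this
  rw [this, List.map_ofFn]
  rfl

/-- The exchange operator is moved through the factors of the L-operator one at a time. It changes
from m = 0 to m = 1 when it passes the factors `i` and `j`. -/
theorem xopF_mulVec_Lop {i j : Fin n} (hij : (j : ℕ) = i + 1)
    (f : Fin 2 × Finset (Fin n) → SerF n) :
    xopF (cF n (lamK n)) (cF n (yK n)) (cF n ∘ zK n) i j 0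
        (((Lop n).map (serF (Equiv.swap i j))).mulVec f)
      = ((Lop n).map (serF 1)).mulVec
          (xopF (cF n (lamK n)) (cF n (yK n)) (cF n ∘ zK n) i j 1 f) := by
  have h1 : (cF n ∘ zK n) ∘ (1 : Equiv.Perm (Fin n)) = cF n ∘ zK n := rfl
  -- Factors to the right of `j`, by induction from the empty product at `l = n`.
  have hB : ∀ d l : ℕ, l + d = n → (j : ℕ) < l → ∀ f : Fin 2 × Finset (Fin n) → SerF n,
      xopF (cF n (lamK n)) (cF n (yK n)) (cF n ∘ zK n) i j 1
        ((tailProd (Equiv.swap i j) l).mulVec f)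
      = (tailProd 1 l).mulVec
          (xopF (cF n (lamK n)) (cF n (yK n)) (cF n ∘ zK n) i j 1 f) := by
    intro d
    induction d with
    | zero =>
      intro l hl _ f
      rw [tailProd_of_le _ (by omega), tailProd_of_le _ (by omega), Matrix.one_mulVec,
        Matrix.one_mulVec]
    | succ d ih =>
      intro l hl hjl f
      obtain ⟨l, rfl⟩ : ∃ l' : Fin n, l = l' := ⟨⟨l, by omega⟩, rfl⟩
      rw [tailProd_of_lt, tailProd_of_lt, ← Matrix.mulVec_mulVec, ← Matrix.mulVec_mulVec,
        mulVec_R0, mulVec_R0, xopF_ropF_of_gt _ _ _ _ hij (Fin.lt_def.2 hjl),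
        ih _ (by omega) (by omega), h1]
  have hw : ∀ a, wF n - (cF n ∘ zK n) a - cF n (yK n) ≠ 0 := fun a => by
    have := wF_sub_ne_zero (zK n a + yK n)
    rw [map_add, ← sub_sub] at this
    exact this
  have hz : (cF n ∘ zK n) i - (cF n ∘ zK n) j - cF n (yK n) ≠ 0 := by
    have := (map_ne_zero (cF n)).2 (zK_sub_sub_ne_zero (i := i) (j := j))
    simpa using this
  have hC : xopF (cF n (lamK n)) (cF n (yK n)) (cF n ∘ zK n) i j 0
        ((tailProd (Equiv.swap i j) i).mulVec f)
      = (tailProd 1 i).mulVec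
          (xopF (cF n (lamK n)) (cF n (yK n)) (cF n ∘ zK n) i j 1 f) := by
    rw [tailProd_of_lt, tailProd_of_lt, ← hij, tailProd_of_lt, tailProd_of_lt]
    simp only [← Matrix.mulVec_mulVec, mulVec_R0]
    rw [xopF_ropF_ropF _ _ _ _ hij (cF_lam_sub_ne_zero n) hw hz]
    rw [hB (n - (j + 1)) (j + 1) (by omega) (by omega), h1]
  -- Factors to the left of `i`, by induction on the distance to `i`.
  have hA : ∀ d l : ℕ, l + d = i →
      xopF (cF n (lamK n)) (cF n (yK n)) (cF n ∘ zK n) i j 0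
        ((tailProd (Equiv.swap i j) l).mulVec f)
      = (tailProd 1 l).mulVec
          (xopF (cF n (lamK n)) (cF n (yK n)) (cF n ∘ zK n) i j 1 f) := by
    intro d
    induction d with
    | zero =>
      intro l hl
      obtain rfl : l = i := by omega
      exact hC
    | succ d ih =>
      intro l hl
      obtain ⟨l, rfl⟩ : ∃ l' : Fin n, l = l' := ⟨⟨l, by omega⟩, rfl⟩
      rw [tailProd_of_lt, tailProd_of_lt, ← Matrix.mulVec_mulVec, ← Matrix.mulVec_mulVec,
        mulVec_R0, mulVec_R0, xopF_ropF_of_lt _ _ _ _ hij (Fin.lt_def.2 (by omega)),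
        ih _ (by omega), h1]
  have := hA i 0 (by omega)
  rwa [tailProd_zero, tailProd_zero] at this

/-! ### Exchange relations for the coefficients of the L-operator. -/

/-- The diagonal coefficient of the exchange operator with the dynamical shift of `v_b`. -/
def diagShift (i j : Fin n) (b : Fin 2) (Q : Finset (Fin n)) : RatK n :=
  exchDiag (slotDiff i j Q) (lamK n - ((tailWeight Q j + slotWeight b : ℤ) : RatK n) * yK n)
    (zK n i - zK n j) (yK n)

/-- The off-diagonal coefficient of the exchange operator with the dynamical shift of `v_b`. -/
def offShift (i j : Fin n) (b : Fin 2) (Q : Finset (Fin n)) : RatK n :=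
  exchOff (slotDiff i j Q) (lamK n - ((tailWeight Q j + slotWeight b : ℤ) : RatK n) * yK n)
    (zK n i - zK n j) (yK n)

theorem map_exchDiag {F F' : Type*} [Field F] [Field F'] (g : F →+* F') (e : ℤ) (L w y : F) :
    g (exchDiag e L w y) = exchDiag e (g L) (g w) (g y) := by
  simp only [exchDiag, apply_ite g, map_one, map_div₀, map_neg, map_mul, map_add, map_sub,
    map_intCast]

theorem map_exchOff {F F' : Type*} [Field F] [Field F'] (g : F →+* F') (e : ℤ) (L w y : F) :
    g (exchOff e L w y) = exchOff e (g L) (g w) (g y) := by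
  simp only [exchOff, apply_ite g, map_zero, map_div₀, map_mul, map_add, map_sub, map_intCast]

/-- The exchange coefficients do not involve w, so the intertwining relation can be compared one
power of w⁻¹ at a time. -/
theorem Lcoeff_exchange {i j : Fin n} (hij : (j : ℕ) = i + 1) (a b : Fin 2) (s : ℕ)
    (P Q : Finset (Fin n)) :
    diagK i j P * permK (Equiv.swap i j) (Lcoeff n a b s P Q : RatK n)
        + offK i j P * permK (Equiv.swap i j)
          (Lcoeff n a b s (permSet (Equiv.swap i j) P) Q : RatK n)
      = (Lcoeff n a b s P Q : RatK n) * diagShift i j b Q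
        + (Lcoeff n a b s P (permSet (Equiv.swap i j) Q) : RatK n)
          * offShift i j b (permSet (Equiv.swap i j) Q) := by
  -- The intertwining relation is applied to the basis vector with label (b, Q), whose auxiliary
  -- slot b fixes the dynamical shift.
  have h := congrFun (xopF_mulVec_Lop hij (Pi.single (b, Q) 1)) (a, P)
  have e1 : xopF (cF n (lamK n)) (cF n (yK n)) (cF n ∘ zK n) i j 1 (Pi.single (b, Q) 1)
      = Pi.single (b, Q) (cF n (diagShift i j b Q))
        + Pi.single (b, permSet (Equiv.swap i j) Q)
          (cF n (offShift i j b (permSet (Equiv.swap i j) Q))) := by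
    funext ⟨a', P'⟩
    simp only [xopF, one_mul, Pi.add_apply, Pi.single_apply, Prod.mk.injEq, diagShift, offShift,
      map_exchDiag, map_exchOff, map_sub, map_mul, map_intCast, Function.comp_apply]
    congr 1
    · split_ifs with h'
      · rw [h'.1, h'.2, mul_one]
      · rw [mul_zero]
    · have hiff : (a' = b ∧ permSet (Equiv.swap i j) P' = Q)
          ↔ (a' = b ∧ P' = permSet (Equiv.swap i j) Q) := by
        refine and_congr_right fun _ => ⟨?_, ?_⟩
        · rintro rfl; rw [permSet_swap_swap]
        · rintro rfl; rw [permSet_swap_swap]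
      rw [if_congr hiff rfl rfl]
      split_ifs with h'
      · rw [h'.1, h'.2, mul_one]
      · rw [mul_zero]
  rw [e1, Matrix.mulVec_add, Matrix.mulVec_single_one] at h
  simp only [xopF, zero_mul, add_zero, Pi.add_apply, Matrix.mulVec_single, Matrix.col_apply,
    Matrix.map_apply, Pi.smul_apply, MulOpposite.smul_eq_mul_unop, MulOpposite.unop_op] at h
  have e2 : exchDiag (slotDiff i j P) (cF n (lamK n) - (tailWeight P j : SerF n) * cF n (yK n))
      ((cF n ∘ zK n) i - (cF n ∘ zK n) j) (cF n (yK n)) = cF n (diagK i j P) := by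
    simp only [diagK, map_exchDiag, map_sub, map_mul, map_intCast, Function.comp_apply,
      wt_eq_tailWeight]
  have e3 : exchOff (slotDiff i j P) (cF n (lamK n) - (tailWeight P j : SerF n) * cF n (yK n))
      ((cF n ∘ zK n) i - (cF n ∘ zK n) j) (cF n (yK n)) = cF n (offK i j P) := by
    simp only [offK, map_exchOff, map_sub, map_mul, map_intCast, Function.comp_apply,
      wt_eq_tailWeight]
  rw [e2, e3] at h
  simp only [serF, cF, RingHom.comp_apply, ← map_mul, ← map_add] at h
  have h2 := congrArg (PowerSeries.coeff s) (IsFractionRing.injective _ _ h)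
  simp only [map_add, PowerSeries.coeff_C_mul, PowerSeries.coeff_mul_C, PowerSeries.coeff_map,
    RingHom.comp_apply, RingHom.coe_coe, permK_one] at h2
  exact h2

end Lcomm

/-! ### Polynomials in `z` over `𝓛_{λ,y} ⊗ ℂ[y, y⁻¹]` -/

section Az
variable {n : ℕ}

/-- The algebra of polynomials in `z` with coefficients in `𝓛_{λ,y} ⊗ ℂ[y, y⁻¹]`. -/
def Az (n : ℕ) : Subalgebra (Lsmall n) (RatK n) := Algebra.adjoin (Lsmall n) (Set.range (zK n))

theorem lamK_mem_Lsmall (n : ℕ) : lamK n ∈ Lsmall n := Algebra.subset_adjoin (by simp)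

theorem yK_mem_Lsmall (n : ℕ) : yK n ∈ Lsmall n := Algebra.subset_adjoin (by simp)

theorem inv_yK_mem_Lsmall (n : ℕ) : (yK n)⁻¹ ∈ Lsmall n := Algebra.subset_adjoin (by simp)

theorem inv_lamK_add_mem_Lsmall (n : ℕ) (l : ℤ) : (lamK n + (l : RatK n) * yK n)⁻¹ ∈ Lsmall n :=
  Algebra.subset_adjoin (Or.inr ⟨l, rfl⟩)

theorem inv_lamK_sub_mem_Lsmall (n : ℕ) (l : ℤ) : (lamK n - (l : RatK n) * yK n)⁻¹ ∈ Lsmall n := by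
  have := inv_lamK_add_mem_Lsmall n (-l)
  push_cast at this
  rwa [neg_mul, ← sub_eq_add_neg] at this

theorem mem_Az_of_mem_Lsmall {x : RatK n} (h : x ∈ Lsmall n) : x ∈ Az n :=
  (Az n).algebraMap_mem (⟨x, h⟩ : Lsmall n)

theorem zK_mem_Az (a : Fin n) : zK n a ∈ Az n := Algebra.subset_adjoin ⟨a, rfl⟩

theorem yK_mem_Az (n : ℕ) : yK n ∈ Az n := mem_Az_of_mem_Lsmall (yK_mem_Lsmall n)

theorem lamK_mem_Az (n : ℕ) : lamK n ∈ Az n := mem_Az_of_mem_Lsmall (lamK_mem_Lsmall n)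

theorem complex_mem_Az (n : ℕ) (c : ℂ) : algebraMap ℂ (RatK n) c ∈ Az n :=
  mem_Az_of_mem_Lsmall ((Lsmall n).algebraMap_mem c)

theorem lamK_sub_mem_Lsmall (n : ℕ) (m : ℤ) : lamK n - (m : RatK n) * yK n ∈ Lsmall n :=
  sub_mem (lamK_mem_Lsmall n) (mul_mem (intCast_mem _ _) (yK_mem_Lsmall n))

theorem permK_of_mem_Lsmall (σ : Equiv.Perm (Fin n)) {x : RatK n} (h : x ∈ Lsmall n) :
    permK σ x = x := by
  induction h using Algebra.adjoin_induction with
  | mem x hx =>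
    rcases hx with (rfl | rfl | rfl) | ⟨l, rfl⟩ <;> simp
  | algebraMap c => simp
  | add x y _ _ hx hy => rw [map_add, hx, hy]
  | mul x y _ _ hx hy => rw [map_mul, hx, hy]

theorem permK_mem_Az (σ : Equiv.Perm (Fin n)) {x : RatK n} (h : x ∈ Az n) : permK σ x ∈ Az n := by
  induction h using Algebra.adjoin_induction with
  | mem x hx =>
    obtain ⟨a, rfl⟩ := hx
    rw [permK_zK]
    exact zK_mem_Az _
  | algebraMap c =>
    change permK σ (c : RatK n) ∈ _
    rw [permK_of_mem_Lsmall σ c.2]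
    exact mem_Az_of_mem_Lsmall c.2
  | add x y _ _ hx hy => rw [map_add]; exact add_mem hx hy
  | mul x y _ _ hx hy => rw [map_mul]; exact mul_mem hx hy

theorem shiftK_mem_Lsmall (m : ℤ) {x : RatK n} (h : x ∈ Lsmall n) : shiftK n m x ∈ Lsmall n := by
  induction h using Algebra.adjoin_induction with
  | mem x hx =>
    rcases hx with (rfl | rfl | rfl) | ⟨l, rfl⟩
    · rw [shiftK_lamK]
      exact add_mem (lamK_mem_Lsmall n) (mul_mem (intCast_mem _ _) (yK_mem_Lsmall n))
    · rw [shiftK_yK]; exact yK_mem_Lsmall n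
    · rw [map_inv₀, shiftK_yK]; exact inv_yK_mem_Lsmall n
    · rw [map_inv₀, map_add, map_mul, shiftK_lamK, shiftK_yK, map_intCast, add_assoc, ← add_mul,
        ← Int.cast_add]
      exact inv_lamK_add_mem_Lsmall n _
  | algebraMap c => rw [shiftK_complex]; exact (Lsmall n).algebraMap_mem c
  | add x y _ _ hx hy => rw [map_add]; exact add_mem hx hy
  | mul x y _ _ hx hy => rw [map_mul]; exact mul_mem hx hy

theorem shiftK_mem_Az (m : ℤ) {x : RatK n} (h : x ∈ Az n) : shiftK n m x ∈ Az n := by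
  induction h using Algebra.adjoin_induction with
  | mem x hx =>
    obtain ⟨a, rfl⟩ := hx
    rw [shiftK_zK]
    exact zK_mem_Az _
  | algebraMap c => exact mem_Az_of_mem_Lsmall (shiftK_mem_Lsmall m c.2)
  | add x y _ _ hx hy => rw [map_add]; exact add_mem hx hy
  | mul x y _ _ hx hy => rw [map_mul]; exact mul_mem hx hy

/-- Divided differences preserve polynomials. -/
theorem divDiff_mem_Az {i j : Fin n} (hne : i ≠ j) {x : RatK n} (h : x ∈ Az n) :
    (x - permK (Equiv.swap i j) x) / (zK n i - zK n j) ∈ Az n := by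
  have hz := zK_sub_ne_zero hne
  induction h using Algebra.adjoin_induction with
  | mem x hx =>
    obtain ⟨a, rfl⟩ := hx
    rw [permK_zK]
    rcases eq_or_ne a i with rfl | hai
    · rw [Equiv.swap_apply_left, div_self hz]; exact one_mem _
    rcases eq_or_ne a j with rfl | haj
    · rw [Equiv.swap_apply_right, ← neg_sub, neg_div, div_self hz]; exact neg_mem (one_mem _)
    rw [Equiv.swap_apply_of_ne_of_ne hai haj, sub_self, zero_div]
    exact zero_mem _
  | algebraMap c =>
    change ((c : RatK n) - permK _ (c : RatK n)) / _ ∈ _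
    rw [permK_of_mem_Lsmall _ c.2, sub_self, zero_div]
    exact zero_mem _
  | add x y _ _ hx hy =>
    rw [map_add, add_sub_add_comm, add_div]; exact add_mem hx hy
  | mul x y hx' hy' hx hy =>
    -- The twisted Leibniz rule.
    have : (x * y - permK (Equiv.swap i j) (x * y)) / (zK n i - zK n j)
        = (x - permK (Equiv.swap i j) x) / (zK n i - zK n j) * y
          + permK (Equiv.swap i j) x * ((y - permK (Equiv.swap i j) y) / (zK n i - zK n j)) := by
      rw [map_mul]; ring
    rw [this]
    exact add_mem (mul_mem hx hy') (mul_mem (permK_mem_Az _ hx') hy)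

/-! ### Divisibility by linear forms -/

/-- The denominators of `𝓛_{λ,y} ⊗ ℂ[y, y⁻¹]`. -/
def denoms (n : ℕ) : Submonoid (Polynomial (PolyZY n)) :=
  Submonoid.closure ({Polynomial.C (MvPolynomial.X none)} ∪
    Set.range fun l : ℤ => Polynomial.X + Polynomial.C ((l : PolyZY n) * MvPolynomial.X none))

theorem polyK_mem_Az (g : Polynomial (PolyZY n)) : polyK n g ∈ Az n := by
  induction g using Polynomial.induction_on' with
  | add p q hp hq => rw [map_add]; exact add_mem hp hq
  | monomial m a =>
    rw [← Polynomial.C_mul_X_pow_eq_monomial, map_mul, map_pow, polyK_X, polyK_C]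
    refine mul_mem ?_ (pow_mem (lamK_mem_Az n) m)
    induction a using MvPolynomial.induction_on with
    | C c => rw [← algebraMap_complex_RatK]; exact complex_mem_Az n c
    | add p q hp hq => rw [map_add]; exact add_mem hp hq
    | mul_X p o hp =>
      rw [map_mul]
      refine mul_mem hp ?_
      rcases o with _ | a
      · exact yK_mem_Az n
      · exact zK_mem_Az a

theorem polyK_denoms {d : Polynomial (PolyZY n)} (hd : d ∈ denoms n) :
    polyK n d ≠ 0 ∧ (polyK n d)⁻¹ ∈ Lsmall n := by
  induction hd using Submonoid.closure_induction with
  | mem x hx =>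
    rcases hx with rfl | ⟨l, rfl⟩
    · rw [polyK_C]
      exact ⟨yK_ne_zero n, inv_yK_mem_Lsmall n⟩
    · have : polyK n (Polynomial.X + Polynomial.C ((l : PolyZY n) * MvPolynomial.X none))
          = lamK n + (l : RatK n) * yK n := by
        rw [map_add, polyK_X, polyK_C, map_mul, map_intCast]; rfl
      rw [this]
      exact ⟨lamK_add_ne_zero n l, inv_lamK_add_mem_Lsmall n l⟩
  | one => simp [one_mem]
  | mul x y _ _ hx hy =>
    rw [map_mul, mul_inv]
    exact ⟨mul_ne_zero hx.1 hy.1, mul_mem hx.2 hy.2⟩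

/-- Fractions with numerator in `ℂ[z, y][λ]` and denominator in `denoms n`. -/
def fracs (n : ℕ) : Subring (RatK n) where
  carrier := {x | ∃ d ∈ denoms n, ∃ g, polyK n d * x = polyK n g}
  zero_mem' := ⟨1, one_mem _, 0, by simp⟩
  one_mem' := ⟨1, one_mem _, 1, by simp⟩
  neg_mem' := by
    rintro x ⟨d, hd, g, h⟩
    exact ⟨d, hd, -g, by rw [mul_neg, h, map_neg]⟩
  add_mem' := by
    rintro x y ⟨d, hd, g, h⟩ ⟨d', hd', g', h'⟩
    refine ⟨d * d', mul_mem hd hd', d' * g + d * g', ?_⟩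
    simp only [map_mul, map_add]
    linear_combination polyK n d' * h + polyK n d * h'
  mul_mem' := by
    rintro x y ⟨d, hd, g, h⟩ ⟨d', hd', g', h'⟩
    refine ⟨d * d', mul_mem hd hd', g * g', ?_⟩
    simp only [map_mul]
    linear_combination polyK n d' * y * h + polyK n g * h'

theorem polyK_mem_fracs (g : Polynomial (PolyZY n)) : polyK n g ∈ fracs n :=
  ⟨1, one_mem _, g, by simp⟩

theorem mem_fracs_of_mem_Lsmall {x : RatK n} (h : x ∈ Lsmall n) : x ∈ fracs n := by
  induction h using Algebra.adjoin_induction with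
  | mem x hx =>
    rcases hx with (rfl | rfl | rfl) | ⟨l, rfl⟩
    · rw [← polyK_X]; exact polyK_mem_fracs _
    · rw [yK, ← polyK_C]; exact polyK_mem_fracs _
    · refine ⟨_, Submonoid.subset_closure (Or.inl rfl), 1, ?_⟩
      rw [polyK_C, map_one]
      exact mul_inv_cancel₀ (yK_ne_zero n)
    · refine ⟨_, Submonoid.subset_closure (Or.inr ⟨l, rfl⟩), 1, ?_⟩
      have : polyK n (Polynomial.X + Polynomial.C ((l : PolyZY n) * MvPolynomial.X none))
          = lamK n + (l : RatK n) * yK n := by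
        rw [map_add, polyK_X, polyK_C, map_mul, map_intCast]; rfl
      rw [this, map_one]
      exact mul_inv_cancel₀ (lamK_add_ne_zero n l)
  | algebraMap c => rw [algebraMap_complex_RatK, ← polyK_C]; exact polyK_mem_fracs _
  | add x y _ _ hx hy => exact add_mem hx hy
  | mul x y _ _ hx hy => exact mul_mem hx hy

theorem mem_fracs_of_mem_Az {x : RatK n} (h : x ∈ Az n) : x ∈ fracs n := by
  induction h using Algebra.adjoin_induction with
  | mem x hx =>
    obtain ⟨a, rfl⟩ := hx
    rw [zK, ← polyK_C]; exact polyK_mem_fracs _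
  | algebraMap c => exact mem_fracs_of_mem_Lsmall c.2
  | add x y _ _ hx hy => exact add_mem hx hy
  | mul x y _ _ hx hy => exact mul_mem hx hy

theorem prod_dvd_of_dvd_mul {R ι : Type*} [CommRing R] [IsDomain R] (S : Finset ι) (l : ι → R)
    (e : R) (hp : ∀ s ∈ S, Prime (l s)) (he : ∀ s ∈ S, ¬ l s ∣ e) :
    ∀ g : R, ∏ s ∈ S, l s ∣ e * g → ∏ s ∈ S, l s ∣ g := by
  classical
  induction S using Finset.induction_on with
  | empty => simp
  | insert s S hs ih =>
    intro g hg
    rw [Finset.prod_insert hs] at hg ⊢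
    have h1 : l s ∣ g := ((hp s (by simp)).dvd_or_dvd (dvd_of_mul_right_dvd hg)).resolve_left
      (he s (by simp))
    obtain ⟨g', rfl⟩ := h1
    refine mul_dvd_mul_left _ (ih (fun t ht => hp t (by simp [ht])) (fun t ht => he t (by simp [ht]))
      g' ?_)
    rw [mul_left_comm] at hg
    exact (mul_dvd_mul_iff_left (hp s (by simp)).ne_zero).1 hg

/-- A possible denominator of `x` divides both ∏ l and e up to units of `Lsmall n`, and these are
coprime. Denominators are cleared first, so that divisibility takes place in ℂ[z, y][λ]. -/
theorem mem_Az_of_mul_mem {ι : Type*} (S : Finset ι) (l : ι → PolyZY n) (e : PolyZY n)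
    (hp : ∀ s ∈ S, Prime (l s)) (he : ∀ s ∈ S, ¬ l s ∣ e) (x : RatK n)
    (h1 : algebraMap (PolyZY n) (RatK n) (∏ s ∈ S, l s) * x ∈ Az n)
    (h2 : algebraMap (PolyZY n) (RatK n) e * x ∈ Az n) : x ∈ Az n := by
  obtain ⟨d, hd, g, hg⟩ := mem_fracs_of_mem_Az h1
  obtain ⟨d', hd', g', hg'⟩ := mem_fracs_of_mem_Az h2
  have h3 : (∏ s ∈ S, Polynomial.C (l s)) * (d * g')
      = Polynomial.C e * (d' * g) := by
    apply polyK_injective n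
    rw [← map_prod]
    simp only [map_mul, ← hg, ← hg', polyK_C]
    ring
  -- By `h3` the product divides e · d' · g, while no single prime divides e.
  have h4 : (∏ s ∈ S, Polynomial.C (l s)) ∣ d' * g := by
    refine prod_dvd_of_dvd_mul S _ (Polynomial.C e) (fun s hs => Polynomial.prime_C_iff.2 (hp s hs))
      (fun s hs hdvd => he s hs ?_) _ ⟨_, h3.symm⟩
    obtain ⟨c, hc⟩ := hdvd
    -- Comparing constant terms in λ brings the divisibility back to ℂ[z, y].
    refine ⟨c.coeff 0, ?_⟩
    have := congrArg (fun p => Polynomial.coeff p 0) hc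
    simpa using this
  obtain ⟨q, hq⟩ := h4
  have hdd := polyK_denoms (mul_mem hd hd')
  have h5 : polyK n (d * d') * x = polyK n q := by
    have hS : polyK n (∏ s ∈ S, Polynomial.C (l s)) ≠ 0 := by
      rw [Ne, map_eq_zero_iff _ (polyK_injective n), Finset.prod_eq_zero_iff]
      rintro ⟨s, hs, h0⟩
      exact (Polynomial.prime_C_iff.2 (hp s hs)).ne_zero h0
    refine mul_left_cancel₀ hS ?_
    rw [← map_mul _ _ q, ← hq]
    rw [← map_prod]
    simp only [map_mul, ← hg, polyK_C]
    ring
  have h6 : x = (polyK n (d * d'))⁻¹ * polyK n q := by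
    rw [← h5, inv_mul_cancel_left₀ hdd.1]
  rw [h6]
  exact mul_mem (mem_Az_of_mem_Lsmall hdd.2) (polyK_mem_Az q)

/-- The linear form `z_b - z_a + y`. -/
def linForm (a b : Fin n) : PolyZY n :=
  MvPolynomial.X (some b) - MvPolynomial.X (some a) + MvPolynomial.X none

theorem algebraMap_linForm (a b : Fin n) :
    algebraMap (PolyZY n) (RatK n) (linForm a b) = zK n b - zK n a + yK n := by
  simp [linForm, zK, yK]

/-- The substitution `y ↦ z_a - z_b`. -/
def substY (a b : Fin n) : PolyZY n →ₐ[ℂ] PolyZY n :=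
  MvPolynomial.aeval fun o => o.elim (MvPolynomial.X (some a) - MvPolynomial.X (some b))
    fun c => MvPolynomial.X (some c)

/-- Modulo the linear form, y is z_a - z_b. Hence the kernel of `substY` is the ideal of the form,
which reduces divisibility to a substitution and proves primality. -/
theorem linForm_dvd_sub (a b : Fin n) (p : PolyZY n) : linForm a b ∣ p - substY a b p := by
  induction p using MvPolynomial.induction_on with
  | C c => simp [substY]
  | add p q hp hq => rw [map_add, add_sub_add_comm]; exact dvd_add hp hq
  | mul_X p o hp =>
    have h1 : linForm a b ∣ MvPolynomial.X o - substY a b (MvPolynomial.X o) := by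
      rcases o with _ | c
      · refine dvd_of_eq ?_
        simp [substY, linForm]
        ring
      · simp [substY]
    have : p * MvPolynomial.X o - substY a b (p * MvPolynomial.X o)
        = (p - substY a b p) * MvPolynomial.X o
          + substY a b p * (MvPolynomial.X o - substY a b (MvPolynomial.X o)) := by
      rw [map_mul]; ring
    rw [this]
    exact dvd_add (hp.mul_right _) (h1.mul_left _)

theorem linForm_dvd_iff (a b : Fin n) (p : PolyZY n) : linForm a b ∣ p ↔ substY a b p = 0 := by
  constructor
  · rintro ⟨q, rfl⟩
    rw [map_mul]
    have : substY a b (linForm a b) = 0 := by simp [substY, linForm]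
    rw [this, zero_mul]
  · intro h
    have := linForm_dvd_sub a b p
    rwa [h, sub_zero] at this

theorem linForm_ne_zero (a b : Fin n) : linForm a b ≠ 0 := by
  intro h
  have h1 := algebraMap_linForm a b
  rw [h, map_zero] at h1
  exact zK_sub_add_ne_zero b a h1.symm

theorem prime_linForm (a b : Fin n) : Prime (linForm a b) := by
  refine ⟨linForm_ne_zero a b, fun hu => ?_, fun p q h => ?_⟩
  · have := (linForm_dvd_iff a b 1).1 hu.dvd
    simp at this
  · rw [linForm_dvd_iff, map_mul, mul_eq_zero] at h
    rwa [linForm_dvd_iff, linForm_dvd_iff]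

theorem not_linForm_dvd {a b c d : Fin n} (hab : a < b) (hcd : d < c) :
    ¬ linForm a b ∣ linForm c d := by
  rw [linForm_dvd_iff]
  intro h
  have h1 : substY a b (linForm c d) = MvPolynomial.X (some d) - MvPolynomial.X (some c)
      + (MvPolynomial.X (some a) - MvPolynomial.X (some b)) := by simp [substY, linForm]
  rw [h1] at h
  -- At the test point z_e = e vanishing would mean d + a = c + b, against a < b and d < c.
  have h2 := congrArg (MvPolynomial.eval fun o : Option (Fin n) => o.elim (0 : ℂ)
    fun e => ((e : ℕ) : ℂ)) h
  simp only [map_add, map_sub, MvPolynomial.eval_X, Option.elim_some, map_zero] at h2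
  have h3 : ((d + a : ℕ) : ℂ) = ((c + b : ℕ) : ℂ) := by
    push_cast
    linear_combination h2
  have h4 : (d + a : ℕ) = c + b := by exact_mod_cast h3
  rw [Fin.lt_def] at hab hcd
  omega

end Az

/-! ### Invariant vectors and invariant families -/

section Inv
variable {n k : ℕ}

/-- The product `∏_{a < b} (z_b - z_a + y)`. -/
def Dprod (n : ℕ) : RatK n :=
  ∏ a : Fin n, ∏ b ∈ Finset.univ.filter (fun b => a < b), (zK n b - zK n a + yK n)

/-- Vectors that are invariant under the exchange operators and become polynomial in `z` after
multiplication by `Dprod n`. -/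
def IsInvVec (ζ : Finset (Fin n) → RatK n) : Prop :=
  (∀ i j : Fin n, (j : ℕ) = i + 1 → exchT i j ζ = ζ) ∧ ∀ J, Dprod n * ζ J ∈ Az n

/-- Families of polynomials on the set of fixed points that are equivariant under permutations. -/
def IsInvFam (g : Sub n k → RatK n) : Prop :=
  (∀ I, g I ∈ Az n) ∧ ∀ σ I, permK σ (g I) = g (permSub σ I)

theorem inv_Cfac_mem_Lsmall (r : ℤ) (J : Finset (Fin n)) :
    (Cfac r J (lamK n) (yK n))⁻¹ ∈ Lsmall n := by
  rw [Cfac, ← Finset.prod_inv_distrib]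
  exact prod_mem fun i _ => inv_lamK_sub_mem_Lsmall n _

theorem Cfac_mem_Lsmall (r : ℤ) (J : Finset (Fin n)) : Cfac r J (lamK n) (yK n) ∈ Lsmall n :=
  prod_mem fun _ _ => lamK_sub_mem_Lsmall n _

/-- Pairs of indices in the same block of the decomposition of `[n]` given by `topSub`. -/
def blockPairs (n k : ℕ) : Finset (Fin n × Fin n) :=
  Finset.univ.filter fun p => p.1 < p.2 ∧ ¬ ((p.1 : ℕ) < n - k ∧ n - k ≤ p.2)

/-- The pairs a < b that cross from the first n - k to the last k indices are exactly those of Q at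
the base subset. -/
theorem Dprod_eq (hk : k ≤ n) :
    Dprod n = QI (topSub hk)
      * ∏ p ∈ blockPairs n k, (zK n p.2 - zK n p.1 + yK n) := by
  have h1 : Dprod n = ∏ p ∈ (Finset.univ : Finset (Fin n × Fin n)).filter (fun p => p.1 < p.2),
      (zK n p.2 - zK n p.1 + yK n) := by
    rw [Finset.prod_filter, Fintype.prod_prod_type]
    exact Finset.prod_congr rfl fun a _ => Finset.prod_filter _ _
  rw [h1, ← Finset.prod_filter_mul_prod_filter_not _
    (fun p : Fin n × Fin n => (p.1 : ℕ) < n - k ∧ n - k ≤ p.2), Finset.filter_filter,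
    Finset.filter_filter]
  congr 1
  rw [QI, ← Finset.prod_product']
  refine Finset.prod_nbij' Prod.swap Prod.swap ?_ ?_ ?_ ?_ ?_
  · rintro ⟨a, b⟩ h
    simp only [Finset.mem_filter, Finset.mem_univ, true_and] at h
    simp only [Prod.swap_prod_mk, Finset.mem_product, Finset.mem_compl, mem_topSub]
    omega
  · rintro ⟨a, b⟩ h
    simp only [Finset.mem_product, Finset.mem_compl, mem_topSub] at h
    simp only [Prod.swap_prod_mk, Finset.mem_filter, Finset.mem_univ, true_and, Fin.lt_def]
    omega
  · intro p _; exact Prod.swap_swap p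
  · intro p _; exact Prod.swap_swap p
  · rintro ⟨a, b⟩ _; rfl

/-- The permutation of `[n]` that reverses the first `n - k` and the last `k` elements. -/
def blockRev (hk : k ≤ n) : Equiv.Perm (Fin n) where
  toFun a := if h : (a : ℕ) < n - k then ⟨n - k - 1 - a, by omega⟩ else ⟨2 * n - k - 1 - a, by omega⟩
  invFun a := if h : (a : ℕ) < n - k then ⟨n - k - 1 - a, by omega⟩ else ⟨2 * n - k - 1 - a, by omega⟩
  left_inv a := by
    apply Fin.ext
    by_cases h : (a : ℕ) < n - k
    · have h' : n - k - 1 - (a : ℕ) < n - k := by omega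
      simp only [h, h', dif_pos]
      omega
    · have h' : ¬ (2 * n - k - 1 - (a : ℕ) < n - k) := by omega
      simp only [h, h', dif_neg, not_false_iff]
      omega
  right_inv a := by
    apply Fin.ext
    by_cases h : (a : ℕ) < n - k
    · have h' : n - k - 1 - (a : ℕ) < n - k := by omega
      simp only [h, h', dif_pos]
      omega
    · have h' : ¬ (2 * n - k - 1 - (a : ℕ) < n - k) := by omega
      simp only [h, h', dif_neg, not_false_iff]
      omega

theorem val_blockRev (hk : k ≤ n) (a : Fin n) :
    (blockRev hk a : ℕ) = if (a : ℕ) < n - k then n - k - 1 - a else 2 * n - k - 1 - a := by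
  change ((if h : (a : ℕ) < n - k then (⟨n - k - 1 - a, _⟩ : Fin n)
    else ⟨2 * n - k - 1 - a, _⟩ : Fin n) : ℕ) = _
  split_ifs <;> rfl

theorem permSub_blockRev (hk : k ≤ n) : permSub (blockRev hk) (topSub hk) = topSub hk := by
  apply Subtype.ext
  ext a
  rw [permSub, mem_permSet]
  change blockRev hk a ∈ _ ↔ _
  rw [mem_topSub, mem_topSub, val_blockRev]
  split_ifs <;> omega

theorem permK_fam_of_adjacent {g : Sub n k → RatK n}
    (h : ∀ i j : Fin n, (j : ℕ) = i + 1 → ∀ I, permK (Equiv.swap i j) (g I)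
      = g (permSub (Equiv.swap i j) I)) (σ : Equiv.Perm (Fin n)) :
    ∀ I, permK σ (g I) = g (permSub σ I) := by
  refine perm_adjacent_induction (fun σ => ∀ I, permK σ (g I) = g (permSub σ I)) ?_ ?_ σ
  · intro I; rw [permK_one, permSub_one]
  · intro i j hij σ ih I
    rw [permK_mul, ih, h i j hij, permSub_mul]

theorem locSum_topSub (hk : k ≤ n) (ζ : Finset (Fin n) → RatK n) :
    locSum ζ (topSub hk)
      = ζ (topSub hk).1 * (QI (topSub hk) / Cfac 1 (topSub hk).1 (lamK n) (yK n)) := by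
  rw [locSum, Finset.sum_eq_single (topSub hk).1, plusAt_topSub]
  · intro J _ hJ
    rw [plusAt_topSub_of_ne hk J hJ, mul_zero]
  · simp

/-- At the base fixed point the factor Q in the restriction is cancelled against the same factor of
D. Only forms from pairs inside a block can remain as denominators, and a symmetry argument excludes
these. -/
theorem IsInvVec.isInvFam {ζ : Finset (Fin n) → RatK n} (h : IsInvVec ζ) :
    IsInvFam fun I : Sub n k => locSum ζ I := by
  have hperm : ∀ (σ : Equiv.Perm (Fin n)) (I : Sub n k),
      permK σ (locSum ζ I) = locSum ζ (permSub σ I) :=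
    permK_fam_of_adjacent fun i j hij I => by
      rw [← locSum_exchT hij, h.1 i j hij]
  refine ⟨fun I => ?_, hperm⟩
  have hk := sub_le I
  suffices h0 : locSum ζ (topSub hk) ∈ Az n by
    obtain ⟨σ, rfl⟩ := exists_permSub_eq (topSub hk) I
    change locSum ζ (permSub σ (topSub hk)) ∈ Az n
    rw [← hperm]
    exact permK_mem_Az σ h0
  -- The product E over pairs within blocks clears the denominator of the restriction, since D = Q ·
  -- E.
  have hE : (∏ p ∈ blockPairs n k, (zK n p.2 - zK n p.1 + yK n)) * locSum ζ (topSub hk) ∈ Az n := by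
    have : (∏ p ∈ blockPairs n k, (zK n p.2 - zK n p.1 + yK n)) * locSum ζ (topSub hk)
        = Dprod n * ζ (topSub hk).1 * (Cfac 1 (topSub hk).1 (lamK n) (yK n))⁻¹ := by
      rw [locSum_topSub, Dprod_eq hk]; ring
    rw [this]
    exact mul_mem (h.2 _) (mem_Az_of_mem_Lsmall (inv_Cfac_mem_Lsmall _ _))
  -- Block reversal fixes the base subset, hence the restriction, but reverses the orientation of
  -- every form in E. By `not_linForm_dvd` the two products are coprime.
  have hE' := permK_mem_Az (blockRev hk) hE
  rw [map_mul, hperm, permSub_blockRev] at hE'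
  refine mem_Az_of_mul_mem (blockPairs n k) (fun p => linForm p.1 p.2)
    (∏ p ∈ blockPairs n k, linForm (blockRev hk p.1) (blockRev hk p.2))
    (fun p _ => prime_linForm _ _) (fun p hp hdvd => ?_) _ ?_ ?_
  · obtain ⟨q, hq, hpq⟩ := (prime_linForm p.1 p.2).exists_mem_finset_dvd hdvd
    simp only [blockPairs, Finset.mem_filter, Finset.mem_univ, true_and] at hp hq
    refine not_linForm_dvd hp.1 ?_ hpq
    have h1 := val_blockRev hk q.1
    have h2 := val_blockRev hk q.2
    have h3 := Fin.lt_def.1 hq.1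
    rw [Fin.lt_def]
    split_ifs at h1 h2 <;> omega
  · simp only [map_prod, algebraMap_linForm]
    exact hE
  · simp only [map_prod, algebraMap_linForm]
    simpa only [map_prod, map_add, map_sub, permK_zK, permK_yK] using hE'

/-! ### From equivariant families to invariant vectors. -/

theorem permK_Dprod {i j : Fin n} (hij : (j : ℕ) = i + 1) :
    permK (Equiv.swap i j) (Dprod n) * (yK n - (zK n i - zK n j))
      = Dprod n * (yK n + (zK n i - zK n j)) := by
  obtain ⟨c, h1, h2⟩ := pairs_swap hij (fun a b => zK n b - zK n a + yK n)
  have h3 : permK (Equiv.swap i j) (Dprod n) = (zK n i - zK n j + yK n) * c := by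
    rw [← h2, Dprod]
    simp only [map_prod, map_add, map_sub, permK_zK, permK_yK]
  rw [h3, Dprod, h1]
  ring

/-- The polynomiality condition propagates along the exchange relations. -/
theorem Dprod_mul_permSet_swap_mem_Az {i j : Fin n} (hij : (j : ℕ) = i + 1)
    {ζ : Finset (Fin n) → RatK n} (hζ : exchT i j ζ = ζ) {J : Finset (Fin n)}
    (h : Dprod n * ζ J ∈ Az n) : Dprod n * ζ (permSet (Equiv.swap i j) J) ∈ Az n := by
  by_cases h0 : slotDiff i j J = 0
  · rwa [permSet_swap_eq_self h0]
  set x := permK (Equiv.swap i j) (Dprod n * ζ (permSet (Equiv.swap i j) J)) with hx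
  suffices hmem : x ∈ Az n by
    have := permK_mem_Az (Equiv.swap i j) hmem
    rwa [hx, permK_swap_swap] at this
  set w := zK n i - zK n j with hw
  set L := lamK n - (wt J j : RatK n) * yK n with hL
  set e := slotDiff i j J with he
  have hw0 : w ≠ 0 := zK_sub_ne_zero (adjacent_ne hij)
  have hL0 : L ≠ 0 := lamK_sub_ne_zero n _
  have hey : L + (e : RatK n) * yK n = lamK n - ((wt J j - e : ℤ) : RatK n) * yK n := by
    rw [hL]; push_cast; ring
  have hey0 : L + (e : RatK n) * yK n ≠ 0 := by rw [hey]; exact lamK_sub_ne_zero n _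
  have hwy : w - yK n ≠ 0 := zK_sub_sub_ne_zero
  have hJ := congrFun hζ J
  rw [exchT, diagK, offK, exchDiag, exchOff, ← he, if_neg h0, if_neg h0, ← hL, ← hw] at hJ
  have hD := permK_Dprod hij
  rw [← hw] at hD
  set η := Dprod n * ζ J with hη
  -- The J-component of invariance is solved for the swapped coordinate. Multiplication by the
  -- permuted D cancels w - y, so the only pole left in z is at w = 0, and it sits in a divided
  -- difference of η.
  have key : x = ((-(L * yK n)) * ((η - permK (Equiv.swap i j) η) / w) - L * η
      + (e : RatK n) * yK n * permK (Equiv.swap i j) η) * (L + (e : RatK n) * yK n)⁻¹ := by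
    rw [hx, hη, map_mul, map_mul]
    generalize permK (Equiv.swap i j) (Dprod n) = D' at *
    generalize permK (Equiv.swap i j) (ζ J) = s at *
    generalize permK (Equiv.swap i j) (ζ (permSet (Equiv.swap i j) J)) = s' at *
    have hD'' : D' = -(Dprod n * (yK n + w)) / (w - yK n) := by
      rw [eq_div_iff hwy]; linear_combination -hD
    have hs' : s' = (L * (w - yK n) * ζ J + (L + e * w) * yK n * s) / ((L + e * yK n) * w) := by
      rw [eq_div_iff (mul_ne_zero hey0 hw0)]
      field_simp at hJ
      linear_combination hJ
    rw [hs', hD'']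
    field_simp
    ring
  rw [key]
  have hLA : L ∈ Az n := mem_Az_of_mem_Lsmall (lamK_sub_mem_Lsmall n _)
  have hyA := yK_mem_Az n
  have heA : (e : RatK n) ∈ Az n := intCast_mem _ _
  refine mul_mem (add_mem (sub_mem (mul_mem (neg_mem (mul_mem hLA hyA))
    (divDiff_mem_Az (adjacent_ne hij) h)) (mul_mem hLA h))
    (mul_mem (mul_mem heA hyA) (permK_mem_Az _ h))) (mem_Az_of_mem_Lsmall ?_)
  rw [hey]
  exact inv_lamK_sub_mem_Lsmall n _

/-- The vector that corresponds to a family of values at the fixed points. -/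
def famVec (g : Sub n k → RatK n) (K : Finset (Fin n)) : RatK n :=
  ∑ I : Sub n k, g I / RI I * xi I K

theorem exchT_famVec {i j : Fin n} (hij : (j : ℕ) = i + 1) {g : Sub n k → RatK n}
    (hg : ∀ I, permK (Equiv.swap i j) (g I) = g (permSub (Equiv.swap i j) I)) :
    exchT i j (famVec g) = famVec g := by
  funext P
  have h1 : exchT i j (famVec g) P
      = ∑ I : Sub n k, permK (Equiv.swap i j) (g I / RI I) * exchT i j (xi I) P := by
    simp only [exchT, famVec, map_sum, map_mul, Finset.mul_sum, ← Finset.sum_add_distrib]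
    exact Finset.sum_congr rfl fun I _ => by ring
  rw [h1, famVec]
  let e : Sub n k ≃ Sub n k := ⟨permSub (Equiv.swap i j), permSub (Equiv.swap i j),
    permSub_swap_swap i j, permSub_swap_swap i j⟩
  refine Fintype.sum_equiv e _ _ fun I => ?_
  change _ = g (permSub (Equiv.swap i j) I) / RI (permSub (Equiv.swap i j) I)
    * xi (permSub (Equiv.swap i j) I) P
  rw [map_div₀, hg, permK_RI, exchT_xi hij]

/-- At the base subset only one ξ contributes and its denominators divide D. The exchange relations
spread polynomiality to the other coordinates. -/
theorem IsInvFam.isInvVec {g : Sub n k → RatK n} (h : IsInvFam g) : IsInvVec (famVec g) := by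
  have hT : ∀ i j : Fin n, (j : ℕ) = i + 1 → exchT i j (famVec g) = famVec g :=
    fun i j hij => exchT_famVec hij fun I => h.2 _ I
  refine ⟨hT, fun J => ?_⟩
  by_cases hJ : J.card = k
  · have hk : k ≤ n := sub_le ⟨J, hJ⟩
    refine sub_induction (topSub hk) (fun J => Dprod n * famVec g J.1 ∈ Az n) ?_
      (fun i j hij I ih => Dprod_mul_permSet_swap_mem_Az hij (hT i j hij) ih) ⟨J, hJ⟩
    have h1 : Dprod n * famVec g (topSub hk).1
        = (∏ p ∈ blockPairs n k, (zK n p.2 - zK n p.1 + yK n))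
          * Cfac 1 (topSub hk).1 (lamK n) (yK n) * g (topSub hk) := by
      rw [famVec, Finset.sum_eq_single (topSub hk), xi_topSub, Dprod_eq hk]
      · have hQ := QI_ne_zero (topSub hk)
        have hR := RI_ne_zero (topSub hk)
        field_simp
      · intro I _ hI
        rw [xi_topSub_of_ne hk I hI, mul_zero]
      · simp
    rw [h1]
    refine mul_mem (mul_mem (prod_mem fun p _ => ?_)
      (mem_Az_of_mem_Lsmall (Cfac_mem_Lsmall _ _))) (h.1 _)
    exact add_mem (sub_mem (zK_mem_Az _) (zK_mem_Az _)) (yK_mem_Az n)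
  · rw [famVec, Finset.sum_eq_zero fun I _ => by rw [xi_of_card_ne I J hJ, mul_zero], mul_zero]
    exact zero_mem _

theorem famVec_locSum (ζ : Finset (Fin n) → RatK n) (K : Finset (Fin n)) :
    famVec (fun I : Sub n k => locSum ζ I) K = if K.card = k then ζ K else 0 := by
  split_ifs with hK
  · exact (eq_sum_locSum ζ (⟨K, hK⟩ : Sub n k)).symm
  · exact Finset.sum_eq_zero fun I _ => by rw [xi_of_card_ne I K hK, mul_zero]

theorem IsInvVec.add {ζ η : Finset (Fin n) → RatK n} (h : IsInvVec ζ) (h' : IsInvVec η) :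
    IsInvVec (ζ + η) := by
  refine ⟨fun i j hij => ?_, fun J => ?_⟩
  · have : exchT i j (ζ + η) = exchT i j ζ + exchT i j η := by
      funext P
      simp only [exchT, Pi.add_apply, map_add]
      ring
    rw [this, h.1 i j hij, h'.1 i j hij]
  · rw [Pi.add_apply, mul_add]
    exact add_mem (h.2 J) (h'.2 J)

theorem IsInvVec.zero : IsInvVec (0 : Finset (Fin n) → RatK n) := by
  refine ⟨fun i j _ => funext fun P => ?_, fun J => ?_⟩
  · simp [exchT]
  · rw [Pi.zero_apply, mul_zero]; exact zero_mem _

/-- For the converse, the inversion formula rebuilds ζ from its restrictions, one weight space at a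
time. -/
theorem isInvVec_iff {ζ : Finset (Fin n) → RatK n} :
    IsInvVec ζ ↔ ∀ k : Fin (n + 1), IsInvFam fun I : Sub n k => locSum ζ I := by
  refine ⟨fun h k => h.isInvFam, fun h => ?_⟩
  have h1 : ζ = ∑ k : Fin (n + 1), famVec fun I : Sub n k => locSum ζ I := by
    funext K
    have hK : K.card < n + 1 := by
      have := Finset.card_le_univ K
      rw [Fintype.card_fin] at this
      omega
    rw [Finset.sum_apply, Finset.sum_eq_single (⟨K.card, hK⟩ : Fin (n + 1))]
    · rw [famVec_locSum, if_pos rfl]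
    · intro b _ hb
      rw [famVec_locSum, if_neg]
      rintro e
      exact hb (Fin.ext e.symm)
    · simp
  rw [h1]
  exact Finset.sum_induction _ IsInvVec (fun _ _ => IsInvVec.add) IsInvVec.zero
    fun k _ => (h k).isInvVec

end Inv

/-! ### Invariant vectors form a submodule -/

section Action
variable {n : ℕ}

/-- The coordinates of an element of `V n` as elements of `ℂ(λ, z, y)`. -/
def coords (ζ : V n) : Finset (Fin n) → RatK n := fun J => (ζ J : RatK n)

theorem shiftK_mul_Dprod (m : ℤ) (x : RatK n) :
    shiftK n m (Dprod n * x) = Dprod n * shiftK n m x := by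
  have : shiftK n m (Dprod n) = Dprod n := by
    simp only [Dprod, map_prod, map_add, map_sub, shiftK_zK, shiftK_yK]
  rw [map_mul, this]

/-- Power series over `𝓛_{λ,(z,y)}` with coefficients that are polynomial in `z`. -/
def polySer (n : ℕ) : Subring (PowerSeries (Lfull n)) :=
  (PowerSeries.map ((Az n).toSubring.comap (algebraMap (Lfull n) (RatK n))).subtype).range

theorem mem_polySer {p : PowerSeries (Lfull n)} :
    p ∈ polySer n ↔ ∀ s, ((PowerSeries.coeff s p : Lfull n) : RatK n) ∈ Az n := by
  constructor
  · rintro ⟨q, rfl⟩ s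
    rw [PowerSeries.coeff_map]
    exact (PowerSeries.coeff s q).2
  · intro h
    refine ⟨PowerSeries.mk fun s => ⟨PowerSeries.coeff s p, h s⟩, ?_⟩
    ext s
    simp

theorem C_mem_polySer {x : Lfull n} (h : (x : RatK n) ∈ Az n) :
    PowerSeries.C x ∈ polySer n := by
  rw [mem_polySer]
  intro s
  rw [PowerSeries.coeff_C]
  split_ifs
  · exact h
  · exact zero_mem (Az n)

theorem X_mem_polySer : (PowerSeries.X : PowerSeries (Lfull n)) ∈ polySer n := by
  rw [mem_polySer]
  intro s
  rw [PowerSeries.coeff_X]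
  split_ifs
  · exact one_mem (Az n)
  · exact zero_mem (Az n)

theorem geom_mem_polySer {x : Lfull n} (h : (x : RatK n) ∈ Az n) : geom x ∈ polySer n := by
  rw [mem_polySer]
  intro s
  rw [geom, PowerSeries.coeff_mk, Subalgebra.coe_pow]
  exact pow_mem h s

theorem Rentry_mem_polySer (m : ℤ) (a : Fin n) (p q : Fin 2 × Fin 2) :
    Rentry n m (zL n a) p q ∈ polySer n := by
  have hl : (lamL n : RatK n) ∈ Az n := lamK_mem_Az n
  have hy : (yL n : RatK n) ∈ Az n := yK_mem_Az n
  have hz : (zL n a : RatK n) ∈ Az n := zK_mem_Az a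
  have hi : (invL n (-m) : RatK n) ∈ Az n := mem_Az_of_mem_Lsmall (inv_lamK_add_mem_Lsmall n _)
  have hm : ((m : Lfull n) : RatK n) ∈ Az n := intCast_mem (Az n) m
  have hL : ((lamL n - (m : Lfull n) * yL n : Lfull n) : RatK n) ∈ Az n :=
    (Az n).sub_mem hl (mul_mem hm hy)
  have hg : geom (zL n a + yL n) ∈ polySer n := geom_mem_polySer ((Az n).add_mem hz hy)
  unfold Rentry
  split_ifs
  · exact one_mem _
  · exact mul_mem (mul_mem (C_mem_polySer ((Az n).mul_mem (add_mem hL hy) hi))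
      (sub_mem (one_mem _) (mul_mem (C_mem_polySer hz) X_mem_polySer))) hg
  · exact mul_mem (mul_mem (neg_mem (C_mem_polySer ((Az n).mul_mem hy hi)))
      (add_mem (one_mem _) (mul_mem (C_mem_polySer ((Az n).sub_mem hL hz)) X_mem_polySer))) hg
  · exact mul_mem (mul_mem (neg_mem (C_mem_polySer ((Az n).mul_mem hy hi)))
      (sub_mem (mul_mem (C_mem_polySer ((Az n).add_mem hL hz)) X_mem_polySer) (one_mem _))) hg
  · exact mul_mem (mul_mem (C_mem_polySer ((Az n).mul_mem (sub_mem hL hy) hi))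
      (sub_mem (one_mem _) (mul_mem (C_mem_polySer hz) X_mem_polySer))) hg
  · exact one_mem _
  · exact zero_mem _

theorem list_prod_apply_mem {R ι : Type*} [CommRing R] [Fintype ι] [DecidableEq ι] (S : Subring R)
    (l : List (Matrix ι ι R)) (h : ∀ M ∈ l, ∀ p q, M p q ∈ S) : ∀ p q, l.prod p q ∈ S := by
  induction l with
  | nil =>
    intro p q
    rw [List.prod_nil, Matrix.one_apply]
    split_ifs
    · exact one_mem S
    · exact zero_mem S
  | cons M l ih =>
    intro p q
    rw [List.prod_cons, Matrix.mul_apply]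
    exact sum_mem fun r _ => mul_mem (h M (by simp) p r) (ih (fun N hN => h N (by simp [hN])) r q)

theorem Lcoeff_mem_Az (a b : Fin 2) (s : ℕ) (P Q : Finset (Fin n)) :
    (Lcoeff n a b s P Q : RatK n) ∈ Az n := by
  refine mem_polySer.1 (list_prod_apply_mem (polySer n) (List.ofFn (R0 n)) (fun M hM p q => ?_) _ _) s
  obtain ⟨l, rfl⟩ := (List.mem_ofFn' _ _).1 hM
  rw [R0, Matrix.of_apply]
  split_ifs
  · exact Rentry_mem_polySer _ _ _ _
  · exact zero_mem _

theorem coords_Ltilde (a b : Fin 2) (s : ℕ) (ζ : V n) (P : Finset (Fin n)) :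
    coords (Ltilde n a b s ζ) P
      = ∑ Q, (Lcoeff n a b s P Q : RatK n) * shiftK n (-slotWeight b) (coords ζ Q) := by
  have h : (if b = 0 then (-1 : ℤ) else 1) = -slotWeight b := by
    unfold slotWeight; split_ifs <;> rfl
  change ((∑ Q, Lcoeff n a b s P Q * shiftL n (if b = 0 then -1 else 1) (ζ Q) : Lfull n) : RatK n)
    = _
  rw [h]
  exact map_sum (algebraMap (Lfull n) (RatK n)) _ _

/-- The shift by which `Ltilde` acts is exactly the auxiliary contribution to the dynamical
parameter in `Lcoeff_exchange`. -/
theorem shiftK_diagK (i j : Fin n) (b : Fin 2) (Q : Finset (Fin n)) :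
    shiftK n (-slotWeight b) (diagK i j Q) = diagShift i j b Q := by
  have := map_exchDiag ((shiftK n (-slotWeight b)).toRingEquiv : RatK n →+* RatK n)
    (slotDiff i j Q) (lamK n - (wt Q j : RatK n) * yK n) (zK n i - zK n j) (yK n)
  refine this.trans ?_
  rw [diagShift]
  congr 1
  · simp [shiftK_lamK, shiftK_yK, wt_eq_tailWeight]
    ring
  · simp [shiftK_zK]
  · simp [shiftK_yK]

theorem shiftK_offK (i j : Fin n) (b : Fin 2) (Q : Finset (Fin n)) :
    shiftK n (-slotWeight b) (offK i j Q) = offShift i j b Q := by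
  have := map_exchOff ((shiftK n (-slotWeight b)).toRingEquiv : RatK n →+* RatK n)
    (slotDiff i j Q) (lamK n - (wt Q j : RatK n) * yK n) (zK n i - zK n j) (yK n)
  refine this.trans ?_
  rw [offShift]
  congr 1
  · simp [shiftK_lamK, shiftK_yK, wt_eq_tailWeight]
    ring
  · simp [shiftK_zK]
  · simp [shiftK_yK]

/-- `Lcoeff_exchange` moves the exchange operator past L, and the shift of λ turns the result back
into the unshifted operator acting on ζ. For polynomiality, D does not involve λ and the
coefficients of L lie in `Az n`. -/
theorem isInvVec_Ltilde (a b : Fin 2) (s : ℕ) {ζ : V n} (h : IsInvVec (coords ζ)) :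
    IsInvVec (coords (Ltilde n a b s ζ)) := by
  refine ⟨fun i j hij => funext fun P => ?_, fun J => ?_⟩
  · have h1 : exchT i j (coords (Ltilde n a b s ζ)) P
        = ∑ Q, ((Lcoeff n a b s P Q : RatK n) * diagShift i j b Q
          + (Lcoeff n a b s P (permSet (Equiv.swap i j) Q) : RatK n)
            * offShift i j b (permSet (Equiv.swap i j) Q))
          * shiftK n (-slotWeight b) (permK (Equiv.swap i j) (coords ζ Q)) := by
      simp only [exchT, coords_Ltilde, map_sum, map_mul, Finset.mul_sum, permK_shiftK]
      rw [← Finset.sum_add_distrib]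
      refine Finset.sum_congr rfl fun Q _ => ?_
      rw [← Lcoeff_exchange hij]
      ring
    rw [h1, coords_Ltilde]
    simp only [add_mul, Finset.sum_add_distrib]
    let e : Finset (Fin n) ≃ Finset (Fin n) :=
      ⟨permSet (Equiv.swap i j), permSet (Equiv.swap i j), permSet_swap_swap i j,
        permSet_swap_swap i j⟩
    have h2 : ∑ Q, (Lcoeff n a b s P (permSet (Equiv.swap i j) Q) : RatK n)
            * offShift i j b (permSet (Equiv.swap i j) Q)
          * shiftK n (-slotWeight b) (permK (Equiv.swap i j) (coords ζ Q))
        = ∑ Q, (Lcoeff n a b s P Q : RatK n) * offShift i j b Q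
          * shiftK n (-slotWeight b)
            (permK (Equiv.swap i j) (coords ζ (permSet (Equiv.swap i j) Q))) := by
      refine Fintype.sum_equiv e _ _ fun Q => ?_
      simp only [e, Equiv.coe_fn_mk, permSet_swap_swap]
    rw [h2, ← Finset.sum_add_distrib]
    refine Finset.sum_congr rfl fun Q _ => ?_
    -- Invariance of ζ after the shift of λ, now with the coefficients `diagShift` and `offShift`.
    have h3 := congrArg (shiftK n (-slotWeight b)) (congrFun (h.1 i j hij) Q)
    rw [exchT, map_add, map_mul, map_mul, shiftK_diagK, shiftK_offK] at h3
    rw [← h3]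
    ring
  · rw [coords_Ltilde, Finset.mul_sum]
    refine sum_mem fun Q _ => ?_
    have h1 := shiftK_mem_Az (-slotWeight b) (h.2 Q)
    rw [shiftK_mul_Dprod] at h1
    rw [mul_left_comm]
    exact mul_mem (Lcoeff_mem_Az _ _ _ _ _) h1

/-- The scalar depends only on |J|, which the exchange operators preserve, and contains no z, so
permutations fix it. -/
theorem isInvVec_cartan (p : MvPolynomial (Fin 3) ℂ) (D : Multiset (ℤ × ℤ)) {ζ : V n}
    (h : IsInvVec (coords ζ)) : IsInvVec (coords (cartan n p D ζ)) := by
  let c : ℕ → Lfull n := fun r =>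
    MvPolynomial.aeval ![lamL n, ((2 * (r : ℤ) - n : ℤ) : Lfull n) * yL n, yL n] p
      * (D.map fun kl => invL n (kl.1 * (2 * (r : ℤ) - n) + kl.2)).prod
  have hc : ∀ r, (c r : RatK n) ∈ Lsmall n := by
    intro r
    refine (Lsmall n).mul_mem ?_ ?_
    · induction p using MvPolynomial.induction_on with
      | C x => simp
      | add p q hp hq => rw [map_add]; exact (Lsmall n).add_mem hp hq
      | mul_X p a hp =>
        rw [map_mul, MvPolynomial.aeval_X]
        refine (Lsmall n).mul_mem hp ?_
        fin_cases a
        · exact lamK_mem_Lsmall n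
        · exact (Lsmall n).mul_mem (intCast_mem (Lsmall n) (2 * (r : ℤ) - n))
            (yK_mem_Lsmall n)
        · exact yK_mem_Lsmall n
    · have : ((D.map fun kl => invL n (kl.1 * (2 * (r : ℤ) - n) + kl.2)).prod : RatK n)
          = (D.map fun kl => (invL n (kl.1 * (2 * (r : ℤ) - n) + kl.2) : RatK n)).prod := by
        have h1 := map_multiset_prod (algebraMap (Lfull n) (RatK n))
          (D.map fun kl => invL n (kl.1 * (2 * (r : ℤ) - n) + kl.2))
        rw [Multiset.map_map] at h1
        exact h1
      rw [this]
      refine multiset_prod_mem _ fun x hx => ?_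
      obtain ⟨kl, _, rfl⟩ := Multiset.mem_map.1 hx
      exact inv_lamK_add_mem_Lsmall n _
  have hval : ∀ J, coords (cartan n p D ζ) J = (c J.card : RatK n) * coords ζ J := fun J => rfl
  refine ⟨fun i j hij => funext fun P => ?_, fun J => ?_⟩
  · have hcard : (permSet (Equiv.swap i j) P).card = P.card := Finset.card_map _
    have h1 := congrFun (h.1 i j hij) P
    rw [exchT] at h1
    rw [exchT, hval, hval, hcard, map_mul, map_mul, permK_of_mem_Lsmall _ (hc _)]
    linear_combination (c P.card : RatK n) * h1
  · rw [hval, mul_left_comm]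
    exact mul_mem (mem_Az_of_mem_Lsmall (hc _)) (h.2 J)

theorem isInvVec_operatorAlgebra {a : Module.End ℂ (V n)} (ha : a ∈ operatorAlgebra n) :
    ∀ ζ : V n, IsInvVec (coords ζ) → IsInvVec (coords (a ζ)) := by
  induction ha using Algebra.adjoin_induction with
  | mem a ha =>
    rcases ha with ⟨p, D, rfl⟩ | ⟨i, j, s, rfl⟩
    · exact fun ζ h => isInvVec_cartan p D h
    · exact fun ζ h => isInvVec_Ltilde i j s h
  | algebraMap c =>
    intro ζ h
    have hval : ∀ J, coords (algebraMap ℂ (Module.End ℂ (V n)) c ζ) J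
        = algebraMap ℂ (RatK n) c * coords ζ J := by
      intro J
      rw [← Algebra.smul_def]
      rfl
    refine ⟨fun i j hij => funext fun P => ?_, fun J => ?_⟩
    · have h1 := congrFun (h.1 i j hij) P
      rw [exchT] at h1
      rw [exchT, hval, hval, map_mul, map_mul, permK_complex]
      linear_combination (algebraMap ℂ (RatK n) c) * h1
    · rw [hval, mul_left_comm]
      exact mul_mem (complex_mem_Az n c) (h.2 J)
  | add a b _ _ iha ihb => exact fun ζ h => (iha ζ h).add (ihb ζ h)
  | mul a b _ _ iha ihb => exact fun ζ h => iha _ (ihb ζ h)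

end Action

/-! ### Lagrange idempotents -/

section Lagrange
variable {K A G ι : Type*} [Field K] [CommRing A] [Algebra K A] [Fintype G] [Fintype ι]
  [DecidableEq ι]

/-- The element `∏_j ℓ_{g(j)}(γ_j)`, where the `ℓ_i` are the Lagrange basis polynomials with
nodes `z`. -/
def lagrangeProd (z : ι → K) (γ : G → A) (g : G → ι) : A :=
  ∏ j, Polynomial.aeval (γ j) (Lagrange.basis Finset.univ z (g j))

variable {z : ι → K} {γ : G → A}

theorem sum_lagrangeProd [DecidableEq G] (hz : Function.Injective z)
    (hc : Fintype.card G = Fintype.card ι) : ∑ g : G → ι, lagrangeProd z γ g = 1 := by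
  simp only [lagrangeProd]
  rw [← Fintype.prod_sum (fun j i => Polynomial.aeval (γ j) (Lagrange.basis Finset.univ z i))]
  refine Finset.prod_eq_one fun j _ => ?_
  -- The cardinalities rule out an empty set of nodes when a factor j exists.
  have hne : (Finset.univ : Finset ι).Nonempty := by
    rw [← Finset.card_pos, Finset.card_univ, ← hc]
    exact Fintype.card_pos_iff.2 ⟨j⟩
  rw [← map_sum, Lagrange.sum_basis hz.injOn hne, map_one]

omit [DecidableEq ι] in
theorem prod_sub_eq (h : ∏ j, (Polynomial.X - Polynomial.C (γ j))
      = ∏ i, (Polynomial.X - Polynomial.C (algebraMap K A (z i)))) (x : A) :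
    ∏ j, (x - γ j) = ∏ i, (x - algebraMap K A (z i)) := by
  have := congrArg (Polynomial.eval x) h
  simpa [Polynomial.eval_prod] using this

/-- Each γ_j is a root of ∏ (u - z_i), and its Lagrange basis polynomial contains all linear factors
but one. Thus the products are joint eigenvectors of the γ_j. -/
theorem mul_lagrangeProd (h : ∏ j, (Polynomial.X - Polynomial.C (γ j))
      = ∏ i, (Polynomial.X - Polynomial.C (algebraMap K A (z i)))) (g : G → ι) (j : G) :
    γ j * lagrangeProd z γ g = algebraMap K A (z (g j)) * lagrangeProd z γ g := by
  classical
  rw [← sub_eq_zero, ← sub_mul, lagrangeProd, ← Finset.mul_prod_erase _ _ (Finset.mem_univ j),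
    ← mul_assoc]
  have h1 : (γ j - algebraMap K A (z (g j)))
      * Polynomial.aeval (γ j) (Lagrange.basis Finset.univ z (g j))
      = algebraMap K A (∏ i ∈ Finset.univ.erase (g j), (z (g j) - z i)⁻¹)
        * ∏ i, (γ j - algebraMap K A (z i)) := by
    rw [← Finset.mul_prod_erase _ (fun i => γ j - algebraMap K A (z i)) (Finset.mem_univ (g j)),
      Lagrange.basis, map_prod, map_prod]
    simp only [Lagrange.basisDivisor, map_mul, map_sub, Polynomial.aeval_X, Polynomial.aeval_C,
      Finset.prod_mul_distrib]
    ring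
  rw [h1, ← prod_sub_eq h, Finset.prod_eq_zero (Finset.mem_univ j) (sub_self _), mul_zero,
    zero_mul]

/-- If z_i is not among the eigenvalues, ∏_j (z_i - γ_j) acts on the product by a unit; but this
element is zero by the relation. -/
theorem lagrangeProd_eq_zero (hz : Function.Injective z)
    (hc : Fintype.card G = Fintype.card ι)
    (h : ∏ j, (Polynomial.X - Polynomial.C (γ j))
      = ∏ i, (Polynomial.X - Polynomial.C (algebraMap K A (z i)))) {g : G → ι}
    (hg : ¬ Function.Bijective g) : lagrangeProd z γ g = 0 := by
  have hs : ¬ Function.Surjective g := fun hs =>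
    hg ((Fintype.bijective_iff_surjective_and_card g).2 ⟨hs, hc⟩)
  obtain ⟨i, hi⟩ := not_forall.1 hs
  have h1 : ∀ s : Finset G, (∏ j ∈ s, (algebraMap K A (z i) - γ j)) * lagrangeProd z γ g
      = algebraMap K A (∏ j ∈ s, (z i - z (g j))) * lagrangeProd z γ g := by
    classical
    intro s
    induction s using Finset.induction_on with
    | empty => simp
    | insert a s ha ih =>
      rw [Finset.prod_insert ha, Finset.prod_insert ha, mul_assoc, ih, map_mul, map_sub]
      linear_combination
        (-algebraMap K A (∏ j ∈ s, (z i - z (g j)))) * mul_lagrangeProd h g a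
  have h2 := h1 Finset.univ
  rw [prod_sub_eq h, Finset.prod_eq_zero (Finset.mem_univ i) (sub_self _), zero_mul] at h2
  have hu : IsUnit (algebraMap K A (∏ j, (z i - z (g j)))) := by
    refine IsUnit.map _ (isUnit_iff_ne_zero.2 (Finset.prod_ne_zero_iff.2 fun j _ => ?_))
    exact sub_ne_zero.2 fun e => hi ⟨j, (hz e).symm⟩
  exact (hu.mul_right_eq_zero).1 h2.symm

theorem aeval_mul_lagrangeProd {R : Type*} [CommRing R] [Algebra R A]
    (h : ∏ j, (Polynomial.X - Polynomial.C (γ j))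
      = ∏ i, (Polynomial.X - Polynomial.C (algebraMap K A (z i)))) (g : G → ι)
    (p : MvPolynomial G R) :
    MvPolynomial.aeval γ p * lagrangeProd z γ g
      = MvPolynomial.aeval (fun j => algebraMap K A (z (g j))) p * lagrangeProd z γ g := by
  induction p using MvPolynomial.induction_on with
  | C a => simp
  | add p q hp hq => simp only [map_add, add_mul, hp, hq]
  | mul_X p j hp =>
    simp only [map_mul, MvPolynomial.aeval_X]
    rw [mul_assoc, mul_lagrangeProd h, mul_left_comm, hp, mul_left_comm, mul_assoc]

/-- Lagrange interpolation for polynomials in several variables. -/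
theorem aeval_eq_sum_lagrangeProd {R : Type*} [CommRing R] [Algebra R A] [DecidableEq G]
    (hz : Function.Injective z) (hc : Fintype.card G = Fintype.card ι)
    (h : ∏ j, (Polynomial.X - Polynomial.C (γ j))
      = ∏ i, (Polynomial.X - Polynomial.C (algebraMap K A (z i)))) (p : MvPolynomial G R) :
    MvPolynomial.aeval γ p
      = ∑ e : G ≃ ι, MvPolynomial.aeval (fun j => algebraMap K A (z (e j))) p
        * lagrangeProd z γ e := by
  classical
  have h1 : MvPolynomial.aeval γ p = ∑ g : G → ι,
      MvPolynomial.aeval (fun j => algebraMap K A (z (g j))) p * lagrangeProd z γ g := by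
    rw [← Finset.sum_congr rfl fun g _ => aeval_mul_lagrangeProd h g p, ← Finset.mul_sum,
      sum_lagrangeProd hz hc, mul_one]
  rw [h1]
  refine (Finset.sum_of_injOn (fun e : G ≃ ι => (e : G → ι)) ?_ ?_ ?_ ?_).symm
  · exact fun a _ b _ hab => DFunLike.coe_injective hab
  · exact fun _ _ => Finset.mem_coe.2 (Finset.mem_univ _)
  · intro g _ hg
    rw [lagrangeProd_eq_zero hz hc h, mul_zero]
    exact fun hb => hg ⟨Equiv.ofBijective g hb, by simp, rfl⟩
  · exact fun _ _ => rfl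

end Lagrange

/-! ### Averages over `S_k × S_{n-k}` -/

section Average
variable {n k : ℕ}

/-- Permutations of `Γ` that preserve the set of the `γ_{1,*}` come from pairs of
permutations. -/
theorem exists_eq_fixedPt_comp (I : Sub n k) (e : Gam n k → Fin n) (he : Function.Bijective e)
    (h : ∀ r, e (Sum.inl r) ∈ I.1) :
    ∃ (σ : Equiv.Perm (Fin k)) (τ : Equiv.Perm (Fin (n - k))), ∀ g,
      e g = fixedPt I (Sum.map σ τ g) := by
  let π : Equiv.Perm (Gam n k) := (Equiv.ofBijective e he).trans (fixedEquiv I).symm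
  have hπ : ∀ g, fixedPt I (π g) = e g := by
    intro g
    rw [← fixedEquiv_apply]
    exact (fixedEquiv I).apply_symm_apply _
  have h1 : Set.MapsTo π (Set.range Sum.inl) (Set.range Sum.inl) := by
    rintro _ ⟨r, rfl⟩
    have h2 : (π (Sum.inl r)).isLeft := by
      rw [← fixedPt_mem_iff I, hπ]
      exact h r
    obtain ⟨s, hs⟩ := Sum.isLeft_iff.1 h2
    exact ⟨s, hs.symm⟩
  obtain ⟨⟨σ, τ⟩, hst⟩ := Equiv.Perm.mem_sumCongrHom_range_of_perm_mapsTo_inl h1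
  refine ⟨σ, τ, fun g => ?_⟩
  rw [← hπ, ← hst]
  rfl

/-- The average over `S_k × S_{n-k}`. -/
def avg (n k : ℕ) : PolyGzy n k →ₗ[PolyZY n] InvT n k :=
  LinearMap.codRestrict (Subalgebra.toSubmodule (InvT n k))
    ((MvPolynomial.C ((Fintype.card (Equiv.Perm (Fin k) × Equiv.Perm (Fin (n - k))) : ℂ)⁻¹)
        : PolyZY n) •
      ∑ p : Equiv.Perm (Fin k) × Equiv.Perm (Fin (n - k)),
        (MvPolynomial.rename (Sum.map p.1 p.2) : PolyGzy n k →ₐ[PolyZY n] PolyGzy n k).toLinearMap)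
    (by
      intro f σ τ
      simp only [LinearMap.smul_apply, LinearMap.sum_apply, AlgHom.toLinearMap_apply, map_smul,
        map_sum, MvPolynomial.rename_rename]
      congr 1
      exact Fintype.sum_equiv ((Equiv.mulLeft σ).prodCongr (Equiv.mulLeft τ)) _ _ fun p => by
        congr 1
        congr 1
        funext g
        rcases g with g | g <;> rfl)

theorem avg_apply (f : PolyGzy n k) :
    (avg n k f : PolyGzy n k)
      = (MvPolynomial.C ((Fintype.card (Equiv.Perm (Fin k) × Equiv.Perm (Fin (n - k))) : ℂ)⁻¹)
        : PolyZY n) • ∑ p : Equiv.Perm (Fin k) × Equiv.Perm (Fin (n - k)),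
          MvPolynomial.rename (Sum.map p.1 p.2) f := by
  refine (LinearMap.codRestrict_apply _ _ _).trans ?_
  simp only [LinearMap.smul_apply, LinearMap.sum_apply, AlgHom.toLinearMap_apply]

/-- Linearity over the invariants is what lets averaging carry the relations of the full polynomial
ring into `relT`. -/
theorem avg_mul_inv (f : PolyGzy n k) (r : InvT n k) : avg n k (f * r) = avg n k f * r := by
  apply Subtype.ext
  rw [Subalgebra.coe_mul, avg_apply, avg_apply, smul_mul_assoc, Finset.sum_mul]
  congr 1
  refine Finset.sum_congr rfl fun p _ => ?_
  rw [map_mul, r.2 p.1 p.2]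

theorem avg_one : avg n k 1 = 1 := by
  apply Subtype.ext
  rw [avg_apply]
  simp only [map_one, Finset.sum_const, Finset.card_univ, Subalgebra.coe_one]
  rw [← Nat.cast_smul_eq_nsmul (PolyZY n), smul_smul,
    ← map_natCast (MvPolynomial.C : ℂ →+* PolyZY n), ← map_mul, inv_mul_cancel₀, map_one, one_smul]
  exact Nat.cast_ne_zero.2 Fintype.card_ne_zero

theorem avg_inv (r : InvT n k) : avg n k r = r := by
  have := avg_mul_inv (1 : PolyGzy n k) r
  rwa [one_mul, avg_one, one_mul] at this

theorem relPoly_map_rename (σ : Equiv.Perm (Fin k)) (τ : Equiv.Perm (Fin (n - k))) :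
    (relPoly n k).map (MvPolynomial.rename (Sum.map σ τ) :
      PolyGzy n k →ₐ[PolyZY n] PolyGzy n k).toRingHom = relPoly n k := by
  rw [relPoly, Polynomial.map_sub, Polynomial.map_mul, Polynomial.map_prod, Polynomial.map_prod,
    Polynomial.map_prod]
  simp only [Polynomial.map_sub, Polynomial.map_X, Polynomial.map_C, AlgHom.toRingHom_eq_coe,
    RingHom.coe_coe, MvPolynomial.rename_X, MvPolynomial.rename_C, Sum.map_inl, Sum.map_inr]
  rw [Equiv.prod_comp σ fun i => (Polynomial.X - Polynomial.C (MvPolynomial.X (Sum.inl i)) :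
      Polynomial (PolyGzy n k)),
    Equiv.prod_comp τ fun i => (Polynomial.X - Polynomial.C (MvPolynomial.X (Sum.inr i)) :
      Polynomial (PolyGzy n k))]

/-- The coefficients of `relPoly` as invariant polynomials. -/
def relCoeff (n k j : ℕ) : InvT n k :=
  ⟨(relPoly n k).coeff j, fun σ τ => by
    have := congrArg (fun p => Polynomial.coeff p j) (relPoly_map_rename (n := n) (k := k) σ τ)
    rwa [Polynomial.coeff_map] at this⟩

/-- The class in cohomology of the average of a polynomial. -/
def avgClass (n k : ℕ) : PolyGzy n k →ₗ[PolyZY n] HT n k :=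
  (Ideal.Quotient.mkₐ (PolyZY n) (relT n k)).toLinearMap ∘ₗ avg n k

/-- The class of an invariant polynomial. -/
def classT (f : InvT n k) : HT n k := Ideal.Quotient.mk (relT n k) f

theorem avgClass_inv (r : InvT n k) : avgClass n k r = classT r :=
  congrArg (Ideal.Quotient.mk (relT n k)) (avg_inv r)

theorem avgClass_mul_relPoly (f : PolyGzy n k) (j : ℕ) :
    avgClass n k (f * (relPoly n k).coeff j) = 0 := by
  have h : avg n k (f * (relPoly n k).coeff j) = avg n k f * relCoeff n k j :=
    avg_mul_inv f (relCoeff n k j)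
  change Ideal.Quotient.mk (relT n k) (avg n k (f * (relPoly n k).coeff j)) = 0
  rw [h, Ideal.Quotient.eq_zero_iff_mem]
  exact Ideal.mul_mem_left _ _ (Ideal.subset_span ⟨j, rfl⟩)

theorem Loc_classT (I : Sub n k) (f : InvT n k) : Loc I (classT f) = subst I (f : PolyGzy n k) :=
  rfl

theorem LocL_tmul (I : Sub n k) (a : Lfull n) (x : HT n k) :
    LocL I (a ⊗ₜ x) = a * algebraMap (PolyZY n) (Lfull n) (Loc I x) := by
  rw [LocL, LinearMap.comp_apply, LinearMap.baseChange_tmul]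
  change TensorProduct.AlgebraTensorModule.rid (PolyZY n) (Lfull n) (Lfull n) (a ⊗ₜ Loc I x) = _
  rw [TensorProduct.AlgebraTensorModule.rid_tmul, Algebra.smul_def, mul_comm]

end Average

/-! ### Localization at the fixed points -/

section Interpolation
variable {R K L T M G ι : Type*} [CommRing R] [Field K] [CommRing L] [CommRing T] [AddCommGroup M]
  [Module L M] [Algebra R K] [Algebra K L] [Algebra R L] [IsScalarTower R K L] [Algebra R T]
  [Algebra L T] [IsScalarTower R L T] [Fintype G] [Fintype ι]

/-- The polynomial `∏ (u - γ_j) - ∏ (u - z_i)`. -/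
def relGen (G : Type*) [Fintype G] (z : ι → R) : Polynomial (MvPolynomial G R) :=
  ∏ j, (Polynomial.X - Polynomial.C (MvPolynomial.X j))
    - ∏ i, (Polynomial.X - Polynomial.C (MvPolynomial.C (z i)))

theorem prod_of_relGen (K : Type*) [Field K] [Algebra R K] [Algebra K T] [IsScalarTower R K T]
    (z : ι → R) (s : MvPolynomial G R →ₐ[R] T) (hs : ∀ j, s ((relGen G z).coeff j) = 0) :
    ∏ j, (Polynomial.X - Polynomial.C (s (MvPolynomial.X j)))
      = ∏ i, (Polynomial.X - Polynomial.C (algebraMap K T (algebraMap R K (z i)))) := by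
  have h : (relGen G z).map s.toRingHom = 0 := by
    ext j
    rw [Polynomial.coeff_map, Polynomial.coeff_zero]
    exact hs j
  rw [relGen, Polynomial.map_sub, Polynomial.map_prod, Polynomial.map_prod, sub_eq_zero] at h
  simp only [Polynomial.map_sub, Polynomial.map_X, Polynomial.map_C, AlgHom.toRingHom_eq_coe,
    RingHom.coe_coe] at h
  rw [h]
  refine Finset.prod_congr rfl fun i _ => ?_
  rw [← IsScalarTower.algebraMap_apply]
  exact congrArg (fun x => Polynomial.X - Polynomial.C x) (s.commutes (z i))

/-- Modulo the relations `relGen`, a polynomial is determined by its values at the bijections. -/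
theorem exists_interpolation (K : Type*) [Field K] [Algebra R K] [Algebra K L]
    [IsScalarTower R K L] [DecidableEq G] [DecidableEq ι] (z : ι → R)
    (hz : Function.Injective fun i => algebraMap R K (z i))
    (hc : Fintype.card G = Fintype.card ι) (s : MvPolynomial G R →ₐ[R] T) (φ : T →ₗ[L] M)
    (hφ : ∀ t j, φ (t * s ((relGen G z).coeff j)) = 0) :
    ∃ m : G ≃ ι → M, ∀ p : MvPolynomial G R, φ (s p)
      = ∑ e : G ≃ ι, algebraMap R L (MvPolynomial.aeval (fun j => z (e j)) p) • m e := by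
  let I : Ideal T := Ideal.span (Set.range fun j => s ((relGen G z).coeff j))
  have hI : ∀ x ∈ I, φ x = 0 := by
    intro x hx
    obtain ⟨c, rfl⟩ := (Finsupp.mem_ideal_span_range_iff_exists_finsupp).1 hx
    rw [Finsupp.sum, map_sum]
    exact Finset.sum_eq_zero fun j _ => hφ _ _
  -- Lagrange polynomials divide by differences of nodes, so the quotient is viewed over K by way of
  -- L.
  let _ : Algebra K (T ⧸ I) := ((algebraMap L (T ⧸ I)).comp (algebraMap K L)).toAlgebra
  have hK : ∀ r : R, algebraMap K (T ⧸ I) (algebraMap R K r) = algebraMap R (T ⧸ I) r := by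
    intro r
    rw [RingHom.algebraMap_toAlgebra, RingHom.comp_apply, ← IsScalarTower.algebraMap_apply R K L,
      ← IsScalarTower.algebraMap_apply R L (T ⧸ I)]
  have : IsScalarTower R K (T ⧸ I) := IsScalarTower.of_algebraMap_eq fun r => (hK r).symm
  let q : MvPolynomial G R →ₐ[R] T ⧸ I := (Ideal.Quotient.mkₐ R I).comp s
  have hγ := prod_of_relGen K z q fun j =>
    Ideal.Quotient.eq_zero_iff_mem.2 (Ideal.subset_span ⟨j, rfl⟩)
  -- Lifts of the Lagrange products; the choice is immaterial because φ kills the ideal.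
  choose E hE using fun e : G ≃ ι => Ideal.Quotient.mk_surjective (I := I)
    (lagrangeProd (fun i => algebraMap R K (z i)) (fun j => q (MvPolynomial.X j)) e)
  refine ⟨fun e => φ (E e), fun p => ?_⟩
  have h1 := aeval_eq_sum_lagrangeProd hz hc hγ p
  have hq : q p = MvPolynomial.aeval (fun j => q (MvPolynomial.X j)) p :=
    DFunLike.congr_fun (MvPolynomial.aeval_unique q) p
  rw [← hq] at h1
  have h2 : s p - ∑ e : G ≃ ι,
      algebraMap R L (MvPolynomial.aeval (fun j => z (e j)) p) • E e ∈ I := by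
    rw [← Ideal.Quotient.eq_zero_iff_mem, map_sub, sub_eq_zero, map_sum]
    refine h1.trans (Finset.sum_congr rfl fun e _ => ?_)
    rw [← hE, Algebra.smul_def, map_mul]
    congr 1
    simp only [hK]
    refine (MvPolynomial.aeval_algebraMap_apply (T ⧸ I) (fun j => z (e j)) p).trans ?_
    rw [IsScalarTower.algebraMap_apply R L (T ⧸ I)]
    rfl
  have h3 := hI _ h2
  rw [map_sub, map_sum, sub_eq_zero] at h3
  simpa only [map_smul] using h3

end Interpolation

section Localization
variable {n k : ℕ}

theorem relPoly_eq_relGen :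
    relPoly n k = relGen (Gam n k) (fun i : Fin n => (MvPolynomial.X (some i) : PolyZY n)) := by
  rw [relPoly, relGen, Fintype.prod_sum_type]

theorem card_Gam (hk : k ≤ n) : Fintype.card (Gam n k) = Fintype.card (Fin n) := by
  simp [hk]

/-- The average after extension of coefficients. -/
def avgExt (n k : ℕ) : Lfull n ⊗[PolyZY n] PolyGzy n k →ₗ[Lfull n] Lfull n ⊗[PolyZY n] HT n k :=
  (avgClass n k).baseChange (Lfull n)

theorem avgExt_mul_relPoly (t : Lfull n ⊗[PolyZY n] PolyGzy n k) (j : ℕ) :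
    avgExt n k (t * (1 : Lfull n) ⊗ₜ[PolyZY n] (relPoly n k).coeff j) = 0 := by
  induction t using TensorProduct.induction_on with
  | zero => rw [zero_mul, map_zero]
  | tmul a p =>
    rw [Algebra.TensorProduct.tmul_mul_tmul, avgExt, LinearMap.baseChange_tmul,
      avgClass_mul_relPoly, TensorProduct.tmul_zero]
  | add a b ha hb => rw [add_mul, map_add, ha, hb, add_zero]

/-- The set of indices of the variables `z` that are substituted for the `γ_{1,*}`. -/
def leftSet (e : Gam n k ≃ Fin n) : Sub n k :=
  ⟨Finset.univ.map ⟨fun r : Fin k => e (Sum.inl r), fun _ _ h => Sum.inl_injective (e.injective h)⟩,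
    by rw [Finset.card_map, Finset.card_univ, Fintype.card_fin]⟩

/-- Invariance under S_k × S_{n-k} makes the value depend only on which z are substituted for the
γ_{1,*}. -/
theorem aeval_equiv_eq_subst (e : Gam n k ≃ Fin n) (f : InvT n k) :
    MvPolynomial.aeval (fun j => (MvPolynomial.X (some (e j)) : PolyZY n)) (f : PolyGzy n k)
      = subst (leftSet e) (f : PolyGzy n k) := by
  obtain ⟨σ, τ, h⟩ := exists_eq_fixedPt_comp (leftSet e) e e.bijective fun r =>
    Finset.mem_map_of_mem _ (Finset.mem_univ r)
  conv_rhs => rw [← f.2 σ τ]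
  rw [subst, MvPolynomial.aeval_rename]
  congr 2
  funext g
  rw [h]
  rfl

/-- Single Lagrange products need not be invariant. The interpolation is therefore done for all
polynomials in Γ, and averaging transports it to cohomology. -/
theorem exists_avgExt_eq_sum (hk : k ≤ n) :
    ∃ m : (Gam n k ≃ Fin n) → Lfull n ⊗[PolyZY n] HT n k, ∀ p : PolyGzy n k,
      (1 : Lfull n) ⊗ₜ[PolyZY n] avgClass n k p = ∑ e : Gam n k ≃ Fin n,
        algebraMap (PolyZY n) (Lfull n)
          (MvPolynomial.aeval (fun j => (MvPolynomial.X (some (e j)) : PolyZY n)) p) • m e := by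
  have hz : Function.Injective fun i : Fin n =>
      algebraMap (PolyZY n) (FieldZY n) (MvPolynomial.X (some i)) :=
    (IsFractionRing.injective (PolyZY n) (FieldZY n)).comp
      ((MvPolynomial.X_injective).comp (Option.some_injective _))
  exact exists_interpolation (L := Lfull n) (FieldZY n)
    (fun i : Fin n => (MvPolynomial.X (some i) : PolyZY n)) hz (card_Gam hk)
    (Algebra.TensorProduct.includeRight : PolyGzy n k →ₐ[PolyZY n] Lfull n ⊗[PolyZY n] PolyGzy n k)
    (avgExt n k) (fun t j => by
      rw [← relPoly_eq_relGen]; exact avgExt_mul_relPoly t j)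

theorem tmul_classT (a : Lfull n) (f : InvT n k) :
    a ⊗ₜ[PolyZY n] classT f = a • ((1 : Lfull n) ⊗ₜ[PolyZY n] classT f) := by
  rw [TensorProduct.smul_tmul', smul_eq_mul, mul_one]

theorem exists_eq_sum_LocL_leftSet (hk : k ≤ n) :
    ∃ m : (Gam n k ≃ Fin n) → Lfull n ⊗[PolyZY n] HT n k,
      ∀ x, x = ∑ e, LocL (leftSet e) x • m e := by
  obtain ⟨m, hm⟩ := exists_avgExt_eq_sum (n := n) hk
  refine ⟨m, fun x => ?_⟩
  have h1 : ∀ f : InvT n k, (1 : Lfull n) ⊗ₜ[PolyZY n] classT f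
      = ∑ e, LocL (leftSet e) ((1 : Lfull n) ⊗ₜ[PolyZY n] classT f) • m e := by
    intro f
    have := hm f
    rw [avgClass_inv] at this
    refine this.trans (Finset.sum_congr rfl fun e _ => ?_)
    rw [LocL_tmul, one_mul, Loc_classT, aeval_equiv_eq_subst]
  induction x using TensorProduct.induction_on with
  | zero =>
    refine (Finset.sum_eq_zero fun e _ => ?_).symm
    rw [map_zero, zero_smul]
  | tmul a y =>
    obtain ⟨f, rfl⟩ : ∃ f, classT f = y := Ideal.Quotient.mk_surjective y
    rw [tmul_classT]
    conv_lhs => rw [h1, Finset.smul_sum]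
    refine Finset.sum_congr rfl fun e _ => ?_
    rw [map_smul, smul_assoc]
  | add a b ha hb =>
    conv_lhs => rw [ha, hb, ← Finset.sum_add_distrib]
    refine Finset.sum_congr rfl fun e _ => ?_
    rw [map_add, add_smul]

/-- Bijections with the same left set give the same restriction, so their terms are collected.
Injectivity of localization is immediate from this form. -/
theorem exists_eq_sum_LocL (hk : k ≤ n) : ∃ m : Sub n k → Lfull n ⊗[PolyZY n] HT n k,
    ∀ x, x = ∑ I, LocL I x • m I := by
  obtain ⟨m, hm⟩ := exists_eq_sum_LocL_leftSet (n := n) hk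
  refine ⟨fun I => ∑ e ∈ Finset.univ.filter (fun e => leftSet e = I), m e, fun x => ?_⟩
  refine (hm x).trans ?_
  rw [← Finset.sum_fiberwise Finset.univ leftSet]
  refine Finset.sum_congr rfl fun I _ => ?_
  rw [Finset.smul_sum]
  refine Finset.sum_congr rfl fun e he => ?_
  rw [(Finset.mem_filter.1 he).2]

theorem LocL_injective (hk : k ≤ n) {x x' : Lfull n ⊗[PolyZY n] HT n k}
    (h : ∀ I, LocL I x = LocL I x') : x = x' := by
  obtain ⟨m, hm⟩ := exists_eq_sum_LocL (n := n) hk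
  rw [hm x, hm x']
  exact Finset.sum_congr rfl fun I _ => by rw [h]

/-- The polynomial `∏_r ∏_{b ∉ I} (γ_{1,r} - z_b)`. -/
def interpPoly (I : Sub n k) : InvT n k :=
  ⟨∏ r : Fin k, ∏ b ∈ I.1ᶜ, (MvPolynomial.X (Sum.inl r)
    - MvPolynomial.C (MvPolynomial.X (some b))), fun σ τ => by
      simp only [map_prod, map_sub, MvPolynomial.rename_X, MvPolynomial.rename_C, Sum.map_inl]
      exact Equiv.prod_comp σ fun r => ∏ b ∈ I.1ᶜ, (MvPolynomial.X (Sum.inl r)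
        - MvPolynomial.C (MvPolynomial.X (some b)) : PolyGzy n k)⟩

theorem subst_interpPoly (I J : Sub n k) :
    subst J (interpPoly I : PolyGzy n k)
      = ∏ a ∈ J.1, ∏ b ∈ I.1ᶜ, (MvPolynomial.X (some a) - MvPolynomial.X (some b)) := by
  refine Eq.trans ?_ (prod_orderEmbOfFin J.1 J.2 fun a => ∏ b ∈ I.1ᶜ,
    (MvPolynomial.X (some a) - MvPolynomial.X (some b) : PolyZY n))
  simp [interpPoly, subst, fixedPt]

theorem coe_algebraMap_PolyZY (p : PolyZY n) :
    (algebraMap (PolyZY n) (Lfull n) p : RatK n) = algebraMap (PolyZY n) (RatK n) p := rfl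

theorem coe_LocL_interpPoly_self (I : Sub n k) (a : Lfull n) :
    (LocL I (a ⊗ₜ classT (interpPoly I)) : RatK n) = a * RI I := by
  rw [LocL_tmul, Loc_classT, subst_interpPoly, Subalgebra.coe_mul, coe_algebraMap_PolyZY, map_prod,
    RI]
  simp only [map_prod, map_sub, zK]

/-- An index of `J` outside `I` produces a factor z_a - z_a. -/
theorem LocL_interpPoly_of_ne {I J : Sub n k} (h : J ≠ I) (a : Lfull n) :
    LocL J (a ⊗ₜ classT (interpPoly I)) = 0 := by
  have h1 : ¬ J.1 ⊆ I.1 := fun hs =>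
    h (Subtype.ext (Finset.eq_of_subset_of_card_le hs (by rw [I.2, J.2])))
  obtain ⟨a, ha, hb⟩ := Finset.not_subset.1 h1
  rw [LocL_tmul, Loc_classT, subst_interpPoly, Finset.prod_eq_zero ha
    (Finset.prod_eq_zero (Finset.mem_compl.2 hb) (sub_self _)), map_zero, mul_zero]

theorem inv_algebraMap_mem_Lfull (p : PolyZY n) :
    (algebraMap (PolyZY n) (RatK n) p)⁻¹ ∈ Lfull n := by
  rw [IsScalarTower.algebraMap_apply (PolyZY n) (FieldZY n) (RatK n), ← map_inv₀]
  exact (Lfull n).algebraMap_mem _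

theorem inv_RI_mem_Lfull (I : Sub n k) : (RI I)⁻¹ ∈ Lfull n := by
  have : RI I = algebraMap (PolyZY n) (RatK n)
      (∏ a ∈ I.1, ∏ b ∈ I.1ᶜ, (MvPolynomial.X (some a) - MvPolynomial.X (some b))) := by
    simp only [map_prod, map_sub, RI, zK]
  rw [this]
  exact inv_algebraMap_mem_Lfull _

/-- The interpolation class of `J` restricts to R_J at x_J and to zero elsewhere, and R_J is
invertible in `Lfull n`. -/
theorem LocL_surjective (g : Sub n k → Lfull n) :
    ∃ x : Lfull n ⊗[PolyZY n] HT n k, ∀ I, LocL I x = g I := by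
  refine ⟨∑ J, (g J * ⟨(RI J)⁻¹, inv_RI_mem_Lfull J⟩) ⊗ₜ classT (interpPoly J), fun I => ?_⟩
  rw [map_sum, Finset.sum_eq_single I, ← SetLike.coe_eq_coe, coe_LocL_interpPoly_self]
  · exact inv_mul_cancel_right₀ (RI_ne_zero I) _
  · exact fun J _ hJ => LocL_interpPoly_of_ne hJ.symm _
  · simp

/-- Restriction to the fixed points, with coefficients in `𝓛_{λ,(z,y)}`. -/
def locEquiv (hk : k ≤ n) : (Lfull n ⊗[PolyZY n] HT n k) ≃ₗ[Lfull n] (Sub n k → Lfull n) :=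
  LinearEquiv.ofBijective (LinearMap.pi LocL)
    ⟨fun _ _ h => LocL_injective hk fun I => congrFun h I,
      fun g => (LocL_surjective g).imp fun _ h => funext h⟩

theorem locEquiv_apply (hk : k ≤ n) (x : Lfull n ⊗[PolyZY n] HT n k) (I : Sub n k) :
    locEquiv hk x I = LocL I x := rfl

end Localization

/-! ### Equivariant families -/

section Families
variable {n k : ℕ}

/-- The substitution `Γ ↦ z_I` commutes with permutations up to `S_k × S_{n-k}`. -/
theorem exists_comp_fixedPt (ρ : Equiv.Perm (Fin n)) (I : Sub n k) :
    ∃ (σ : Equiv.Perm (Fin k)) (τ : Equiv.Perm (Fin (n - k))), ∀ g,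
      ρ (fixedPt I g) = fixedPt (permSub ρ I) (Sum.map σ τ g) := by
  refine exists_eq_fixedPt_comp (permSub ρ I) (fun g => ρ (fixedPt I g)) ?_ fun r => ?_
  · have : (fun g => ρ (fixedPt I g)) = ρ ∘ fixedEquiv I := by
      funext g
      rw [Function.comp_apply, fixedEquiv_apply]
    rw [this]
    exact ρ.bijective.comp (fixedEquiv I).bijective
  · rw [permSub, mem_permSet, Equiv.symm_apply_apply, fixedPt_mem_iff]
    rfl

theorem aeval_mem_Az {ι : Type*} {v : ι → RatK n} (hv : ∀ i, v i ∈ Az n)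
    (f : MvPolynomial ι (Lsmall n)) : MvPolynomial.aeval v f ∈ Az n := by
  induction f using MvPolynomial.induction_on with
  | C a => rw [MvPolynomial.aeval_C]; exact (Az n).algebraMap_mem a
  | add p q hp hq => rw [map_add]; exact add_mem hp hq
  | mul_X p i hp => rw [map_mul, MvPolynomial.aeval_X]; exact mul_mem hp (hv i)

theorem permK_aeval {ι : Type*} (σ : Equiv.Perm (Fin n)) (v : ι → RatK n)
    (f : MvPolynomial ι (Lsmall n)) :
    permK σ (MvPolynomial.aeval v f) = MvPolynomial.aeval (fun i => permK σ (v i)) f := by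
  induction f using MvPolynomial.induction_on with
  | C a =>
    rw [MvPolynomial.aeval_C, MvPolynomial.aeval_C]
    exact permK_of_mem_Lsmall σ a.2
  | add p q hp hq => rw [map_add, map_add, map_add, hp, hq]
  | mul_X p i hp => rw [map_mul, map_mul, map_mul, hp, MvPolynomial.aeval_X, MvPolynomial.aeval_X]

theorem isInvFam_evalGz {f : MvPolynomial (Gam n k ⊕ Fin n) (Lsmall n)} (hf : IsInvGz f) :
    IsInvFam fun I : Sub n k => evalGz I f := by
  refine ⟨fun I => aeval_mem_Az (fun i => ?_) f, fun ρ I => ?_⟩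
  · rcases i with g | a <;> exact zK_mem_Az _
  · obtain ⟨σ, τ, h⟩ := exists_comp_fixedPt ρ I
    change permK ρ (evalGz I f) = evalGz (permSub ρ I) f
    conv_rhs => rw [← hf σ τ ρ]
    simp only [evalGz]
    rw [permK_aeval, MvPolynomial.aeval_rename]
    congr 2
    funext i
    rcases i with g | a
    · simp [h]
    · simp

/-- The permutation that takes one fixed point to another, with a given permutation in each
block. -/
def transPerm (I J : Sub n k) (p : Equiv.Perm (Fin k) × Equiv.Perm (Fin (n - k))) :
    Equiv.Perm (Fin n) :=
  (fixedEquiv I).symm.trans ((Equiv.sumCongr p.1 p.2).trans (fixedEquiv J))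

theorem transPerm_apply (I J : Sub n k) (p : Equiv.Perm (Fin k) × Equiv.Perm (Fin (n - k)))
    (a : Fin n) : transPerm I J p a = fixedPt J (Sum.map p.1 p.2 ((fixedEquiv I).symm a)) := by
  rw [← fixedEquiv_apply]
  rfl

theorem permSub_transPerm (I J : Sub n k)
    (p : Equiv.Perm (Fin k) × Equiv.Perm (Fin (n - k))) : permSub (transPerm I J p) I = J := by
  have h : (permSub (transPerm I J p) I).1 ⊆ J.1 := by
    intro a ha
    obtain ⟨b, hb, rfl⟩ := Finset.mem_map.1 ha
    change transPerm I J p b ∈ J.1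
    rw [transPerm_apply, fixedPt_mem_iff, Sum.isLeft_map, ← fixedPt_mem_iff I, ← fixedEquiv_apply,
      Equiv.apply_symm_apply]
    exact hb
  exact Subtype.ext (Finset.eq_of_subset_of_card_le h (by rw [J.2, (permSub _ I).2]))

theorem exists_aeval_of_mem_Az {x : RatK n} (h : x ∈ Az n) :
    ∃ p : MvPolynomial (Fin n) (Lsmall n), MvPolynomial.aeval (zK n) p = x := by
  rw [Az, Algebra.adjoin_range_eq_range_aeval] at h
  exact h

/-- The inverse of the order of `S_k × S_{n-k}`. -/
def invOrder (n k : ℕ) : ℂ :=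
  (Fintype.card (Equiv.Perm (Fin k) × Equiv.Perm (Fin (n - k))) : ℂ)⁻¹

theorem invOrder_mul_card {A : Type*} [CommRing A] [Algebra ℂ A] (x : A) :
    algebraMap ℂ A (invOrder n k)
      * ∑ _p : Equiv.Perm (Fin k) × Equiv.Perm (Fin (n - k)), x = x := by
  rw [Finset.sum_const, Finset.card_univ, nsmul_eq_mul, ← mul_assoc,
    ← map_natCast (algebraMap ℂ A), ← map_mul, invOrder, inv_mul_cancel₀, map_one, one_mul]
  exact Nat.cast_ne_zero.2 Fintype.card_ne_zero

/-- The average over `S_k × S_{n-k}` of the values of a polynomial in `z` at a fixed point. -/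
def avgFam (I₀ : Sub n k) (p : MvPolynomial (Fin n) (Lsmall n)) (I : Sub n k) : RatK n :=
  algebraMap ℂ (RatK n) (invOrder n k)
    * ∑ w, permK (transPerm I₀ I w) (MvPolynomial.aeval (zK n) p)

/-- Every `transPerm I₀ I w` carries `I₀` to `I`, so by equivariance all summands equal `g I`. A
family is thus recovered from one polynomial value. -/
theorem IsInvFam.eq_avgFam {g : Sub n k → RatK n} (hg : IsInvFam g) {I₀ : Sub n k}
    {p : MvPolynomial (Fin n) (Lsmall n)} (hp : MvPolynomial.aeval (zK n) p = g I₀) (I : Sub n k) :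
    avgFam I₀ p I = g I := by
  rw [avgFam, hp]
  simp only [hg.2, permSub_transPerm]
  exact invOrder_mul_card _

/-- The variables z of `p` are renamed to the γ that they replace at `I₀`, and the result is
averaged. No z is left, so S_n-invariance is automatic. -/
theorem exists_evalGz_eq_avgFam (I₀ : Sub n k) (p : MvPolynomial (Fin n) (Lsmall n)) :
    ∃ f : MvPolynomial (Gam n k ⊕ Fin n) (Lsmall n), IsInvGz f ∧ ∀ I, evalGz I f = avgFam I₀ p I := by
  refine ⟨algebraMap ℂ (Lsmall n) (invOrder n k) •
    ∑ w : Equiv.Perm (Fin k) × Equiv.Perm (Fin (n - k)),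
      MvPolynomial.rename (fun a => Sum.inl (Sum.map w.1 w.2 ((fixedEquiv I₀).symm a))) p,
    fun σ τ ρ => ?_, fun I => ?_⟩
  · rw [map_smul, map_sum]
    congr 1
    refine Fintype.sum_equiv ((Equiv.mulLeft σ).prodCongr (Equiv.mulLeft τ)) _ _ fun w => ?_
    rw [MvPolynomial.rename_rename]
    congr 2
    funext a
    simp only [Function.comp_apply, Sum.map_inl, Sum.map_map]
    rfl
  · rw [evalGz, map_smul, map_sum, avgFam, Algebra.smul_def]
    congr 1
    refine Finset.sum_congr rfl fun w _ => ?_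
    rw [MvPolynomial.aeval_rename, permK_aeval]
    congr 2
    funext a
    simp only [Function.comp_apply, Sum.elim_inl, permK_zK, transPerm_apply]

theorem isInvFam_iff_exists_evalGz (hk : k ≤ n) {g : Sub n k → RatK n} :
    IsInvFam g ↔ ∃ f : MvPolynomial (Gam n k ⊕ Fin n) (Lsmall n), IsInvGz f ∧
      g = fun I => evalGz I f := by
  constructor
  · intro h
    obtain ⟨p, hp⟩ := exists_aeval_of_mem_Az (h.1 (topSub hk))
    obtain ⟨f, hf, hfg⟩ := exists_evalGz_eq_avgFam (topSub hk) p
    exact ⟨f, hf, funext fun I => by rw [hfg, h.eq_avgFam hp]⟩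
  · rintro ⟨f, hf, rfl⟩
    exact isInvFam_evalGz hf

theorem mem_Vk_iff (hk : k ≤ n) {ζ : V n} :
    ζ ∈ Vk n k ↔ ∃ g : Sub n k → RatK n, IsInvFam g ∧ coords ζ = famVec g := by
  constructor
  · rintro ⟨f, hf, h⟩
    exact ⟨_, isInvFam_evalGz hf, funext h⟩
  · rintro ⟨g, hg, h⟩
    obtain ⟨f, hf, rfl⟩ := (isInvFam_iff_exists_evalGz hk).1 hg
    exact ⟨f, hf, fun J => congrFun h J⟩

theorem mem_Vsub_iff {ζ : V n} : ζ ∈ Vsub n ↔ IsInvVec (coords ζ) := by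
  constructor
  · intro h
    refine Submodule.iSup_induction _ (motive := fun ζ => IsInvVec (coords ζ)) h
      (fun k ζ hζ => ?_) IsInvVec.zero fun ζ η hζ hη => hζ.add hη
    obtain ⟨g, hg, e⟩ := (mem_Vk_iff (Nat.lt_succ_iff.1 k.2)).1 hζ
    rw [e]
    exact hg.isInvVec
  · intro h
    let comp : Fin (n + 1) → V n := fun k K => if K.card = k then ζ K else 0
    have h1 : ζ = ∑ k, comp k := by
      funext K
      have hK : K.card < n + 1 := by
        have := Finset.card_le_univ K
        rw [Fintype.card_fin] at this
        omega
      rw [Finset.sum_apply, Finset.sum_eq_single (⟨K.card, hK⟩ : Fin (n + 1))]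
      · exact (if_pos rfl).symm
      · intro b _ hb
        exact if_neg fun e => hb (Fin.ext e.symm)
      · simp
    rw [h1]
    refine sum_mem fun k _ => Submodule.mem_iSup_of_mem k ?_
    refine (mem_Vk_iff (Nat.lt_succ_iff.1 k.2)).2 ⟨_, (isInvVec_iff.1 h) k, funext fun K => ?_⟩
    rw [famVec_locSum]
    change ((if K.card = (k : ℕ) then ζ K else 0 : Lfull n) : RatK n) = _
    split_ifs <;> rfl

end Families

/-! ### The equivariant cohomology for `GL_n × ℂ^×` -/

section Equivariant
variable {n k : ℕ}

/-- Permuting z leaves the coefficients of f alone and moves only the substituted values. The change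
of order inside the two blocks is absorbed by invariance in Γ. -/
theorem permPoly_subst {f : PolyGzy n k} (hf : f ∈ InvGL n k) (ρ : Equiv.Perm (Fin n))
    (I : Sub n k) : permPoly ρ (subst I f) = subst (permSub ρ I) f := by
  obtain ⟨h1, h2⟩ := hf
  have hz : permZ n k ρ f = f := (Subring.mem_iInf.1 h2 ρ : _)
  obtain ⟨σ, τ, h⟩ := exists_comp_fixedPt ρ I
  have h3 : ∀ p : PolyGzy n k, permPoly ρ (subst I p) = subst (permSub ρ I)
      (MvPolynomial.rename (Sum.map σ τ) (permZ n k ρ p)) := by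
    intro p
    induction p using MvPolynomial.induction_on with
    | C a =>
      simp only [subst, permZ, MvPolynomial.map_C, MvPolynomial.rename_C, MvPolynomial.aeval_C]
      rfl
    | add p q hp hq => simp only [map_add, hp, hq]
    | mul_X p g hp =>
      simp only [map_mul, hp]
      congr 1
      simp only [subst, permZ, MvPolynomial.map_X, MvPolynomial.rename_X, MvPolynomial.aeval_X,
        permPoly_X, Option.map_some, h]
  rw [h3, hz, h1 σ τ]

theorem algebraMap_PolyZY_mem_Az (p : PolyZY n) : algebraMap (PolyZY n) (RatK n) p ∈ Az n := by
  rw [← polyK_C]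
  exact polyK_mem_Az _

/-- The class in `H^*_{GL_n × ℂ^×}` of an invariant polynomial. -/
def classGL (f : InvGL n k) : HGL n k := Ideal.Quotient.mk (relGL n k) f

theorem HGLtoHT_classGL (f : InvGL n k) : HGLtoHT n k (classGL f) = classT (inclInv n k f) := rfl

theorem coe_LocL_classGL (I : Sub n k) (a : Lfull n) (f : InvGL n k) :
    (LocL I (a ⊗ₜ HGLtoHT n k (classGL f)) : RatK n)
      = a * algebraMap (PolyZY n) (RatK n) (subst I (f : PolyGzy n k)) := by
  rw [HGLtoHT_classGL, LocL_tmul, Loc_classT]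
  rfl

theorem isInvFam_of_mem_HGLk {x : Lfull n ⊗[PolyZY n] HT n k} (hx : x ∈ HGLk n k) :
    IsInvFam fun I : Sub n k => (LocL I x : RatK n) := by
  induction hx using Submodule.span_induction with
  | mem x hx =>
    obtain ⟨a, y, ha, rfl⟩ := hx
    obtain ⟨f, rfl⟩ : ∃ f, classGL f = y := Ideal.Quotient.mk_surjective y
    simp only [coe_LocL_classGL]
    refine ⟨fun I => mul_mem (mem_Az_of_mem_Lsmall ha) (algebraMap_PolyZY_mem_Az _), fun ρ I => ?_⟩
    rw [map_mul, permK_of_mem_Lsmall ρ ha, permK_algebraMap, permPoly_subst f.2]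
  | zero =>
    simp only [map_zero]
    exact ⟨fun I => zero_mem (Az n), fun ρ I => map_zero _⟩
  | add x y _ _ hx hy =>
    simp only [map_add]
    refine ⟨fun I => add_mem (hx.1 I) (hy.1 I), fun ρ I => ?_⟩
    exact (map_add (permK ρ) _ _).trans (congrArg₂ (· + ·) (hx.2 ρ I) (hy.2 ρ I))
  | smul c x _ hx =>
    have h : ∀ I : Sub n k, (LocL I (c • x) : RatK n) = algebraMap ℂ (RatK n) c * LocL I x := by
      intro I
      have h1 : c • x = algebraMap ℂ (Lfull n) c • x := (algebraMap_smul (Lfull n) c x).symm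
      rw [h1, map_smul]
      rfl
    simp only [h]
    refine ⟨fun I => mul_mem (complex_mem_Az n c) (hx.1 I), fun ρ I => ?_⟩
    rw [map_mul, permK_complex]
    exact congrArg _ (hx.2 ρ I)

theorem Lsmall_le_Lfull {x : RatK n} (hx : x ∈ Lsmall n) : x ∈ Lfull n := by
  induction hx using Algebra.adjoin_induction with
  | mem x hx =>
    rcases hx with (rfl | rfl | rfl) | ⟨l, rfl⟩
    · exact (lamL n).2
    · exact (yL n).2
    · exact inv_algebraMap_mem_Lfull _
    · exact (invL n l).2
  | algebraMap c =>
    rw [IsScalarTower.algebraMap_apply ℂ (FieldZY n) (RatK n)]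
    exact (Lfull n).algebraMap_mem _
  | add x y _ _ hx hy => exact add_mem hx hy
  | mul x y _ _ hx hy => exact mul_mem hx hy

/-- The average of a monomial in `Γ`. -/
def avgMonomial (I₀ : Sub n k) (m : Fin n →₀ ℕ) : InvGL n k :=
  ⟨avg n k (MvPolynomial.rename (fixedEquiv I₀).symm (MvPolynomial.monomial m 1)),
    (avg n k _).2, by
      -- The averaged monomial involves only Γ and a complex constant.
      refine Subring.mem_iInf.2 fun ρ => ?_
      change permZ n k ρ _ = _
      rw [avg_apply]
      simp only [MvPolynomial.rename_monomial, MvPolynomial.smul_eq_C_mul, map_mul, map_sum, permZ,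
        MvPolynomial.map_monomial, MvPolynomial.map_C]
      simp⟩

theorem algebraMap_subst_avgMonomial (I₀ I : Sub n k) (m : Fin n →₀ ℕ) :
    algebraMap (PolyZY n) (RatK n) (subst I (avgMonomial I₀ m : PolyGzy n k))
      = avgFam I₀ (MvPolynomial.monomial m 1) I := by
  have h : (avgMonomial I₀ m : PolyGzy n k) = (avg n k
      (MvPolynomial.rename (fixedEquiv I₀).symm (MvPolynomial.monomial m 1)) : PolyGzy n k) := rfl
  rw [h, avg_apply, map_smul, map_sum, smul_eq_mul, map_mul, map_sum, avgFam]
  congr 1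
  refine Finset.sum_congr rfl fun w _ => ?_
  rw [permK_aeval, MvPolynomial.rename_rename, subst, MvPolynomial.aeval_rename,
    MvPolynomial.aeval_monomial, MvPolynomial.aeval_monomial, map_one, map_one, one_mul, one_mul,
    Finsupp.prod, Finsupp.prod, map_prod]
  refine Finset.prod_congr rfl fun a _ => ?_
  rw [permK_zK, transPerm_apply, map_pow]
  rfl

/-- It suffices to treat monomials, since the coefficients are fixed by permutations of z and can be
pulled out of the average. -/
theorem exists_mem_HGLk_avgFam (I₀ : Sub n k) (p : MvPolynomial (Fin n) (Lsmall n)) :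
    ∃ x ∈ HGLk n k, ∀ I : Sub n k, (LocL I x : RatK n) = avgFam I₀ p I := by
  induction p using MvPolynomial.induction_on' with
  | monomial m c =>
    refine ⟨(⟨c, Lsmall_le_Lfull c.2⟩ : Lfull n) ⊗ₜ HGLtoHT n k (classGL (avgMonomial I₀ m)),
      Submodule.subset_span ⟨_, _, c.2, rfl⟩, fun I => ?_⟩
    rw [coe_LocL_classGL, algebraMap_subst_avgMonomial, avgFam, avgFam]
    have h : (MvPolynomial.monomial m c : MvPolynomial (Fin n) (Lsmall n))
        = c • MvPolynomial.monomial m 1 := by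
      rw [MvPolynomial.smul_monomial, smul_eq_mul, mul_one]
    rw [h, mul_left_comm, Finset.mul_sum]
    congr 1
    refine Finset.sum_congr rfl fun w _ => ?_
    rw [map_smul, Algebra.smul_def, map_mul]
    exact congrArg (· * _) (permK_of_mem_Lsmall _ c.2).symm
  | add p q hp hq =>
    obtain ⟨x, hx, hx'⟩ := hp
    obtain ⟨y, hy, hy'⟩ := hq
    refine ⟨x + y, add_mem hx hy, fun I => ?_⟩
    rw [map_add, Subalgebra.coe_add, hx', hy']
    simp only [avgFam, map_add, Finset.sum_add_distrib, mul_add]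

/-- Conversely, the class built from the polynomial value at one fixed point has the right
restrictions everywhere, and restrictions determine the class. -/
theorem mem_HGLk_iff (hk : k ≤ n) {x : Lfull n ⊗[PolyZY n] HT n k} :
    x ∈ HGLk n k ↔ IsInvFam fun I : Sub n k => (LocL I x : RatK n) := by
  refine ⟨isInvFam_of_mem_HGLk, fun h => ?_⟩
  obtain ⟨p, hp⟩ := exists_aeval_of_mem_Az (h.1 (topSub hk))
  obtain ⟨y, hy, hy'⟩ := exists_mem_HGLk_avgFam (topSub hk) p
  have : x = y := LocL_injective hk fun I => Subtype.ext (by rw [hy', h.eq_avgFam hp])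
  rwa [this]

end Equivariant

/-! ### The stable envelope map -/

section Stab
variable {n k : ℕ}

theorem W_mem (S : Subring (RatK n)) {I : Finset (Fin n)} (hI : I.card = k) {lam y : RatK n}
    {t : Fin k → RatK n} {z : Fin n → RatK n} (hlam : lam ∈ S) (hy : y ∈ S) (ht : ∀ r, t r ∈ S)
    (hz : ∀ a, z a ∈ S) (hinv : ∀ a b, (t a - t b)⁻¹ ∈ S) : W I hI lam t z y ∈ S := by
  refine mul_mem (pow_mem hy _) (sum_mem fun σ _ => mul_mem
    (prod_mem fun r _ => prod_mem fun a _ => ?_) (prod_mem fun a _ => prod_mem fun b _ => ?_))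
  · unfold lfac
    split_ifs
    · exact add_mem (sub_mem (ht _) (hz _)) hy
    · exact sub_mem (sub_mem (add_mem hlam (ht _)) (hz _)) (mul_mem (intCast_mem _ _) hy)
    · exact sub_mem (ht _) (hz _)
  · rw [div_eq_mul_inv]
    exact mul_mem (add_mem (sub_mem (ht _) (ht _)) hy) (hinv _ _)

theorem zK_mem_Lfull (a : Fin n) : zK n a ∈ Lfull n := (zL n a).2

theorem yK_mem_Lfull (n : ℕ) : yK n ∈ Lfull n := (yL n).2

theorem W_mem_Lfull {lam : RatK n} (hlam : lam ∈ Lfull n) {J : Finset (Fin n)} (hJ : J.card = k)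
    (I : Sub n k) (σ : Equiv.Perm (Fin n)) :
    W J hJ lam (zSub I) (fun a => zK n (σ a)) (yK n) ∈ Lfull n := by
  refine W_mem (Lfull n).toSubring hJ hlam (yK_mem_Lfull n) (fun r => zK_mem_Lfull _)
    (fun a => zK_mem_Lfull _) fun a b => ?_
  have := inv_algebraMap_mem_Lfull (n := n) (MvPolynomial.X (some (I.1.orderEmbOfFin I.2 a))
    - MvPolynomial.X (some (I.1.orderEmbOfFin I.2 b)))
  rwa [map_sub] at this

theorem inv_ek_mem_Lfull (I : Sub n k) : (ek (zSub I) (yK n))⁻¹ ∈ Lfull n := by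
  have : ek (zSub I) (yK n) = algebraMap (PolyZY n) (RatK n)
      (∏ a : Fin k, ∏ b : Fin k, (MvPolynomial.X (some (I.1.orderEmbOfFin I.2 a))
        - MvPolynomial.X (some (I.1.orderEmbOfFin I.2 b)) + MvPolynomial.X none)) := by
    simp only [map_prod, map_sub, map_add, ek, zSub, zK, yK]
  rw [this]
  exact inv_algebraMap_mem_Lfull _

theorem inv_QI_mem_Lfull (I : Sub n k) : (QI I)⁻¹ ∈ Lfull n := by
  have : QI I = algebraMap (PolyZY n) (RatK n) (∏ a ∈ I.1, ∏ b ∈ I.1ᶜ,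
      (MvPolynomial.X (some a) - MvPolynomial.X (some b) + MvPolynomial.X none)) := by
    simp only [map_prod, map_sub, map_add, QI, zK, yK]
  rw [this]
  exact inv_algebraMap_mem_Lfull _

theorem plusAt_mem_Lfull (J : Finset (Fin n)) (I : Sub n k) : plusAt J I ∈ Lfull n := by
  by_cases hJ : J.card = k
  · rw [plusAt_of_card J I hJ, div_eq_mul_inv, mul_inv, mul_inv]
    exact mul_mem (W_mem_Lfull (lamL n).2 hJ I 1) (mul_mem (mul_mem
      (Lsmall_le_Lfull (inv_Cfac_mem_Lsmall _ _)) (Lsmall_le_Lfull (inv_Cfac_mem_Lsmall _ _)))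
      (inv_ek_mem_Lfull I))
  · rw [plusAt_of_card_ne J I hJ]
    exact zero_mem _

theorem xi_mem_Lfull (I : Sub n k) (J : Finset (Fin n)) : xi I J ∈ Lfull n := by
  by_cases hJ : J.card = k
  · rw [xi, dif_pos hJ, Wminus, div_eq_mul_inv, div_eq_mul_inv, one_mul]
    refine mul_mem (inv_QI_mem_Lfull I) (mul_mem (mul_mem
      (pow_mem (neg_mem (one_mem (Lfull n))) _) (inv_ek_mem_Lfull I)) ?_)
    refine W_mem_Lfull ?_ _ I Fin.revPerm
    exact sub_mem (neg_mem (lamL n).2) (mul_mem (sub_mem (natCast_mem (Lfull n) n)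
      (mul_mem (natCast_mem (Lfull n) 2) (natCast_mem (Lfull n) k))) (yK_mem_Lfull n))
  · rw [xi_of_card_ne I J hJ]
    exact zero_mem _

/-- The restrictions of the stable envelope to the fixed points. -/
def stabFam (n : ℕ) : V n →ₗ[Lfull n] ∀ k : Fin (n + 1), Sub n k → Lfull n where
  toFun ζ k I := ∑ J, ζ J * ⟨plusAt J I, plusAt_mem_Lfull J I⟩
  map_add' ζ η := by
    funext k I
    simp only [Pi.add_apply, add_mul, Finset.sum_add_distrib]
  map_smul' c ζ := by
    funext k I
    simp only [Pi.smul_apply, smul_eq_mul, RingHom.id_apply, Finset.mul_sum, mul_assoc]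

theorem coe_stabFam (ζ : V n) (k : Fin (n + 1)) (I : Sub n k) :
    (stabFam n ζ k I : RatK n) = locSum (coords ζ) I :=
  map_sum (algebraMap (Lfull n) (RatK n)) _ _

theorem card_lt (K : Finset (Fin n)) : K.card < n + 1 := by
  have := Finset.card_le_univ K
  rw [Fintype.card_fin] at this
  omega

/-- The inversion formula `eq_sum_locSum` recovers each coordinate; surjectivity is the other half
of orthogonality, `locSum_sum_xi`. -/
theorem stabFam_injective : Function.Injective (stabFam n) := by
  intro ζ η h
  funext K
  apply Subtype.ext
  let k : Fin (n + 1) := ⟨K.card, card_lt K⟩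
  have h1 : ∀ I : Sub n k, locSum (coords ζ) I = locSum (coords η) I := fun I => by
    rw [← coe_stabFam, ← coe_stabFam, h]
  have h2 := eq_sum_locSum (coords ζ) (⟨K, rfl⟩ : Sub n k)
  have h3 := eq_sum_locSum (coords η) (⟨K, rfl⟩ : Sub n k)
  simp only [h1] at h2
  exact h2.trans h3.symm

theorem famVec_mem_Lfull {g : Sub n k → RatK n} (hg : ∀ I, g I ∈ Lfull n) (K : Finset (Fin n)) :
    famVec g K ∈ Lfull n :=
  sum_mem fun I _ => by
    rw [div_eq_mul_inv]
    exact mul_mem (mul_mem (hg I) (inv_RI_mem_Lfull I)) (xi_mem_Lfull I K)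

theorem locSum_congr {ζ η : Finset (Fin n) → RatK n} (I : Sub n k)
    (h : ∀ J : Finset (Fin n), J.card = k → ζ J = η J) : locSum ζ I = locSum η I := by
  refine Finset.sum_congr rfl fun J _ => ?_
  by_cases hJ : J.card = k
  · rw [h J hJ]
  · rw [plusAt_of_card_ne J I hJ, mul_zero, mul_zero]

theorem stabFam_surjective : Function.Surjective (stabFam n) := by
  intro g
  let ζ : V n := fun K => ⟨famVec (fun I : Sub n (⟨K.card, card_lt K⟩ : Fin (n + 1)) =>
    (g ⟨K.card, card_lt K⟩ I : RatK n)) K, famVec_mem_Lfull (fun I => (g _ I).2) K⟩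
  refine ⟨ζ, ?_⟩
  funext k I
  apply Subtype.ext
  rw [coe_stabFam, ← locSum_sum_xi (fun I : Sub n k => (g k I : RatK n)) I]
  refine locSum_congr I fun J hJ => ?_
  obtain rfl : (⟨J.card, card_lt J⟩ : Fin (n + 1)) = k := Fin.ext hJ
  rfl

/-- The stable envelope map. -/
def stab (n : ℕ) : V n ≃ₗ[Lfull n] HX n :=
  (LinearEquiv.ofBijective (stabFam n) ⟨stabFam_injective, stabFam_surjective⟩).trans
    (LinearEquiv.piCongrRight fun k => (locEquiv (Nat.lt_succ_iff.1 k.2)).symm)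

theorem coe_LocL_stab (ζ : V n) (k : Fin (n + 1)) (I : Sub n k) :
    (LocL I (stab n ζ k) : RatK n) = locSum (coords ζ) I := by
  have h : stab n ζ k = (locEquiv (Nat.lt_succ_iff.1 k.2)).symm (stabFam n ζ k) := rfl
  rw [h, ← locEquiv_apply (Nat.lt_succ_iff.1 k.2), LinearEquiv.apply_symm_apply, coe_stabFam]

theorem locSum_single (J : Finset (Fin n)) (I : Sub n k) :
    locSum (coords (Pi.single J 1)) I = plusAt J I := by
  rw [locSum, Finset.sum_eq_single J]
  · simp [coords]
  · intro K _ hK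
    simp [coords, hK]
  · simp

theorem isStab_stab (n : ℕ) : IsStab (stab n) := by
  refine fun I k => ⟨fun hI J => ?_, fun hI => ?_⟩
  · rw [coe_LocL_stab, locSum_single, plusAt, dif_pos hI]
  · refine LocL_injective (Nat.lt_succ_iff.1 k.2) fun J => Subtype.ext ?_
    rw [coe_LocL_stab, locSum_single, plusAt_of_card_ne I J hI, map_zero]
    rfl

theorem IsStab.unique {S S' : V n ≃ₗ[Lfull n] HX n} (h : IsStab S) (h' : IsStab S') : S' = S := by
  refine LinearEquiv.toLinearMap_injective (LinearMap.pi_ext' fun I => LinearMap.ext_ring ?_)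
  funext k
  change S' (Pi.single I 1) k = S (Pi.single I 1) k
  by_cases hI : I.card = k
  · exact LocL_injective (Nat.lt_succ_iff.1 k.2) fun J => Subtype.ext
      (((h' I k).1 hI J).trans ((h I k).1 hI J).symm)
  · rw [(h I k).2 hI, (h' I k).2 hI]

/-- By construction the restrictions of the stable envelope of ζ are the `locSum` of ζ, so both
conditions say that these form equivariant polynomial families. -/
theorem stab_mem_HGLsub_iff {ζ : V n} : stab n ζ ∈ HGLsub n ↔ IsInvVec (coords ζ) := by
  rw [isInvVec_iff, HGLsub, Submodule.mem_pi]
  simp only [Set.mem_univ, true_imp_iff]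
  refine forall_congr' fun k => ?_
  rw [mem_HGLk_iff (Nat.lt_succ_iff.1 k.2)]
  simp only [coe_LocL_stab]

end Stab

end DynGr
end

theorem mainTheorem11 (n : ℕ) :
    ∃ S : DynGr.V n ≃ₗ[DynGr.Lfull n] DynGr.HX n,
      DynGr.IsStab S ∧ (∀ S' : DynGr.V n ≃ₗ[DynGr.Lfull n] DynGr.HX n, DynGr.IsStab S' → S' = S) ∧
      (∀ a ∈ DynGr.operatorAlgebra n, ∀ x ∈ DynGr.HGLsub n, S (a (S.symm x)) ∈ DynGr.HGLsub n) ∧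
      (∀ a ∈ DynGr.operatorAlgebra n, ∀ ζ ∈ DynGr.Vsub n, a ζ ∈ DynGr.Vsub n) ∧
      (∀ ζ : DynGr.V n, ζ ∈ DynGr.Vsub n ↔ S ζ ∈ DynGr.HGLsub n) := by
  refine ⟨DynGr.stab n, DynGr.isStab_stab n, fun S' h => (DynGr.isStab_stab n).unique h,
    fun a ha x hx => ?_, fun a ha ζ hζ => ?_, fun ζ => ?_⟩
  · rw [DynGr.stab_mem_HGLsub_iff]
    refine DynGr.isInvVec_operatorAlgebra ha _ (DynGr.stab_mem_HGLsub_iff.1 ?_)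
    rwa [LinearEquiv.apply_symm_apply]
  · rw [DynGr.mem_Vsub_iff] at hζ ⊢
    exact DynGr.isInvVec_operatorAlgebra ha ζ hζ
  · rw [DynGr.mem_Vsub_iff, DynGr.stab_mem_HGLsub_iff]
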